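/- **Theorem (quantum-enhanced classical simulation).** *Setting.* For a Pauli operator $P\in\{I,X,Y,Z\}^{\otimes n}$ let $|P|$ be its weight (number of non-identity factors). For a Hermitian $O=\sum_P a_PP$ put $\|O\|_{\mathrm{Pauli},2}=(\sum_P|a_P|^2)^{1/2}$, and let $\|O\|$ be the operator norm. A distribution of a random unitary $U$ on a set of qubits is *locally scrambling* if $\mathbb E[U^{\otimes2}\otimes U^{*\otimes2}]$ ($^*$ is entrywise conjugation) does not change when $U$ is replaced by $(\bigotimes_iV_i)U$ with independent uniformly random single-qubit Cliffords $V_i$. An *$L$-layered locally scrambling circuit* on $n$ qubits is a random $U=U_LU_{L-1}\cdots U_1$, $L\ge 1$, with independent layers such that $U_1$ is locally scrambling on all $n$ qubits; for $j\ge2$, $U_j=V_{A_j}\otimes I$ with $V_{A_j}$ locally scrambling on a set $A_j$ of qubits; and, for a constant $b$, almost surely and for all $j$ and $P$, a fixed classical procedure computes from a classical description of the sampled circuit a Pauli expansion of $U_j^\dagger PU_j$ with at most $n^{b(|P|+1)}$ terms in at most $n^{b(|P|+1)}$ steps. Classical computations are programs of a real RAM, i.e. a random access machine with exact real arithmetic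 at unit cost and without rounding. Assume moreover that almost surely $U_1$ is a tensor product of gates acting on disjoint sets of at most $a$ qubits, for a constant $a$. *Data.* Let $O$ be an unknown observable (a Hermitian operator) and $\rho$ an unknown state on $n$ qubits. One *randomized measurement of $\rho$* measures every qubit of a copy of $\rho$ in an independent uniformly random Pauli basis and records bases and outcomes. One *randomized measurement of $O$* measures $O$ on a uniformly random tensor product of single-qubit stabilizer states and records the state and the outcome. *Claim.* There are constants $C_1,C_2>0$ that depend only on $a$ and $b$, and for each procedure as above one classical algorithm $\mathcal A$, such that the following holds for all $n\ge2$, $L\ge1$, all $L$-layered locally scrambling circuits as above, and all $\epsilon,\delta\in(0,1)$. Let $M=\lceil n^{C_1(1+\log(\epsilon^{-1}\delta^{-1}))}\rceil$. Given $n$, $L$, $\epsilon$, $\delta$, the description of $U$, and the records of $M$ randomized measurements of $\rho$ and $M$ of $O$ (all independent of each other and of $U$), the algorithm $\mathcal A$ halts, for almost every circuit and for every measurement record, within $L\cdot n^{C_2(1+\log(\epsilon^{-1}\delta^{-1}))}$ steps. For all $O$ and $\rho$ its output $\alpha$ satisfies $$\bigl|\alpha-\operatorname{Tr}[OU\rho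 U^\dagger]\bigr|\le\epsilon\,\|O\|_{\mathrm{Pauli},2}\le\epsilon\,\|O\|$$ with probability at least $1-\delta$ over the circuit and the measurements. -/

import Mathlib

open MeasureTheory
open scoped Kronecker ComplexOrder

/-! ## Qubits, Pauli operators, norms -/

/-- Computational basis labels of a register of qubits indexed by `ι`. -/
abbrev Bits (ι : Type) := ι → Fin 2

/-- Operators on the register of qubits indexed by `ι`. -/
abbrev QOp (ι : Type) := Matrix (Bits ι) (Bits ι) ℂ

/-- The unitary group of the register of qubits indexed by `ι`. -/
abbrev QUnitary (ι : Type) [Fintype ι] [DecidableEq ι] := Matrix.unitaryGroup (Bits ι) ℂ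

/-- Probability distributions over the unitary group are Borel measures. -/
noncomputable instance {ι : Type} [Fintype ι] [DecidableEq ι] : MeasurableSpace (QUnitary ι) :=
  borel _

instance {ι : Type} [Fintype ι] [DecidableEq ι] : BorelSpace (QUnitary ι) :=
  ⟨rfl⟩

/-- The tensor product of single-qubit operators. -/
def tensorOp {ι : Type} [Fintype ι] (A : ι → Matrix (Fin 2) (Fin 2) ℂ) : QOp ι :=
  Matrix.of fun x y => ∏ i, A i (x i) (y i)

/-- The single-qubit Pauli matrices `I, X, Y, Z`, numbered `0, 1, 2, 3`. -/
def pauliOne : Fin 4 → Matrix (Fin 2) (Fin 2) ℂ :=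
  ![1, !![0, 1; 1, 0], !![0, -Complex.I; Complex.I, 0], !![1, 0; 0, -1]]

/-- The Pauli operator with the given letters. -/
def pauliOp {ι : Type} [Fintype ι] (P : ι → Fin 4) : QOp ι :=
  tensorOp fun i => pauliOne (P i)

/-- The weight: the number of non-identity letters. -/
def pauliWeight {n : ℕ} (P : Fin n → Fin 4) : ℕ :=
  (Finset.univ.filter fun i => P i ≠ 0).card

/-- The coefficient `a_P = Tr[P O] / 2^n` of `P` in the Pauli expansion of `O`. -/
noncomputable def pauliCoeff {n : ℕ} (O : QOp (Fin n)) (P : Fin n → Fin 4) : ℂ :=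
  (pauliOp P * O).trace / 2 ^ n

/-- The norm `‖O‖_{Pauli,2}`: the `ℓ²` norm of the Pauli coefficients. -/
noncomputable def pauliNorm {n : ℕ} (O : QOp (Fin n)) : ℝ :=
  Real.sqrt (∑ P : Fin n → Fin 4, ‖pauliCoeff O P‖ ^ 2)

/-- Quantum states (density matrices). -/
def IsState {n : ℕ} (ρ : QOp (Fin n)) : Prop :=
  ρ.PosSemidef ∧ ρ.trace = 1

/-! ## Locally scrambling circuits -/

/-- The Hadamard gate. -/
noncomputable def hadamardGate : Matrix (Fin 2) (Fin 2) ℂ :=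
  ((Real.sqrt 2 : ℝ) : ℂ)⁻¹ • !![1, 1; 1, -1]

/-- The phase gate. -/
def phaseGate : Matrix (Fin 2) (Fin 2) ℂ := !![1, 0; 0, Complex.I]

/-- Labels of the 24 elements of the single-qubit Clifford group modulo global phases. -/
abbrev CliffordLabel := Fin 4 × Fin 3 × Fin 2

/-- Representatives of the single-qubit Clifford group modulo global phases. The group acts on the
axes `X, Y, Z` as the symmetric group on three letters, with `S * H` acting as a 3-cycle and `H` as
a transposition, and the kernel of this action is the Pauli group, so every Clifford unitary is, up
to a phase, `P * (S * H)^r * H^h` for exactly one label `(P, r, h)`. -/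
noncomputable def cliffordOne (v : CliffordLabel) : Matrix (Fin 2) (Fin 2) ℂ :=
  pauliOne v.1 * (phaseGate * hadamardGate) ^ (v.2.1 : ℕ) * hadamardGate ^ (v.2.2 : ℕ)

/-- The operator `U ⊗ U ⊗ U^* ⊗ U^*`, with `U^*` the entrywise complex conjugate. -/
def doubled {κ : Type} (U : Matrix κ κ ℂ) :
    Matrix ((κ × κ) × (κ × κ)) ((κ × κ) × (κ × κ)) ℂ :=
  (U ⊗ₖ U) ⊗ₖ (U.map star ⊗ₖ U.map star)

/-- A distribution over unitaries is locally scrambling if its second moment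
`E_U[U ⊗ U ⊗ U^* ⊗ U^*]` does not change when `U` is post-processed by independent uniformly random
single-qubit Clifford gates, that is, when `U` is replaced by `(⨂ V_i) U`. -/
def IsLocallyScrambling {ι : Type} [Fintype ι] [DecidableEq ι] (μ : Measure (QUnitary ι)) : Prop :=
  ∀ r c, ∫ U, doubled (U : QOp ι) r c ∂μ =
    ∫ U, (Fintype.card (ι → CliffordLabel) : ℂ)⁻¹ *
      ∑ V : ι → CliffordLabel,
        doubled (tensorOp (fun i => cliffordOne (V i)) * (U : QOp ι)) r c ∂μ

/-- The unitary `V_A ⊗ I` on `n` qubits that acts as `V` on the qubits in `A` and trivially on the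
other ones. -/
def actOn {n : ℕ} (A : Finset (Fin n)) (V : QUnitary {i // i ∈ A}) : QUnitary (Fin n) :=
  ⟨((V : QOp {i // i ∈ A}) ⊗ₖ (1 : QOp {i // i ∉ A})).submatrix
      (Equiv.piEquivPiSubtypeProd (fun i => i ∈ A) fun _ => Fin 2)
      (Equiv.piEquivPiSubtypeProd (fun i => i ∈ A) fun _ => Fin 2), by
    have h : ((V : QOp {i // i ∈ A}) ⊗ₖ (1 : QOp {i // i ∉ A})) ∈ Matrix.unitaryGroup _ ℂ :=
      Matrix.kronecker_mem_unitary V.2 (one_mem _)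
    rw [Matrix.mem_unitaryGroup_iff] at h ⊢
    rw [Matrix.star_eq_conjTranspose] at h ⊢
    rw [Matrix.conjTranspose_submatrix, Matrix.submatrix_mul_equiv, h, Matrix.submatrix_one_equiv]⟩

/-- The circuit `U = U_L ⋯ U_2 U_1`; the layer `U_{j+1}` has index `j`. -/
def circuitProd {n L : ℕ} (U : Fin L → QUnitary (Fin n)) : QUnitary (Fin n) :=
  (List.ofFn U).reverse.prod

/-- The exact value `f_U(O) = Tr[O U ρ U^†]`. -/
def expectationValue {n L : ℕ} (O ρ : QOp (Fin n)) (U : Fin L → QUnitary (Fin n)) : ℝ :=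
  (O * (circuitProd U : QOp (Fin n)) * ρ * (circuitProd U : QOp (Fin n)).conjTranspose).trace.re

/-- `U` is a tensor product of gates acting on pairwise disjoint sets of at most `a` qubits. The
qubit `i` belongs to the block with label `B i`. -/
def IsGateLayer {n : ℕ} (a : ℕ) (U : QUnitary (Fin n)) : Prop :=
  ∃ B : Fin n → Fin n, (∀ q, (Finset.univ.filter fun i => B i = q).card ≤ a) ∧
    ∃ g : ∀ q : Fin n, QUnitary {i : Fin n // B i = q},
      ∀ x y : Bits (Fin n), (U : QOp (Fin n)) x y =
        ∏ q, (g q : QOp {i : Fin n // B i = q}) (fun i => x i) (fun i => y i)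

/-! ## The classical computer: a real RAM

Programs work on two-dimensional arrays of natural numbers and of real numbers. Arrays are named by
natural numbers and are zero where nothing has been written. A cell access, an arithmetic operation
on indices (addition, truncated subtraction) or on reals (`+`, `-`, `*`, `/`) and a comparison cost
one step each. There is no rounding of reals to integers and no multiplication of indices. The
description of the circuit is a read-only input. -/

/-- A read-only classical description of a circuit: row `j` holds natural and real parameters. -/
structure CircuitDesc where
  nat : ℕ → ℕ → ℕ
  real : ℕ → ℕ → ℝ

/-- The memory: `nat x i j` and `real x i j` are the entries `(i, j)` of the arrays named `x`. -/
structure Store where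
  nat : ℕ → ℕ → ℕ → ℕ
  real : ℕ → ℕ → ℕ → ℝ

/-- Index expressions. -/
inductive NExp where
  | lit (k : ℕ)
  | get (x : ℕ) (i j : NExp)
  | desc (i j : NExp)
  | add (e f : NExp)
  | sub (e f : NExp)

/-- Real expressions. -/
inductive RExp where
  | ofNat (e : NExp)
  | get (x : ℕ) (i j : NExp)
  | desc (i j : NExp)
  | add (e f : RExp)
  | sub (e f : RExp)
  | mul (e f : RExp)
  | div (e f : RExp)

/-- Tests. -/
inductive Test where
  | natLt (e f : NExp)
  | realLt (e f : RExp)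

/-- Programs. -/
inductive Prog where
  | setNat (x : ℕ) (i j e : NExp)
  | setReal (x : ℕ) (i j : NExp) (e : RExp)
  | seq (p q : Prog)
  | ite (b : Test) (p q : Prog)
  | loop (b : Test) (p : Prog)
  | call (q : Prog) (x y z : ℕ)

def NExp.eval (w : CircuitDesc) (s : Store) : NExp → ℕ
  | .lit k => k
  | .get x i j => s.nat x (i.eval w s) (j.eval w s)
  | .desc i j => w.nat (i.eval w s) (j.eval w s)
  | .add e f => e.eval w s + f.eval w s
  | .sub e f => e.eval w s - f.eval w s

def NExp.cost : NExp → ℕ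
  | .lit _ => 1
  | .get _ i j => 1 + i.cost + j.cost
  | .desc i j => 1 + i.cost + j.cost
  | .add e f => 1 + e.cost + f.cost
  | .sub e f => 1 + e.cost + f.cost

noncomputable def RExp.eval (w : CircuitDesc) (s : Store) : RExp → ℝ
  | .ofNat e => (e.eval w s : ℝ)
  | .get x i j => s.real x (i.eval w s) (j.eval w s)
  | .desc i j => w.real (i.eval w s) (j.eval w s)
  | .add e f => e.eval w s + f.eval w s
  | .sub e f => e.eval w s - f.eval w s
  | .mul e f => e.eval w s * f.eval w s
  | .div e f => e.eval w s / f.eval w s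

def RExp.cost : RExp → ℕ
  | .ofNat e => 1 + e.cost
  | .get _ i j => 1 + i.cost + j.cost
  | .desc i j => 1 + i.cost + j.cost
  | .add e f => 1 + e.cost + f.cost
  | .sub e f => 1 + e.cost + f.cost
  | .mul e f => 1 + e.cost + f.cost
  | .div e f => 1 + e.cost + f.cost

def Test.holds (w : CircuitDesc) (s : Store) : Test → Prop
  | .natLt e f => e.eval w s < f.eval w s
  | .realLt e f => e.eval w s < f.eval w s

def Test.cost : Test → ℕ
  | .natLt e f => 1 + e.cost + f.cost
  | .realLt e f => 1 + e.cost + f.cost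

def Store.setNat (s : Store) (x i j v : ℕ) : Store :=
  ⟨fun x' i' j' => if x' = x ∧ i' = i ∧ j' = j then v else s.nat x' i' j', s.real⟩

def Store.setReal (s : Store) (x i j : ℕ) (v : ℝ) : Store :=
  ⟨s.nat, fun x' i' j' => if x' = x ∧ i' = i ∧ j' = j then v else s.real x' i' j'⟩

/-- The memory in which a procedure with argument `f` starts: natural-number array `0` is `f`,
everything else is zero. -/
def Store.ofArg (f : ℕ → ℕ → ℕ) : Store :=
  ⟨fun x => if x = 0 then f else fun _ _ => 0, fun _ _ _ => 0⟩

/-- The memory of the caller `s` after a procedure has stopped in `s'`: the arrays number `0` of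
the procedure become the arrays `y` (natural numbers) and `z` (reals) of the caller. -/
def Store.afterCall (s s' : Store) (y z : ℕ) : Store :=
  ⟨fun x => if x = y then s'.nat 0 else s.nat x, fun x => if x = z then s'.real 0 else s.real x⟩

/-- `Exec w p s t s'`: on the circuit description `w`, the program `p` started in the memory `s`
stops after `t` steps in the memory `s'`. A procedure `call q x y z` runs `q` in a fresh memory on
the argument array `x` and returns its result in the arrays `y` and `z`. -/
inductive Exec (w : CircuitDesc) : Prog → Store → ℕ → Store → Prop
  | setNat (x : ℕ) (i j e : NExp) (s : Store) :
      Exec w (.setNat x i j e) s (1 + i.cost + j.cost + e.cost)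
        (s.setNat x (i.eval w s) (j.eval w s) (e.eval w s))
  | setReal (x : ℕ) (i j : NExp) (e : RExp) (s : Store) :
      Exec w (.setReal x i j e) s (1 + i.cost + j.cost + e.cost)
        (s.setReal x (i.eval w s) (j.eval w s) (e.eval w s))
  | seq {p q : Prog} {s s₁ s₂ : Store} {t u : ℕ} :
      Exec w p s t s₁ → Exec w q s₁ u s₂ → Exec w (.seq p q) s (t + u) s₂
  | iteTrue {b : Test} {p : Prog} (q : Prog) {s s₁ : Store} {t : ℕ} :
      b.holds w s → Exec w p s t s₁ → Exec w (.ite b p q) s (b.cost + t) s₁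
  | iteFalse {b : Test} (p : Prog) {q : Prog} {s s₁ : Store} {t : ℕ} :
      ¬ b.holds w s → Exec w q s t s₁ → Exec w (.ite b p q) s (b.cost + t) s₁
  | loopStop {b : Test} (p : Prog) {s : Store} :
      ¬ b.holds w s → Exec w (.loop b p) s b.cost s
  | loopStep {b : Test} {p : Prog} {s s₁ s₂ : Store} {t u : ℕ} :
      b.holds w s → Exec w p s t s₁ → Exec w (.loop b p) s₁ u s₂ →
        Exec w (.loop b p) s (b.cost + t + u) s₂
  | call {q : Prog} {s s₁ : Store} {t : ℕ} (x y z : ℕ) :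
      Exec w q (Store.ofArg (s.nat x)) t s₁ →
        Exec w (.call q x y z) s (1 + t) (s.afterCall s₁ y z)

/-- Programs are deterministic: the running time and the result are determined by the input. -/
theorem Exec.deterministic {w : CircuitDesc} {p : Prog} {s s₁ s₂ : Store} {t₁ t₂ : ℕ}
    (h₁ : Exec w p s t₁ s₁) (h₂ : Exec w p s t₂ s₂) : t₁ = t₂ ∧ s₁ = s₂ := by
  induction h₁ generalizing t₂ s₂ with
  | setNat => cases h₂; exact ⟨rfl, rfl⟩
  | setReal => cases h₂; exact ⟨rfl, rfl⟩
  | seq _ _ ih ih' =>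
    cases h₂ with
    | seq a b =>
      obtain ⟨rfl, rfl⟩ := ih a
      obtain ⟨rfl, rfl⟩ := ih' b
      exact ⟨rfl, rfl⟩
  | iteTrue q hb _ ih =>
    cases h₂ with
    | iteTrue _ _ a => obtain ⟨rfl, rfl⟩ := ih a; exact ⟨rfl, rfl⟩
    | iteFalse _ hn => exact absurd hb hn
  | iteFalse p hb _ ih =>
    cases h₂ with
    | iteTrue _ hn => exact absurd hn hb
    | iteFalse _ _ a => obtain ⟨rfl, rfl⟩ := ih a; exact ⟨rfl, rfl⟩
  | loopStop p hb =>
    cases h₂ with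
    | loopStop => exact ⟨rfl, rfl⟩
    | loopStep hn => exact absurd hn hb
  | loopStep hb _ _ ih ih' =>
    cases h₂ with
    | loopStop _ hn => exact absurd hb hn
    | loopStep _ a b =>
      obtain ⟨rfl, rfl⟩ := ih a
      obtain ⟨rfl, rfl⟩ := ih' b
      exact ⟨rfl, rfl⟩
  | call x y z _ ih =>
    cases h₂ with
    | call _ _ _ a => obtain ⟨rfl, rfl⟩ := ih a; exact ⟨rfl, rfl⟩

/-! ## Shallow layers -/

/-- The argument array for one Heisenberg step: row `0` is `n, L, j`, row `1` holds the letters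
of `P`. -/
def heisenbergArg {n : ℕ} (L j : ℕ) (P : Fin n → Fin 4) : ℕ → ℕ → ℕ
  | 0, 0 => n
  | 0, 1 => L
  | 0, 2 => j
  | 1, i => if h : i < n then (P ⟨i, h⟩ : ℕ) else 0
  | _, _ => 0

/-- The program `Q`, reading the description `w` of the circuit `U`, computes for every layer `U_j`
and every Pauli operator `P` a Pauli expansion of `U_j^† P U_j` with at most `n^(b(|P|+1))` terms
within `n^(b(|P|+1))` steps. The result array has the number `m` of terms in entry `(0, 0)` and the
letters of the `k`-th term in row `k + 1`; the coefficients are in row `0` of the real result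
array. -/
def ComputesHeisenberg {n L : ℕ} (b : ℕ) (Q : Prog) (w : CircuitDesc)
    (U : Fin L → QUnitary (Fin n)) : Prop :=
  ∀ (j : Fin L) (P : Fin n → Fin 4), ∃ (t : ℕ) (s : Store) (m : ℕ) (T : Fin m → Fin n → Fin 4),
    Exec w Q (Store.ofArg (heisenbergArg L j P)) t s ∧
    t ≤ n ^ (b * (pauliWeight P + 1)) ∧
    m ≤ n ^ (b * (pauliWeight P + 1)) ∧
    s.nat 0 0 0 = m ∧
    (∀ (k : Fin m) (i : Fin n), s.nat 0 ((k : ℕ) + 1) (i : ℕ) = (T k i : ℕ)) ∧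
    (U j : QOp (Fin n)).conjTranspose * pauliOp P * (U j : QOp (Fin n)) =
      ∑ k : Fin m, ((s.real 0 0 (k : ℕ) : ℝ) : ℂ) • pauliOp (T k)

/-- `L`-layered locally scrambling circuit ensembles: the layers are independent, the `j`-th one
being drawn from `D j`; the sampled circuit `U` is handed to the classical computer through the
description `desc U`, from which the program `Q` computes Heisenberg-evolved Pauli operators. -/
structure IsLocallyScramblingCircuit {n L : ℕ} (b : ℕ) (Q : Prog)
    (D : Fin L → Measure (QUnitary (Fin n)))
    (desc : (Fin L → QUnitary (Fin n)) → CircuitDesc) : Prop where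
  prob : ∀ j, IsProbabilityMeasure (D j)
  first : ∀ j : Fin L, (j : ℕ) = 0 → IsLocallyScrambling (D j)
  later : ∀ j : Fin L, (j : ℕ) ≠ 0 → ∃ (A : Finset (Fin n)) (ν : Measure (QUnitary {i // i ∈ A})),
    IsProbabilityMeasure ν ∧ IsLocallyScrambling ν ∧ D j = ν.map (actOn A)
  shallow : ∀ᵐ U ∂(Measure.pi D), ComputesHeisenberg b Q (desc U) U

/-! ## Randomized measurements -/

/-- For each qubit, an axis `X, Y, Z` (numbered `0, 1, 2`) and a sign (`0` for `+`, `1` for `-`):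
the label of a product of single-qubit stabilizer states. -/
abbrev StabLabel (n : ℕ) := Fin n → Fin 3 × Fin 2

/-- The product of the single-qubit stabilizer states `(I ± σ_i) / 2` with the given label. -/
noncomputable def stabState {n : ℕ} (σ : StabLabel n) : QOp (Fin n) :=
  tensorOp fun i => (2⁻¹ : ℂ) • (1 + (-1 : ℂ) ^ ((σ i).2 : ℕ) • pauliOne (σ i).1.succ)

/-- The law of a randomized Pauli measurement of `ρ`: every qubit is measured along an independent
uniformly random axis; the label records the axes and the outcomes. -/
noncomputable def stateShotLaw {n : ℕ} (ρ : QOp (Fin n)) : Measure (StabLabel n) :=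
  ∑ σ : StabLabel n,
    ENNReal.ofReal ((1 / 3) ^ n * (stabState σ * ρ).trace.re) • Measure.dirac σ

/-- The law of a measurement of `O` on a uniformly random product of single-qubit stabilizer
states: the pair of the state and the outcome. On the state `σ`, the outcome is the eigenvalue
`λ_v` with probability `⟨v|σ|v⟩`, for an orthonormal basis of eigenvectors `v` of `O`. -/
noncomputable def observableShotLaw {n : ℕ} (O : QOp (Fin n)) (hO : O.IsHermitian) :
    Measure (StabLabel n × ℝ) :=
  ∑ σ : StabLabel n, ∑ v : Bits (Fin n),
    ENNReal.ofReal ((1 / 6) ^ n *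
      (star (hO.eigenvectorBasis v).ofLp ⬝ᵥ (stabState σ).mulVec (hO.eigenvectorBasis v).ofLp).re) •
      Measure.dirac (σ, hO.eigenvalues v)

/-- The initial memory of the simulation algorithm. Natural-number array `0` has the row `n, L, M`;
arrays `1, 2` hold the axes and the outcomes of the `M` Pauli measurements of `ρ` and arrays `3, 4`
the axes and signs of the stabilizer states on which `O` was measured (row: measurement, column:
qubit). Real array `0` has the row `ε, δ`, and row `0` of real array `1` holds the outcomes of the
measurements of `O`. -/
noncomputable def simInput {n M : ℕ} (L : ℕ) (ε δ : ℝ) (x : Fin M → StabLabel n)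
    (y : Fin M → StabLabel n × ℝ) : Store where
  nat
    | 0, 0, 0 => n
    | 0, 0, 1 => L
    | 0, 0, 2 => M
    | 1, m, i => if h : m < M ∧ i < n then ((x ⟨m, h.1⟩ ⟨i, h.2⟩).1 : ℕ) else 0
    | 2, m, i => if h : m < M ∧ i < n then ((x ⟨m, h.1⟩ ⟨i, h.2⟩).2 : ℕ) else 0
    | 3, m, i => if h : m < M ∧ i < n then (((y ⟨m, h.1⟩).1 ⟨i, h.2⟩).1 : ℕ) else 0
    | 4, m, i => if h : m < M ∧ i < n then (((y ⟨m, h.1⟩).1 ⟨i, h.2⟩).2 : ℕ) else 0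
    | _, _, _ => 0
  real
    | 0, 0, 0 => ε
    | 0, 0, 1 => δ
    | 1, 0, m => if h : m < M then (y ⟨m, h⟩).2 else 0
    | _, _, _ => 0

/-- `n^(C (1 + log(1/(ε δ))))`. -/
noncomputable def resourceBound (C : ℝ) (n : ℕ) (ε δ : ℝ) : ℝ :=
  (n : ℝ) ^ (C * (1 + Real.log (ε⁻¹ * δ⁻¹)))

/-! ## Total-correctness triples with time bounds -/

/-! In the Heisenberg picture the layer `U_j` acts on Pauli coefficients by its Pauli transfer
matrix, the real matrix `R_j` with `U_j† P U_j = ∑_Q R_j(P,Q) Q` (`ptm`). Its rows are orthonormal,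
because conjugation by a unitary preserves the Hilbert–Schmidt product. The algorithm picks a weight
`k` of order `1 + log(1/(εδ))`, estimates the coefficients of `O` at all Pauli operators of weight
at most `k`, and pulls them back through the layers from the last to the first, discarding the
operators of weight above `k` before each layer. After the first layer nothing is discarded: that
layer is a product of gates on at most `a` qubits, so the surviving operators have weight at most `a
* k`. Their coefficients are paired with estimates of `Tr[T ρ]`. Both families of estimates are
means of unbiased single-shot estimators, which reweight random stabilizer measurements by factors
`0, 1, ±3` per qubit.

Truncation costs little, for any number of layers. Let `pathValue … false P` be the part of the
expectation value of `P` that is lost by discarding. Averaging over local Pauli gates makes the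
values at different operators `P ≠ P'` uncorrelated (`integral_pathValue_of_ne`). Averaging over the
remaining Clifford gates makes the mean square of the expectation value of `P` depend only on the
support of `P` (`integral_pathValue_congr`). On a support of size `m` there are `3^m` operators, and
the squares of their expectation values in any state add up to at most `2^m`, since the reduced
state has purity at most one. Hence the mean square at `P` is at most `(2/3)^m`
(`integral_pathValue_true_le`). When an operator of weight above `k` is discarded, the loss thus has
mean square at most `(2/3)^(k+1)`. An operator that is kept loses a combination of uncorrelated
losses from the layer below, with squared coefficients adding up to one, so the same bound persists
through all layers (`integral_pathValue_false_le`). Uncorrelatedness once more gives `(2/3)^(k+1)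
‖O‖²_{Pauli,2}` for the whole observable.

The error of the output has three parts (`abs_estimate_sub_le`): errors in the estimates of `ρ`,
errors in the estimates of `O`, and truncation. The first two are bounded by Cauchy–Schwarz, because
truncated evolution does not increase the `ℓ²` norm of the coefficients (`sum_evolvedCoeff_sq_le`).
Chebyshev-type bounds make the three bad events have probability at most `δ/4`, `δ/4` and `δ/2`.

The number of operators of weight at most `k`, the cost of the expansions and the number of shots
are all of the form `n^(O(1 + log(1/(εδ))))`. The running time is proved in a small Hoare logic with
time bounds (`Runs`): all sizes are majorized by one number `X`, and the program takes at most `L *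
(4000 * X^5)` steps. -/

/-- The arrays of natural numbers written by a program. -/
def Prog.wNat : Prog → ℕ → Bool
  | .setNat x _ _ _, y => y == x
  | .setReal _ _ _ _, _ => false
  | .seq p q, y => p.wNat y || q.wNat y
  | .ite _ p q, y => p.wNat y || q.wNat y
  | .loop _ p, y => p.wNat y
  | .call _ _ x _, y => y == x

/-- The arrays of real numbers written by a program. -/
def Prog.wReal : Prog → ℕ → Bool
  | .setNat _ _ _ _, _ => false
  | .setReal x _ _ _, y => y == x
  | .seq p q, y => p.wReal y || q.wReal y
  | .ite _ p q, y => p.wReal y || q.wReal y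
  | .loop _ p, y => p.wReal y
  | .call _ _ _ x, y => y == x

/-- The stores agree on all arrays that `p` does not write. -/
def Same (p : Prog) (s s' : Store) : Prop :=
  (∀ x, p.wNat x = false → s'.nat x = s.nat x) ∧ ∀ x, p.wReal x = false → s'.real x = s.real x

theorem Same.refl (p : Prog) (s : Store) : Same p s s :=
  ⟨fun _ _ => rfl, fun _ _ => rfl⟩

theorem Same.trans {p : Prog} {s s' s'' : Store} (h : Same p s s') (h' : Same p s' s'') :
    Same p s s'' :=
  ⟨fun x hx => (h'.1 x hx).trans (h.1 x hx), fun x hx => (h'.2 x hx).trans (h.2 x hx)⟩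

theorem Same.of_imp {p q : Prog} {s s' : Store} (h : Same p s s')
    (hn : ∀ x, q.wNat x = false → p.wNat x = false)
    (hr : ∀ x, q.wReal x = false → p.wReal x = false) : Same q s s' :=
  ⟨fun x hx => h.1 x (hn x hx), fun x hx => h.2 x (hr x hx)⟩

theorem Same.seq_left {p : Prog} {s s' : Store} (q : Prog) (h : Same p s s') :
    Same (p.seq q) s s' :=
  h.of_imp (fun x hx => by simp [Prog.wNat] at hx; exact hx.1)
    fun x hx => by simp [Prog.wReal] at hx; exact hx.1

theorem Same.seq_right {q : Prog} {s s' : Store} (p : Prog) (h : Same q s s') :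
    Same (p.seq q) s s' :=
  h.of_imp (fun x hx => by simp [Prog.wNat] at hx; exact hx.2)
    fun x hx => by simp [Prog.wReal] at hx; exact hx.2

/-- A frame rule read off the syntax: branches and loops write only what their bodies write, and a
call touches only the two arrays that receive its result, because the procedure runs in its own
memory. -/
theorem Exec.same {w : CircuitDesc} {p : Prog} {s s' : Store} {t : ℕ} (h : Exec w p s t s') :
    Same p s s' := by
  induction h with
  | setNat x i j e s =>
    refine ⟨fun y hy => ?_, fun y _ => rfl⟩
    have : y ≠ x := by simpa [Prog.wNat] using hy
    funext a b
    simp [Store.setNat, this]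
  | setReal x i j e s =>
    refine ⟨fun y _ => rfl, fun y hy => ?_⟩
    have : y ≠ x := by simpa [Prog.wReal] using hy
    funext a b
    simp [Store.setReal, this]
  | seq _ _ ih ih' => exact (ih.seq_left _).trans (ih'.seq_right _)
  | iteTrue q _ _ ih => exact (ih.seq_left q).of_imp (fun _ h => h) fun _ h => h
  | iteFalse p _ _ ih => exact (ih.seq_right p).of_imp (fun _ h => h) fun _ h => h
  | loopStop => exact Same.refl _ _
  | loopStep _ _ _ ih ih' => exact (ih.of_imp (fun _ h => h) fun _ h => h).trans ih'
  | call x y z _ _ =>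
    refine ⟨fun a ha => ?_, fun a ha => ?_⟩
    · have : a ≠ y := by simpa [Prog.wNat] using ha
      simp [Store.afterCall, this]
    · have : a ≠ z := by simpa [Prog.wReal] using ha
      simp [Store.afterCall, this]

/-- `p` started in `s` stops within `T` steps in a store that satisfies `A`. -/
def Runs (w : CircuitDesc) (p : Prog) (s : Store) (T : ℕ) (A : Store → Prop) : Prop :=
  ∃ t s', Exec w p s t s' ∧ t ≤ T ∧ A s'

namespace Runs

variable {w : CircuitDesc} {p q : Prog} {s : Store} {T T' : ℕ} {A B : Store → Prop}

theorem mono (h : Runs w p s T A) (hT : T ≤ T') (hA : ∀ s', Same p s s' → A s' → B s') :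
    Runs w p s T' B := by
  obtain ⟨t, s', he, ht, ha⟩ := h
  exact ⟨t, s', he, ht.trans hT, hA s' he.same ha⟩

theorem le (h : Runs w p s T A) (hT : T ≤ T') : Runs w p s T' A :=
  h.mono hT fun _ _ h => h

theorem seq (h : Runs w p s T A) (h' : ∀ s', Same p s s' → A s' → Runs w q s' T' B) :
    Runs w (p.seq q) s (T + T') B := by
  obtain ⟨t, s', he, ht, ha⟩ := h
  obtain ⟨t', s'', he', ht', hb⟩ := h' s' he.same ha
  exact ⟨t + t', s'', .seq he he', add_le_add ht ht', hb⟩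

theorem setNat {x : ℕ} {i j e : NExp}
    (h : A (s.setNat x (i.eval w s) (j.eval w s) (e.eval w s))) :
    Runs w (.setNat x i j e) s (1 + i.cost + j.cost + e.cost) A :=
  ⟨_, _, .setNat x i j e s, le_rfl, h⟩

theorem setReal {x : ℕ} {i j : NExp} {e : RExp}
    (h : A (s.setReal x (i.eval w s) (j.eval w s) (e.eval w s))) :
    Runs w (.setReal x i j e) s (1 + i.cost + j.cost + e.cost) A :=
  ⟨_, _, .setReal x i j e s, le_rfl, h⟩

/-- Costs are kept in the form `c * X ^ d` with one size parameter `X`. Sequencing adds the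
coefficients and a loop raises the exponent, so the bookkeeping of time reduces to arithmetic of
numerals. -/
theorem setNat_pow {x : ℕ} {i j e : NExp} {X d : ℕ} (hX : 1 ≤ X)
    (h : A (s.setNat x (i.eval w s) (j.eval w s) (e.eval w s))) :
    Runs w (.setNat x i j e) s ((1 + i.cost + j.cost + e.cost) * X ^ d) A :=
  (setNat h).le (Nat.le_mul_of_pos_right _ (Nat.pow_pos hX))

theorem setReal_pow {x : ℕ} {i j : NExp} {e : RExp} {X d : ℕ} (hX : 1 ≤ X)
    (h : A (s.setReal x (i.eval w s) (j.eval w s) (e.eval w s))) :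
    Runs w (.setReal x i j e) s ((1 + i.cost + j.cost + e.cost) * X ^ d) A :=
  (setReal h).le (Nat.le_mul_of_pos_right _ (Nat.pow_pos hX))

theorem seq_pow {c c' X d : ℕ} (h : Runs w p s (c * X ^ d) A)
    (h' : ∀ s', Same p s s' → A s' → Runs w q s' (c' * X ^ d) B) :
    Runs w (p.seq q) s ((c + c') * X ^ d) B :=
  (h.seq h').le (add_mul c c' _).ge

theorem pow_le {c c' X d d' : ℕ} (h : Runs w p s (c * X ^ d) A) (hX : 1 ≤ X) (hd : d ≤ d')
    (hc : c ≤ c') : Runs w p s (c' * X ^ d') A :=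
  h.le (Nat.mul_le_mul hc (Nat.pow_le_pow_right hX hd))

end Runs

/-- The scalar variable stored in entry `(0, 0)` of array `x`. -/
def NExp.var (x : ℕ) : NExp := .get x (.lit 0) (.lit 0)

/-- Assignment to a scalar variable. -/
def Prog.setVar (x : ℕ) (e : NExp) : Prog := .setNat x (.lit 0) (.lit 0) e

/-- `for v = 0, …, e - 1 do p`. -/
def Prog.for (v : ℕ) (e : NExp) (p : Prog) : Prog :=
  (Prog.setVar v (.lit 0)).seq
    (.loop (.natLt (.var v) e) (p.seq (.setVar v (.add (.var v) (.lit 1)))))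

/-- Induction on the number `r` of passes that remain. The bound `e` is evaluated anew at each test,
hence `he`; the invariant must not depend on the counter, hence `hI`. Test and increment cost
`e.cost + 12` per pass. -/
theorem Runs.loop_count {w : CircuitDesc} {p : Prog} {v N c : ℕ} {e : NExp} {s₀ : Store}
    {I : ℕ → Store → Prop} (hv : p.wNat v = false)
    (he : ∀ s, Same (Prog.for v e p) s₀ s → e.eval w s = N)
    (hI : ∀ i s m, I i s → I i (s.setNat v 0 0 m))
    (hp : ∀ i < N, ∀ s, Same (Prog.for v e p) s₀ s → s.nat v 0 0 = i → I i s →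
      Runs w p s c (I (i + 1))) :
    ∀ (r i : ℕ) (s : Store), r + i = N → Same (Prog.for v e p) s₀ s → s.nat v 0 0 = i → I i s →
      Runs w (.loop (.natLt (.var v) e) (p.seq (.setVar v (.add (.var v) (.lit 1))))) s
        (r * (c + e.cost + 12) + e.cost + 4) (fun s' => I N s' ∧ s'.nat v 0 0 = N) := by
  intro r
  induction r with
  | zero =>
    intro i s hi hs hvi hIs
    have hi' : i = N := by omega
    subst hi'
    refine ⟨_, s, .loopStop _ ?_, ?_, hIs, hvi⟩
    · simp [Test.holds, NExp.var, NExp.eval, hvi, he s hs]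
    · simp [Test.cost, NExp.var, NExp.cost]; omega
  | succ r ih =>
    intro i s hi hs hvi hIs
    obtain ⟨t, s₁, hx, ht, hI₁⟩ := hp i (by omega) s hs hvi hIs
    have hv₁ : s₁.nat v 0 0 = i := by rw [hx.same.1 v hv, hvi]
    have hs₂ := Exec.setNat (w := w) v (.lit 0) (.lit 0) (.add (.var v) (.lit 1)) s₁
    have hse := Exec.seq hx hs₂
    have hsame : Same (Prog.for v e p) s₀
        (s₁.setNat v ((NExp.lit 0).eval w s₁) ((NExp.lit 0).eval w s₁)
          ((NExp.add (.var v) (.lit 1)).eval w s₁)) :=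
      hs.trans ((hse.same.of_imp (fun _ h => h) fun _ h => h).seq_right
        (q := .loop (.natLt (.var v) e) (p.seq (.setVar v (.add (.var v) (.lit 1))))) _)
    obtain ⟨t', s₃, hx', ht', hI'⟩ := ih (i + 1) _ (by omega) hsame
      (by simp [Store.setNat, NExp.eval, NExp.var, hv₁])
      (by simpa [NExp.eval] using hI _ s₁ _ hI₁)
    refine ⟨_, s₃, .loopStep ?_ hse hx', ?_, hI'⟩
    · simp [Test.holds, NExp.var, NExp.eval, hvi, he s hs]; omega
    · simp [Test.cost, NExp.var, NExp.cost]
      have : (r + 1) * (c + e.cost + 12) = r * (c + e.cost + 12) + (c + e.cost + 12) := by ring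
      omega

theorem Runs.for {w : CircuitDesc} {p : Prog} {v N c : ℕ} {e : NExp} {s₀ : Store}
    (I : ℕ → Store → Prop) (hv : p.wNat v = false)
    (he : ∀ s, Same (Prog.for v e p) s₀ s → e.eval w s = N)
    (hI : ∀ i s m, I i s → I i (s.setNat v 0 0 m))
    (h0 : I 0 s₀)
    (hp : ∀ i < N, ∀ s, Same (Prog.for v e p) s₀ s → s.nat v 0 0 = i → I i s →
      Runs w p s c (I (i + 1))) :
    Runs w (Prog.for v e p) s₀ (N * (c + e.cost + 12) + e.cost + 8) (I N) := by
  have hx := Exec.setNat (w := w) v (.lit 0) (.lit 0) (.lit 0) s₀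
  refine (Runs.seq (T := 4) (A := fun s => s = s₀.setNat v 0 0 0) ⟨_, _, hx, le_rfl, rfl⟩ ?_).le
    (T := 4 + (N * (c + e.cost + 12) + e.cost + 4)) (by omega)
  rintro s hs rfl
  exact (Runs.loop_count hv he hI hp N 0 _ (by simp) (hs.seq_left _)
    (by simp [Store.setNat]) (hI _ _ _ h0)).mono le_rfl fun _ _ h => h.1

/-- With `e.cost ≤ 8`, each pass adds at most `20` to the cost of the body, and the initialization
with the last test costs at most `16`; together these give the `36`. -/
theorem Runs.for_pow {w : CircuitDesc} {p : Prog} {v c X d : ℕ} {e : NExp} {s₀ : Store}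
    (N : ℕ) (I : ℕ → Store → Prop) (hX : 1 ≤ X) (hN : N ≤ X) (hc : e.cost ≤ 8)
    (hv : p.wNat v = false)
    (he : ∀ s, Same (Prog.for v e p) s₀ s → e.eval w s = N)
    (hI : ∀ i s m, I i s → I i (s.setNat v 0 0 m))
    (h0 : I 0 s₀)
    (hp : ∀ i < N, ∀ s, Same (Prog.for v e p) s₀ s → s.nat v 0 0 = i → I i s →
      Runs w p s (c * X ^ d) (I (i + 1))) :
    Runs w (Prog.for v e p) s₀ ((c + 36) * X ^ (d + 1)) (I N) := by
  refine (Runs.for I hv he hI h0 hp).le ?_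
  have h1 : 1 ≤ X ^ d := Nat.pow_pos hX
  have h2 : N * (c * X ^ d + e.cost + 12) ≤ X * (c * X ^ d + 20 * X ^ d) :=
    Nat.mul_le_mul hN (by omega)
  have h3 : 1 ≤ X ^ (d + 1) := Nat.pow_pos hX
  have h4 : X * (c * X ^ d + 20 * X ^ d) = (c + 20) * X ^ (d + 1) := by ring
  have h5 : (c + 36) * X ^ (d + 1) = (c + 20) * X ^ (d + 1) + 16 * X ^ (d + 1) := by ring
  omega

/-! ### Footprints of programs as explicit lists of arrays -/

/-- The list of the arrays of natural numbers written by a program. -/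
def Prog.nats : Prog → List ℕ
  | .setNat x _ _ _ => [x]
  | .setReal _ _ _ _ => []
  | .seq p q => p.nats ++ q.nats
  | .ite _ p q => p.nats ++ q.nats
  | .loop _ p => p.nats
  | .call _ _ x _ => [x]

/-- The list of the arrays of real numbers written by a program. -/
def Prog.reals : Prog → List ℕ
  | .setNat _ _ _ _ => []
  | .setReal x _ _ _ => [x]
  | .seq p q => p.reals ++ q.reals
  | .ite _ p q => p.reals ++ q.reals
  | .loop _ p => p.reals
  | .call _ _ _ x => [x]

theorem Prog.wNat_eq_false {p : Prog} {y : ℕ} (h : y ∉ p.nats) : p.wNat y = false := by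
  induction p with
  | seq p q ih ih' => simp [nats] at h; simp [wNat, ih h.1, ih' h.2]
  | ite b p q ih ih' => simp [nats] at h; simp [wNat, ih h.1, ih' h.2]
  | loop b p ih => exact ih h
  | setReal => rfl
  | _ => simpa [nats, wNat] using h

theorem Prog.wReal_eq_false {p : Prog} {y : ℕ} (h : y ∉ p.reals) : p.wReal y = false := by
  induction p with
  | seq p q ih ih' => simp [reals] at h; simp [wReal, ih h.1, ih' h.2]
  | ite b p q ih ih' => simp [reals] at h; simp [wReal, ih h.1, ih' h.2]
  | loop b p ih => exact ih h
  | setNat => rfl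
  | _ => simpa [reals, wReal] using h

/-- The stores agree except on the natural-number arrays in `N` and the real arrays in `R`. -/
def Off (N R : List ℕ) (s s' : Store) : Prop :=
  (∀ y ∉ N, s'.nat y = s.nat y) ∧ ∀ y ∉ R, s'.real y = s.real y

namespace Off

variable {N R N' R' : List ℕ} {s s' s'' : Store}

theorem refl : Off N R s s := ⟨fun _ _ => rfl, fun _ _ => rfl⟩

theorem trans (h : Off N R s s') (h' : Off N R s' s'') : Off N R s s'' :=
  ⟨fun y hy => (h'.1 y hy).trans (h.1 y hy), fun y hy => (h'.2 y hy).trans (h.2 y hy)⟩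

theorem mono (h : Off N R s s') (hN : N ⊆ N') (hR : R ⊆ R') : Off N' R' s s' :=
  ⟨fun y hy => h.1 y fun h => hy (hN h), fun y hy => h.2 y fun h => hy (hR h)⟩

theorem setNat (h : Off N R s s') {x : ℕ} (hx : x ∈ N) (i j v : ℕ) :
    Off N R s (s'.setNat x i j v) :=
  ⟨fun y hy => by
    have : y ≠ x := fun h => hy (h ▸ hx)
    rw [← h.1 y hy]; funext a b; simp [Store.setNat, this], h.2⟩

theorem setReal (h : Off N R s s') {x : ℕ} (hx : x ∈ R) (i j : ℕ) (v : ℝ) :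
    Off N R s (s'.setReal x i j v) :=
  ⟨h.1, fun y hy => by
    have : y ≠ x := fun h => hy (h ▸ hx)
    rw [← h.2 y hy]; funext a b; simp [Store.setReal, this]⟩

end Off

/-- Both side conditions are Boolean computations on concrete lists, so for a concrete program they
are closed by `rfl`, even if the program contains an unknown procedure `Q`: a call reveals only its
result arrays. -/
theorem Same.off {N R : List ℕ} {p : Prog} {s s' : Store} (h : Same p s s')
    (hN : (p.nats.all fun y => N.contains y) = true)
    (hR : (p.reals.all fun y => R.contains y) = true) : Off N R s s' := by
  simp only [List.all_eq_true, List.contains_iff_mem] at hN hR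
  exact ⟨fun y hy => h.1 y (Prog.wNat_eq_false fun h => hy (hN y h)),
    fun y hy => h.2 y (Prog.wReal_eq_false fun h => hy (hR y h))⟩

namespace Runs

variable {w : CircuitDesc} {p q : Prog} {s : Store} {A B : Store → Prop} {c X d : ℕ}

theorem seq_le (c₁ c₂ : ℕ) (hc : c₁ + c₂ ≤ c) (h : Runs w p s (c₁ * X ^ d) A)
    (h' : ∀ s', Same p s s' → A s' → Runs w q s' (c₂ * X ^ d) B) :
    Runs w (p.seq q) s (c * X ^ d) B :=
  (h.seq_pow h').le (Nat.mul_le_mul_right _ hc)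

theorem setNat_le {x : ℕ} {i j e : NExp} (hX : 1 ≤ X) (hc : 1 + i.cost + j.cost + e.cost ≤ c)
    (h : A (s.setNat x (i.eval w s) (j.eval w s) (e.eval w s))) :
    Runs w (.setNat x i j e) s (c * X ^ d) A :=
  (setNat_pow hX h).le (Nat.mul_le_mul_right _ hc)

theorem setReal_le {x : ℕ} {i j : NExp} {e : RExp} (hX : 1 ≤ X)
    (hc : 1 + i.cost + j.cost + e.cost ≤ c)
    (h : A (s.setReal x (i.eval w s) (j.eval w s) (e.eval w s))) :
    Runs w (.setReal x i j e) s (c * X ^ d) A :=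
  (setReal_pow hX h).le (Nat.mul_le_mul_right _ hc)

theorem setNat_seq {x : ℕ} {i j e : NExp} (c₁ c₂ : ℕ) (hc : c₁ + c₂ ≤ c) (hX : 1 ≤ X)
    (hc₁ : 1 + i.cost + j.cost + e.cost ≤ c₁)
    (h : Runs w q (s.setNat x (i.eval w s) (j.eval w s) (e.eval w s)) (c₂ * X ^ d) A) :
    Runs w ((Prog.setNat x i j e).seq q) s (c * X ^ d) A :=
  seq_le c₁ c₂ hc (setNat_le (A := fun s' => s' = _) hX hc₁ rfl) fun _ _ h' => h' ▸ h

theorem setReal_seq {x : ℕ} {i j : NExp} {e : RExp} (c₁ c₂ : ℕ) (hc : c₁ + c₂ ≤ c) (hX : 1 ≤ X)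
    (hc₁ : 1 + i.cost + j.cost + e.cost ≤ c₁)
    (h : Runs w q (s.setReal x (i.eval w s) (j.eval w s) (e.eval w s)) (c₂ * X ^ d) A) :
    Runs w ((Prog.setReal x i j e).seq q) s (c * X ^ d) A :=
  seq_le c₁ c₂ hc (setReal_le (A := fun s' => s' = _) hX hc₁ rfl) fun _ _ h' => h' ▸ h

theorem for_le {v N : ℕ} {e : NExp} {c' d' : ℕ} (I : ℕ → Store → Prop) (hd : d' + 1 ≤ d)
    (hc' : c' + 36 ≤ c) (hX : 1 ≤ X) (hN : N ≤ X) (hc : e.cost ≤ 8)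
    (hv : p.wNat v = false)
    (he : ∀ s', Same (Prog.for v e p) s s' → e.eval w s' = N)
    (hI : ∀ i s m, I i s → I i (s.setNat v 0 0 m))
    (h0 : I 0 s)
    (hp : ∀ i < N, ∀ s', Same (Prog.for v e p) s s' → s'.nat v 0 0 = i → I i s' →
      Runs w p s' (c' * X ^ d') (I (i + 1))) :
    Runs w (Prog.for v e p) s (c * X ^ d) (I N) :=
  (for_pow N I hX hN hc hv he hI h0 hp).pow_le hX hd hc'

end Runs

/-! ## Building blocks of the simulation program -/

/-- The scalar real variable stored in entry `(0, 0)` of array `x`. -/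
def RExp.var (x : ℕ) : RExp := .get x (.lit 0) (.lit 0)

/-- Assignment to a scalar real variable. -/
def Prog.setRVar (x : ℕ) (e : RExp) : Prog := .setReal x (.lit 0) (.lit 0) e

/-- The weight that a single-qubit shot along axis `a` with sign `g` carries in the estimator of
the Pauli letter `l`. -/
noncomputable def shotFactor (l a g : ℕ) : ℝ :=
  ((1 - l : ℕ) : ℝ) + 3 * ((1 - ((l - (a + 1)) + (a + 1 - l)) : ℕ) : ℝ) * (1 - (g + g))

/-- The expression that evaluates `shotFactor`. -/
def shotFactorExp (l a g : NExp) : RExp :=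
  .add (.ofNat (.sub (.lit 1) l))
    (.mul (.mul (.ofNat (.lit 3))
        (.ofNat (.sub (.lit 1) (.add (.sub l (.add a (.lit 1))) (.sub (.add a (.lit 1)) l)))))
      (.sub (.ofNat (.lit 1)) (.add (.ofNat g) (.ofNat g))))

theorem shotFactorExp_eval (w : CircuitDesc) (s : Store) (l a g : NExp) :
    (shotFactorExp l a g).eval w s = shotFactor (l.eval w s) (a.eval w s) (g.eval w s) := by
  simp [shotFactorExp, shotFactor, RExp.eval, NExp.eval]

/-- Sums the weighted shots in the estimator of the Pauli operator whose letters are in row `row`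
of array `x`; the shots have their axes and signs in the arrays `ax` and `sg`. -/
def shotSum (x : ℕ) (row : NExp) (ax sg : ℕ) (wt : RExp) : Prog :=
  (Prog.setRVar 12 (.ofNat (.lit 0))).seq
    (.for 31 (.get 0 (.lit 0) (.lit 2))
      ((Prog.setRVar 11 (.ofNat (.lit 1))).seq
        ((Prog.for 32 (.get 0 (.lit 0) (.lit 0))
            (.setRVar 11 (.mul (.var 11)
              (shotFactorExp (.get x row (.var 32)) (.get ax (.var 31) (.var 32))
                (.get sg (.var 31) (.var 32)))))).seq
          (.setRVar 12 (.add (.var 12) (.mul wt (.var 11)))))))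

/-- The row and the outcome of a shot are expressions that are evaluated inside the loops. They are
therefore specified on every store that agrees with the initial one off the scratch arrays; the
outcome may also depend on the counter `31` of the shots. -/
theorem shotSum_runs {w : CircuitDesc} {s : Store} {x ax sg r n M X : ℕ} {row : NExp} {wt : RExp}
    {y : ℕ → ℝ} (hX : 1 ≤ X) (hn : s.nat 0 0 0 = n) (hM : s.nat 0 0 2 = M) (hnX : n ≤ X)
    (hMX : M ≤ X) (hx : x ∉ [31, 32]) (hax : ax ∉ [31, 32]) (hsg : sg ∉ [31, 32])
    (hrow : ∀ s', Off [31, 32] [11, 12] s s' → row.eval w s' = r) (hrc : row.cost ≤ 10)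
    (hwt : ∀ m < M, ∀ s', Off [31, 32] [11, 12] s s' → s'.nat 31 0 0 = m →
      wt.eval w s' = y m) (hwc : wt.cost ≤ 10) :
    Runs w (shotSum x row ax sg wt) s (400 * X ^ 2) (fun s' => s'.real 12 0 0 =
      ∑ m ∈ Finset.range M, y m * ∏ i ∈ Finset.range n,
        shotFactor (s.nat x r i) (s.nat ax m i) (s.nat sg m i)) := by
  refine Runs.setReal_seq 10 380 (by norm_num) hX (by simp [NExp.cost, RExp.cost]) ?_
  have o₁ : Off [31, 32] [11, 12] s (s.setReal 12 ((NExp.lit 0).eval w s) ((NExp.lit 0).eval w s)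
      ((RExp.ofNat (.lit 0)).eval w s)) := Off.refl.setReal (by decide) _ _ _
  refine Runs.for_le (N := M) (c' := 340) (d' := 1) (fun m s' => s'.real 12 0 0 =
      ∑ m ∈ Finset.range m, y m * ∏ i ∈ Finset.range n,
        shotFactor (s.nat x r i) (s.nat ax m i) (s.nat sg m i)) (by norm_num) (by norm_num) hX hMX
        (by decide) rfl ?_ ?_ ?_ ?_
  · intro s₂ hs₂
    simp [NExp.eval, (o₁.trans (hs₂.off rfl rfl)).1 0 (by decide), hM]
  · intro i s₂ m h; simpa [Store.setNat] using h
  · simp [Store.setReal, NExp.eval, RExp.eval]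
  intro m hm s₂ hs₂ hv hI
  have o₂ := o₁.trans (hs₂.off (N := [31, 32]) (R := [11, 12]) rfl rfl)
  refine Runs.setReal_seq 10 330 (by norm_num) hX (by simp [NExp.cost, RExp.cost]) ?_
  have o₃ := o₂.setReal (x := 11) (by decide) ((NExp.lit 0).eval w s₂) ((NExp.lit 0).eval w s₂)
      ((RExp.ofNat (.lit 1)).eval w s₂)
  have h11 : (s₂.setReal 11 ((NExp.lit 0).eval w s₂) ((NExp.lit 0).eval w s₂)
      ((RExp.ofNat (.lit 1)).eval w s₂)).real 11 0 0 = 1 := by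
    simp [Store.setReal, NExp.eval, RExp.eval]
  have h12 : (s₂.setReal 11 ((NExp.lit 0).eval w s₂) ((NExp.lit 0).eval w s₂)
      ((RExp.ofNat (.lit 1)).eval w s₂)).real 12 0 0 = s₂.real 12 0 0 := by
    simp [Store.setReal]
  have v₃ : (s₂.setReal 11 ((NExp.lit 0).eval w s₂) ((NExp.lit 0).eval w s₂)
      ((RExp.ofNat (.lit 1)).eval w s₂)).nat 31 0 0 = m := hv
  generalize s₂.setReal 11 ((NExp.lit 0).eval w s₂) ((NExp.lit 0).eval w s₂)
      ((RExp.ofNat (.lit 1)).eval w s₂) = s₃ at *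
  refine Runs.seq_le 290 40 (by norm_num) (Runs.for_le (N := n) (c' := 250) (d' := 0)
    (fun u s' => s'.real 11 0 0 = ∏ i ∈ Finset.range u,
        shotFactor (s.nat x r i) (s.nat ax m i) (s.nat sg m i)) (by norm_num) (by norm_num) hX hnX
        (by decide) rfl ?_ ?_ ?_ ?_) ?_
  · intro s₄ hs₄
    simp [NExp.eval, (o₃.trans (hs₄.off rfl rfl)).1 0 (by decide), hn]
  · intro i s₄ m h; simpa [Store.setNat] using h
  · simpa using h11
  · intro u hu s₄ hs₄ hvu hI'
    have o₄ := o₃.trans (hs₄.off (N := [31, 32]) (R := [11, 12]) rfl rfl)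
    have hv' : s₄.nat 31 0 0 = m := by rw [hs₄.1 31 rfl, v₃]
    refine Runs.setReal_le hX ?_ ?_
    · simp [NExp.cost, RExp.cost, shotFactorExp, NExp.var, RExp.var]; omega
    · simp only [Store.setReal, RExp.eval, NExp.eval, RExp.var, shotFactorExp_eval, NExp.var]
      rw [hrow s₄ o₄, o₄.1 x hx, o₄.1 ax hax, o₄.1 sg hsg, hv', hvu, Finset.prod_range_succ, hI']
      simp
  · intro s₄ hs₄ h₄
    have o₄ := o₃.trans (hs₄.off (N := [31, 32]) (R := [11, 12]) rfl rfl)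
    have hv' : s₄.nat 31 0 0 = m := by rw [hs₄.1 31 rfl, v₃]
    refine Runs.setReal_le hX ?_ ?_
    · simp [NExp.cost, RExp.cost, RExp.var]; omega
    · simp only [Store.setReal, RExp.eval, NExp.eval, RExp.var]
      rw [hwt m hm s₄ o₄ hv', h₄, hs₄.2 12 rfl, h12, hI, Finset.sum_range_succ]
      simp

/-- The number whose base-four digits are `f 0, …, f (n - 1)`. -/
def hornerCode (f : ℕ → ℕ) : ℕ → ℕ
  | 0 => 0
  | i + 1 => 4 * hornerCode f i + f i

theorem hornerCode_congr {f g : ℕ → ℕ} {n : ℕ} (h : ∀ i < n, f i = g i) :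
    hornerCode f n = hornerCode g n := by
  induction n with
  | zero => rfl
  | succ n ih =>
    simp only [hornerCode]
    rw [ih fun i hi => h i (by omega), h n (by omega)]

theorem hornerCode_inj {f g : ℕ → ℕ} {n : ℕ} (hf : ∀ i, f i < 4) (hg : ∀ i, g i < 4)
    (h : hornerCode f n = hornerCode g n) : ∀ i < n, f i = g i := by
  induction n with
  | zero => intro i hi; omega
  | succ n ih =>
    simp only [hornerCode] at h
    have hf' := hf n
    have hg' := hg n
    intro i hi
    rcases Nat.lt_succ_iff_lt_or_eq.1 hi with hi | rfl
    · exact ih (by omega) i hi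
    · omega

/-- Computes the code of the Pauli operator whose letters are in row `row` of array `x`. -/
def codeProg (x : ℕ) (row : NExp) : Prog :=
  (Prog.setVar 22 (.lit 0)).seq
    (.for 32 (.get 0 (.lit 0) (.lit 0))
      (.setVar 22 (.add (.add (.add (.var 22) (.var 22)) (.add (.var 22) (.var 22)))
        (.get x row (.var 32)))))

/-- Horner's scheme. Quadrupling is two doublings by addition, as the machine does not multiply
indices. -/
theorem codeProg_runs {w : CircuitDesc} {s : Store} {x r n X : ℕ} {row : NExp}
    (hX : 1 ≤ X) (hn : s.nat 0 0 0 = n) (hnX : n ≤ X) (hx : x ∉ [22, 32])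
    (hrow : ∀ s', Off [22, 32] [] s s' → row.eval w s' = r) (hrc : row.cost ≤ 10) :
    Runs w (codeProg x row) s (100 * X ^ 1)
      (fun s' => s'.nat 22 0 0 = hornerCode (s.nat x r) n) := by
  refine Runs.setNat_seq 10 90 (by norm_num) hX (by simp [NExp.cost]) ?_
  simp only [NExp.eval]
  have o₁ : Off [22, 32] [] s (s.setNat 22 0 0 0) := Off.refl.setNat (by decide) _ _ _
  refine Runs.for_le (N := n) (c' := 50) (d' := 0) (fun m s' => s'.nat 22 0 0 =
      hornerCode (s.nat x r) m) (by norm_num) (by norm_num) hX hnX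
        (by decide) rfl ?_ ?_ ?_ ?_
  · intro s₂ hs₂
    simp [NExp.eval, (o₁.trans (hs₂.off rfl rfl)).1 0 (by decide), hn]
  · intro i s₂ m h; simpa [Store.setNat] using h
  · simp [Store.setNat, hornerCode]
  intro m hm s₂ hs₂ hv hI
  have o₂ := o₁.trans (hs₂.off (N := [22, 32]) (R := []) rfl rfl)
  refine Runs.setNat_le hX ?_ ?_
  · simp [NExp.cost, NExp.var]; omega
  · simp only [Store.setNat, NExp.eval, NExp.var]
    rw [hrow s₂ o₂, o₂.1 x hx, hv, hI]
    simp [hornerCode]; omega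

/-- Computes the truncation weight: the number of factors `2 / 3` that bring `8` below `ε² δ`. -/
def weightProg : Prog :=
  (Prog.setRVar 10 (.ofNat (.lit 1))).seq
    (.loop (.realLt (.mul (.mul (.get 0 (.lit 0) (.lit 0)) (.get 0 (.lit 0) (.lit 0)))
        (.get 0 (.lit 0) (.lit 1))) (.mul (.ofNat (.lit 8)) (.var 10)))
      ((Prog.setRVar 10 (.div (.mul (.var 10) (.ofNat (.lit 2))) (.ofNat (.lit 3)))).seq
        (.setVar 10 (.add (.var 10) (.lit 1)))))

/-- Exact real arithmetic lets the loop carry `(2/3)^i` itself, so no logarithm has to be computed.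
The hypotheses on `K` say that it is the first index at which the test fails. -/
theorem weightProg_runs {w : CircuitDesc} {s : Store} {K X : ℕ} {ε δ : ℝ} (hX : 1 ≤ X)
    (hε : s.real 0 0 0 = ε) (hδ : s.real 0 0 1 = δ) (h0 : s.nat 10 0 0 = 0)
    (hK : ∀ i < K, ε * ε * δ < 8 * (2 / 3) ^ i) (hK' : 8 * (2 / 3) ^ K ≤ ε * ε * δ) (hKX : K ≤ X) :
    Runs w weightProg s (100 * X ^ 1) (fun s' => s'.nat 10 0 0 = K) := by
  have key : ∀ r i (s : Store), r + i = K → s.real 0 0 0 = ε → s.real 0 0 1 = δ →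
      s.nat 10 0 0 = i → s.real 10 0 0 = (2 / 3) ^ i →
      Runs w (.loop (.realLt (.mul (.mul (.get 0 (.lit 0) (.lit 0)) (.get 0 (.lit 0) (.lit 0)))
        (.get 0 (.lit 0) (.lit 1))) (.mul (.ofNat (.lit 8)) (.var 10)))
      ((Prog.setRVar 10 (.div (.mul (.var 10) (.ofNat (.lit 2))) (.ofNat (.lit 3)))).seq
        (.setVar 10 (.add (.var 10) (.lit 1))))) s (r * 40 + 30)
        (fun s' => s'.nat 10 0 0 = K) := by
    intro r
    induction r with
    | zero =>
      intro i s hi hε hδ hk hp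
      have hi' : i = K := by omega
      subst hi'
      refine ⟨_, s, .loopStop _ ?_, ?_, hk⟩
      · simp [Test.holds, RExp.eval, NExp.eval, RExp.var, hε, hδ, hp]; linarith
      · simp [Test.cost, RExp.cost, RExp.var, NExp.cost]
    | succ r ih =>
      intro i s hi hε hδ hk hp
      obtain ⟨t, s', he, ht, ha⟩ := ih (i + 1)
        ((s.setReal 10 0 0 ((2 / 3) ^ (i + 1))).setNat 10 0 0 (i + 1)) (by omega)
        (by simp [Store.setNat, Store.setReal, hε]) (by simp [Store.setNat, Store.setReal, hδ])
        (by simp [Store.setNat]) (by simp [Store.setNat, Store.setReal])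
      have h₁ := Exec.setReal (w := w) 10 (.lit 0) (.lit 0)
        (.div (.mul (.var 10) (.ofNat (.lit 2))) (.ofNat (.lit 3))) s
      have h₂ := Exec.setNat (w := w) 10 (.lit 0) (.lit 0) (.add (.var 10) (.lit 1))
        (s.setReal 10 0 0 ((2 / 3) ^ (i + 1)))
      have e₁ : RExp.eval w s (.div (.mul (.var 10) (.ofNat (.lit 2))) (.ofNat (.lit 3))) =
          (2 / 3) ^ (i + 1) := by
        simp [RExp.eval, RExp.var, NExp.eval, hp, pow_succ]; ring
      have e₂ : NExp.eval w (s.setReal 10 0 0 ((2 / 3) ^ (i + 1))) (.add (.var 10) (.lit 1)) =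
          i + 1 := by
        simp [NExp.eval, NExp.var, Store.setReal, hk]
      rw [e₁] at h₁
      rw [e₂] at h₂
      refine ⟨_, s', .loopStep ?_ (.seq h₁ h₂) he, ?_, ha⟩
      · simp [Test.holds, RExp.eval, NExp.eval, RExp.var, hε, hδ, hp]; exact hK i (by omega)
      · simp [Test.cost, RExp.cost, RExp.var, NExp.var, NExp.cost]; omega
  refine Runs.setReal_seq 10 80 (by norm_num) hX (by simp [NExp.cost, RExp.cost]) ?_
  refine (key K 0 _ (by simp) ?_ ?_ ?_ ?_).le ?_
  · simpa [Store.setReal] using hε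
  · simpa [Store.setReal] using hδ
  · simpa [Store.setReal] using h0
  · simp [Store.setReal, NExp.eval, RExp.eval]
  · simp; omega

/-! ## The table of low-weight Pauli operators -/

/-- The Pauli operator `P` with letter number `i` replaced by `c`. -/
def setLetter {n : ℕ} (P : Fin n → Fin 4) (i c : ℕ) : Fin n → Fin 4 :=
  fun i' => if (i' : ℕ) = i then Fin.ofNat 4 c else P i'

/-- The Pauli operators that differ from `P` in at most one letter. -/
def neighbors {n : ℕ} (P : Fin n → Fin 4) : List (Fin n → Fin 4) :=
  (List.range n).flatMap fun i => (List.range 4).map fun c => setLetter P i c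

/-- A list of the Pauli operators of weight at most `k`, with repetitions. -/
def lowList (n : ℕ) : ℕ → List (Fin n → Fin 4)
  | 0 => [0]
  | k + 1 => lowList n k ++ (lowList n k).flatMap neighbors

theorem length_lowList (n k : ℕ) : (lowList n k).length = (4 * n + 1) ^ k := by
  induction k with
  | zero => rfl
  | succ k ih =>
    have : ∀ P : Fin n → Fin 4, (neighbors P).length = 4 * n := by
      intro P; simp [neighbors, List.length_flatMap, mul_comm]
    simp [lowList, List.length_flatMap, this, ih, pow_succ]
    ring

/-- Changing one letter raises the weight by at most one. Conversely, an operator of positive weight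
arises from one of smaller weight by restoring an erased letter. -/
theorem mem_lowList {n k : ℕ} {P : Fin n → Fin 4} : P ∈ lowList n k ↔ pauliWeight P ≤ k := by
  induction k generalizing P with
  | zero =>
    simp [lowList, pauliWeight, funext_iff]
  | succ k ih =>
    simp only [lowList, List.mem_append, List.mem_flatMap, neighbors, List.mem_map, List.mem_range,
      ih]
    constructor
    · rintro (h | ⟨P', h, i, hi, c, hc, rfl⟩)
      · omega
      · have : (Finset.univ.filter fun j => setLetter P' i c j ≠ 0) ⊆
            insert ⟨i, hi⟩ (Finset.univ.filter fun j => P' j ≠ 0) := by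
          intro j hj
          have hj' := (Finset.mem_filter.1 hj).2
          by_cases h' : (j : ℕ) = i
          · exact Finset.mem_insert.2 (Or.inl (Fin.ext h'))
          · rw [setLetter, if_neg h'] at hj'
            exact Finset.mem_insert_of_mem (Finset.mem_filter.2 ⟨Finset.mem_univ _, hj'⟩)
        have := (Finset.card_le_card this).trans (Finset.card_insert_le _ _)
        unfold pauliWeight at h ⊢
        omega
    · intro h
      by_cases h0 : pauliWeight P ≤ k
      · exact Or.inl h0
      · have : (Finset.univ.filter fun j => P j ≠ 0).Nonempty := by
          rw [← Finset.card_pos]; unfold pauliWeight at h0; omega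
        obtain ⟨i, hi⟩ := this
        refine Or.inr ⟨setLetter P i 0, ?_, i, i.2, P i, (P i).2, ?_⟩
        · have : (Finset.univ.filter fun j => setLetter P i 0 j ≠ 0) ⊆
              (Finset.univ.filter fun j => P j ≠ 0).erase i := by
            intro j hj
            have hj' := (Finset.mem_filter.1 hj).2
            by_cases h' : (j : ℕ) = i
            · simp [setLetter, h'] at hj'
            · rw [setLetter, if_neg h'] at hj'
              exact Finset.mem_erase.2 ⟨fun h => h' (congrArg _ h),
                Finset.mem_filter.2 ⟨Finset.mem_univ _, hj'⟩⟩
          have := Finset.card_le_card this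
          rw [Finset.card_erase_of_mem hi] at this
          unfold pauliWeight at h ⊢
          omega
        · funext j
          simp only [setLetter, ← Fin.ext_iff]
          by_cases h' : j = i
          · simp [h']
          · simp [h']

/-- Array `11` holds the Pauli operators in the list `l`, and variable `12` their number. -/
def HasTable {n : ℕ} (s : Store) (l : List (Fin n → Fin 4)) : Prop :=
  s.nat 12 0 0 = l.length ∧ ∀ p (h : p < l.length) (i : Fin n), s.nat 11 p i = (l[p] i : ℕ)

/-- Appends a copy of row number `14` with letter number `15` set to variable `16`. -/
def appendProg : Prog :=
  (Prog.for 17 (.get 0 (.lit 0) (.lit 0))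
      (.setNat 11 (.var 12) (.var 17) (.get 11 (.var 14) (.var 17)))).seq
    ((Prog.setNat 11 (.var 12) (.var 15) (.var 16)).seq
      (.setVar 12 (.add (.var 12) (.lit 1))))

theorem appendProg_runs {w : CircuitDesc} {s : Store} {n X r i c : ℕ}
    {l : List (Fin n → Fin 4)} (hX : 1 ≤ X) (hn : s.nat 0 0 0 = n) (hnX : n ≤ X)
    (hl : HasTable s l) (hr : s.nat 14 0 0 = r) (hrl : r < l.length)
    (hi : s.nat 15 0 0 = i) (hc : s.nat 16 0 0 = c) (hc4 : c < 4) :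
    Runs w appendProg s (200 * X ^ 1) (fun s' => HasTable s' (l ++ [setLetter l[r] i c])) := by
  refine Runs.seq_le 100 100 (by norm_num) (Runs.for_le (N := n) (c' := 50) (d' := 0)
    (fun u s' => (∀ p < l.length, s'.nat 11 p = s.nat 11 p) ∧
      ∀ i < u, s'.nat 11 l.length i = s.nat 11 r i) (by norm_num) (by norm_num) hX hnX
        (by decide) rfl ?_ ?_ ?_ ?_) ?_
  · intro s₂ hs₂
    simp [NExp.eval, hs₂.1 0 rfl, hn]
  · intro i s₂ m h; simpa [Store.setNat] using h
  · simp
  · intro u hu s₂ hs₂ hv hI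
    refine Runs.setNat_le hX (by simp [NExp.cost, NExp.var]) ?_
    simp only [NExp.eval, NExp.var, hs₂.1 12 rfl, hs₂.1 14 rfl, hv, hr, hl.1, hI.1 r hrl]
    refine ⟨fun p hp => ?_, fun i hi => ?_⟩
    · funext j
      simp [Store.setNat, hp.ne, hI.1 p hp]
    · rcases Nat.lt_succ_iff_lt_or_eq.1 hi with h | rfl
      · simp [Store.setNat, h.ne, hI.2 i h]
      · simp [Store.setNat]
  · intro s₂ hs₂ hI
    refine Runs.setNat_seq 20 30 (by norm_num) hX (by simp [NExp.cost, NExp.var]) ?_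
    refine Runs.setNat_le hX (by simp [NExp.cost, NExp.var]) ?_
    simp only [NExp.eval, NExp.var, Store.setNat]
    simp only [hs₂.1 12 rfl, hs₂.1 15 rfl, hs₂.1 16 rfl, hl.1, hi, hc]
    refine ⟨by simp, fun p hp j => ?_⟩
    simp only [List.length_append, List.length_singleton] at hp
    by_cases hpl : p < l.length
    · simp [hpl.ne, hI.1 p hpl, List.getElem_append_left hpl, hl.2 p hpl j]
    · have hp' : p = l.length := by omega
      subst hp'
      simp only [List.getElem_concat_length, setLetter]
      by_cases hj : (j : ℕ) = i
      · simp [hj, Nat.mod_eq_of_lt hc4]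
      · simp [hj, hI.2 j j.2, hl.2 r hrl j]

/-- Builds the table of the Pauli operators of weight at most variable `10`. -/
def tableProg : Prog :=
  (Prog.setVar 12 (.lit 1)).seq
    (.for 13 (.var 10) ((Prog.setVar 18 (.var 12)).seq
      (.for 14 (.var 18) (.for 15 (.get 0 (.lit 0) (.lit 0)) (.for 16 (.lit 4) appendProg)))))

/-- The exponent `5` counts the nested loops: rounds, old rows, qubits, letters, and the copying of
a row. Repetitions in the table are tolerated; removing them would need a search. -/
theorem tableProg_runs {w : CircuitDesc} {s : Store} {n X k : ℕ}
    (hX : 4 ≤ X) (hn : s.nat 0 0 0 = n) (hnX : n ≤ X) (hk : s.nat 10 0 0 = k) (hkX : k ≤ X)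
    (hT : (4 * n + 1) ^ k ≤ X) (h0 : ∀ i, s.nat 11 0 i = 0) :
    Runs w tableProg s (500 * X ^ 5) (fun s' => HasTable s' (lowList n k)) := by
  have hX1 : 1 ≤ X := by omega
  refine Runs.setNat_seq 10 490 (by norm_num) hX1 (by simp [NExp.cost]) ?_
  simp only [NExp.eval]
  refine Runs.for_le (N := k) (c' := 450) (d' := 4) (fun u s' => HasTable s' (lowList n u))
    (by norm_num) (by norm_num) hX1 hkX (by decide) rfl ?_ ?_ ?_ ?_
  · intro s₂ hs₂
    simp [NExp.eval, NExp.var, hs₂.1 10 rfl, hk, Store.setNat]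
  · intro i s₂ m h; simpa [HasTable, Store.setNat] using h
  -- The first row is never written: unwritten memory is zero, and the zero row is the identity
  -- operator.
  · refine ⟨by simp [lowList, Store.setNat], fun p hp i => ?_⟩
    simp [lowList] at hp
    subst hp
    change _ = ((0 : Fin n → Fin 4) i : ℕ)
    simp [Store.setNat, h0]
  intro u hu s₂ hs₂ hv hI
  have hn₂ : s₂.nat 0 0 0 = n := by rw [hs₂.1 0 rfl]; simpa [Store.setNat] using hn
  -- Variable `18` freezes the number of rows before the round, since the loops inside it append to
  -- the table and variable `12` grows.
  refine Runs.setNat_seq 10 440 (by norm_num) hX1 (by simp [NExp.cost, NExp.var]) ?_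
  simp only [NExp.eval, NExp.var]
  have hlX : (lowList n u).length ≤ X := by
    rw [length_lowList]
    exact (Nat.pow_le_pow_right (by omega) hu.le).trans hT
  refine Runs.mono (Runs.for_le (N := (lowList n u).length) (c' := 400) (d' := 3)
    (fun r s' => HasTable s' (lowList n u ++ ((lowList n u).take r).flatMap neighbors))
    (by norm_num) (by norm_num) hX1 hlX (by decide) rfl ?_ ?_ ?_ ?_) le_rfl ?_
  rotate_right
  · intro s₃ _ h
    simpa [lowList] using h
  · intro s₃ hs₃
    simp [NExp.eval, hs₃.1 18 rfl, Store.setNat, hI.1]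
  · intro i s₃ m h; simpa [HasTable, Store.setNat] using h
  · rw [List.take_zero, List.flatMap_nil, List.append_nil]
    simpa [HasTable, Store.setNat] using hI
  intro r hr s₃ hs₃ hv₃ hI₃
  have hn₃ : s₃.nat 0 0 0 = n := by rw [hs₃.1 0 rfl]; simpa [Store.setNat] using hn₂
  refine Runs.mono (Runs.for_le (N := n) (c' := 350) (d' := 2)
    (fun i s' => HasTable s' (lowList n u ++ ((lowList n u).take r).flatMap neighbors ++
      (List.range i).flatMap fun i => (List.range 4).map fun c => setLetter (lowList n u)[r] i c))
    (by norm_num) (by norm_num) hX1 hnX (by decide) rfl ?_ ?_ ?_ ?_) le_rfl ?_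
  rotate_right
  · intro s₄ _ h
    rw [List.take_succ_eq_append_getElem hr, List.flatMap_append]
    simpa [neighbors] using h
  · intro s₄ hs₄
    simp [NExp.eval, hs₄.1 0 rfl, hn₃]
  · intro i s₄ m h; simpa [HasTable, Store.setNat] using h
  · simpa using hI₃
  intro i hi s₄ hs₄ hv₄ hI₄
  refine Runs.mono (Runs.for_le (N := 4) (c' := 300) (d' := 1)
    (fun c s' => HasTable s' (lowList n u ++ ((lowList n u).take r).flatMap neighbors ++
      ((List.range i).flatMap fun i => (List.range 4).map fun c => setLetter (lowList n u)[r] i c)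
      ++ (List.range c).map fun c => setLetter (lowList n u)[r] i c))
    (by norm_num) (by norm_num) hX1 hX (by decide) rfl ?_ ?_ ?_ ?_) le_rfl ?_
  rotate_right
  · intro s₅ _ h
    rw [show List.range (i + 1) = List.range i ++ [i] from List.range_succ, List.flatMap_append]
    simpa using h
  · intro s₅ hs₅; rfl
  · intro i s₅ m h; simpa [HasTable, Store.setNat] using h
  · simpa using hI₄
  intro c hc s₅ hs₅ hv₅ hI₅
  refine Runs.mono (appendProg_runs (r := r) (i := i) (c := c) hX1
    (by rw [hs₅.1 0 rfl, hs₄.1 0 rfl, hn₃]) hnX hI₅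
    (by rw [hs₅.1 14 rfl, hs₄.1 14 rfl, hv₃]) (by simp; omega)
    (by rw [hs₅.1 15 rfl, hv₄]) hv₅ hc) (Nat.mul_le_mul_right _ (by norm_num)) ?_
  intro s₆ _ h
  rw [show List.range (c + 1) = List.range c ++ [c] from List.range_succ, List.map_append]
  simp only [List.append_assoc, List.map_cons, List.map_nil] at h ⊢
  rwa [List.getElem_append_left hr] at h

/-! ### Pauli codes, shot estimators and the learning of the observable -/

/-- The code of a Pauli operator. -/
def pauliCode {n : ℕ} (P : Fin n → Fin 4) : ℕ :=
  hornerCode (fun i => if h : i < n then (P ⟨i, h⟩ : ℕ) else 0) n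

theorem pauliCode_injective {n : ℕ} : Function.Injective (pauliCode (n := n)) := by
  intro P P' h
  have h4 : ∀ (P : Fin n → Fin 4) (i : ℕ), (if h : i < n then (P ⟨i, h⟩ : ℕ) else 0) < 4 := by
    intro P i; split_ifs <;> omega
  funext i
  have := hornerCode_inj (h4 P) (h4 P') h i i.2
  simpa [Fin.ext_iff] using this

theorem hornerCode_eq_pauliCode {n : ℕ} {f : ℕ → ℕ} {P : Fin n → Fin 4}
    (h : ∀ i : Fin n, f i = P i) : hornerCode f n = pauliCode P :=
  hornerCode_congr fun i hi => by simp [hi, h ⟨i, hi⟩]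

/-- The weight of a shot with label `σ` in the estimator of the Pauli operator `P`. -/
noncomputable def shotWeight {n : ℕ} (P : Fin n → Fin 4) (σ : StabLabel n) : ℝ :=
  ∏ i, shotFactor (P i) (σ i).1 (σ i).2

/-- The estimator of the Pauli coefficients of an observable. -/
noncomputable def observableEstimate {n M : ℕ} (y : Fin M → StabLabel n × ℝ)
    (P : Fin n → Fin 4) : ℝ :=
  (∑ m, (y m).2 * shotWeight P (y m).1) / M

/-- The estimator of the Pauli expectation values of a state. -/
noncomputable def stateEstimate {n M : ℕ} (x : Fin M → StabLabel n) (P : Fin n → Fin 4) : ℝ :=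
  (∑ m, shotWeight P (x m)) / M

/-- The store still contains the input of the simulation. -/
def HasInput {n M : ℕ} (L : ℕ) (x : Fin M → StabLabel n) (y : Fin M → StabLabel n × ℝ)
    (s : Store) : Prop :=
  (∀ a < 5, s.nat a = (simInput L 0 0 x y).nat a) ∧ s.real 1 = (simInput L 0 0 x y).real 1

/-- The input occupies the arrays of natural numbers below `5` and the real array `1`, so it
survives any program that writes elsewhere. The real array `0` is not part of it, which is why zeros
can stand for `ε` and `δ` in `HasInput`. -/
theorem HasInput.of_off {n M L : ℕ} {x : Fin M → StabLabel n} {y : Fin M → StabLabel n × ℝ}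
    {s s' : Store} {N R : List ℕ} (h : HasInput L x y s) (o : Off N R s s')
    (hN : (N.all fun a => decide (5 ≤ a)) = true) (hR : R.contains 1 = false) :
    HasInput L x y s' := by
  simp only [List.all_eq_true, decide_eq_true_eq] at hN
  refine ⟨fun a ha => ?_, ?_⟩
  · rw [o.1 a fun h' => by have := hN a h'; omega, h.1 a ha]
  · rw [o.2 1 fun h' => by simp_all, h.2]

section

variable {n M L : ℕ} {x : Fin M → StabLabel n} {y : Fin M → StabLabel n × ℝ} {s : Store}

theorem HasInput.nat_n (h : HasInput L x y s) : s.nat 0 0 0 = n := by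
  rw [h.1 0 (by norm_num)]; rfl

theorem HasInput.nat_L (h : HasInput L x y s) : s.nat 0 0 1 = L := by
  rw [h.1 0 (by norm_num)]; rfl

theorem HasInput.nat_M (h : HasInput L x y s) : s.nat 0 0 2 = M := by
  rw [h.1 0 (by norm_num)]; rfl

theorem HasInput.state_sum (h : HasInput L x y s) {f : ℕ → ℕ} {P : Fin n → Fin 4}
    (hf : ∀ i : Fin n, f i = P i) :
    ∑ m ∈ Finset.range M, (1 : ℝ) * ∏ i ∈ Finset.range n,
      shotFactor (f i) (s.nat 1 m i) (s.nat 2 m i) = ∑ m, shotWeight P (x m) := by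
  rw [h.1 1 (by norm_num), h.1 2 (by norm_num), Finset.sum_range]
  refine Finset.sum_congr rfl fun m _ => ?_
  rw [Finset.prod_range, one_mul]
  exact Finset.prod_congr rfl fun i _ => by simp [simInput, hf]

theorem HasInput.observable_sum (h : HasInput L x y s) {f : ℕ → ℕ} {P : Fin n → Fin 4}
    (hf : ∀ i : Fin n, f i = P i) :
    ∑ m ∈ Finset.range M, s.real 1 0 m * ∏ i ∈ Finset.range n,
      shotFactor (f i) (s.nat 3 m i) (s.nat 4 m i) = ∑ m, (y m).2 * shotWeight P (y m).1 := by
  rw [h.1 3 (by norm_num), h.1 4 (by norm_num), h.2, Finset.sum_range]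
  refine Finset.sum_congr rfl fun m _ => ?_
  rw [Finset.prod_range]
  congr 1
  · simp [simInput]
  · exact Finset.prod_congr rfl fun i _ => by simp [simInput, hf]

end

/-- Estimates the coefficients of the observable at all operators in the table. -/
def learnProg : Prog :=
  .for 14 (.var 12)
    ((shotSum 11 (.var 14) 3 4 (.get 1 (.lit 0) (.var 31))).seq
      ((codeProg 11 (.var 14)).seq
        (.setReal 13 (.lit 0) (.var 22)
          (.div (.var 12) (.ofNat (.get 0 (.lit 0) (.lit 2)))))))

/-- The estimate for `P` is stored in the column given by the code of `P`, so a repeated row merely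
rewrites the same value. The later rows of array `13` must stay zero because the evolution
accumulates into them. -/
theorem learnProg_runs {w : CircuitDesc} {n M L X : ℕ} {x : Fin M → StabLabel n}
    {y : Fin M → StabLabel n × ℝ} {s : Store} {l : List (Fin n → Fin 4)} (hX : 1 ≤ X)
    (hnX : n ≤ X) (hMX : M ≤ X) (hlX : l.length ≤ X) (hin : HasInput L x y s)
    (hl : HasTable s l) (h0 : ∀ i ≥ 1, ∀ a, s.real 13 i a = 0) :
    Runs w learnProg s (1000 * X ^ 3) (fun s' =>
      (∀ P ∈ l, s'.real 13 0 (pauliCode P) = observableEstimate y P) ∧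
        ∀ i ≥ 1, ∀ a, s'.real 13 i a = 0) := by
  refine Runs.mono (Runs.for_le (N := l.length) (c' := 900) (d' := 2) (fun r s' =>
      (∀ P ∈ l.take r, s'.real 13 0 (pauliCode P) = observableEstimate y P) ∧
        ∀ i ≥ 1, ∀ a, s'.real 13 i a = 0) (by norm_num) (by norm_num) hX hlX (by decide) rfl
        ?_ ?_ ?_ ?_) le_rfl ?_
  · intro s₂ hs₂
    simp [NExp.eval, NExp.var, hs₂.1 12 rfl, hl.1]
  · intro i s₂ m h; simpa [Store.setNat] using h
  · simpa using h0
  · intro r hr s₂ hs₂ hv hI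
    have o₂ : Off [14, 31, 32, 22] [11, 12, 13] s s₂ := hs₂.off rfl rfl
    have hin₂ := hin.of_off o₂ rfl rfl
    refine Runs.seq_le 400 400 (by norm_num) (shotSum_runs (r := r) (y := fun m => s₂.real 1 0 m)
      hX hin₂.nat_n hin₂.nat_M hnX hMX (by decide) (by decide) (by decide) ?_ ?_ ?_ ?_) ?_
    · intro s₃ o₃; simp [NExp.eval, NExp.var, o₃.1 14 (by decide), hv]
    · simp [NExp.cost, NExp.var]
    · intro m hm s₃ o₃ h; simp [RExp.eval, NExp.eval, NExp.var, o₃.2 1 (by decide), h]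
    · simp [NExp.cost, RExp.cost, NExp.var]
    intro s₃ hs₃ h₃
    have o₃ : Off [14, 31, 32, 22] [11, 12, 13] s₂ s₃ := hs₃.off rfl rfl
    have hin₃ := hin₂.of_off o₃ rfl rfl
    have hl₃ : ∀ i : Fin n, s₃.nat 11 r i = (l[r] i : ℕ) := fun i => by
      rw [o₃.1 11 (by decide), o₂.1 11 (by decide), hl.2 r hr i]
    rw [hin₂.observable_sum fun i => by rw [← hl₃ i, o₃.1 11 (by decide)]] at h₃
    refine Runs.seq_le 100 100 (by norm_num) ((codeProg_runs (r := r) hX hin₃.nat_n hnX (by decide)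
      ?_ ?_).pow_le hX (by norm_num) le_rfl) ?_
    · intro s₄ o₄
      simp [NExp.eval, NExp.var, o₄.1 14 (by decide), hs₃.1 14 rfl, hv]
    · simp [NExp.cost, NExp.var]
    intro s₄ hs₄ h₄
    have hin₄ := hin₃.of_off (N := [22, 32]) (R := []) (hs₄.off rfl rfl) rfl rfl
    rw [hornerCode_eq_pauliCode hl₃] at h₄
    refine Runs.setReal_le hX (by simp [NExp.cost, RExp.cost, NExp.var, RExp.var]) ?_
    have e13 : s₄.real 13 = s₂.real 13 := by rw [hs₄.2 13 rfl, hs₃.2 13 rfl]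
    have hval : RExp.eval w s₄ (.div (.var 12) (.ofNat (.get 0 (.lit 0) (.lit 2)))) =
        observableEstimate y l[r] := by
      simp [RExp.eval, NExp.eval, RExp.var, hin₄.nat_M, hs₄.2 12 rfl, h₃, observableEstimate]
    rw [hval]
    simp only [NExp.eval, NExp.var, h₄, Store.setReal]
    refine ⟨fun P hP => ?_, fun i hi a => ?_⟩
    · rw [List.take_succ_eq_append_getElem hr, List.mem_append, List.mem_singleton] at hP
      by_cases hPr : P = l[r]
      · simp [hPr]
      · have := hP.resolve_right hPr
        simp [pauliCode_injective.eq_iff, hPr, e13, hI.1 P this]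
    · have : i ≠ 0 := by omega
      simp [this, e13, hI.2 i hi a]
  · intro s₂ _ h
    simpa using h

/-! ## One step of the Heisenberg evolution -/

/-- The argument array `20` is zero where the letters and parameters are not stored. -/
def ArgClean (n : ℕ) (s : Store) : Prop :=
  ∀ a b, (a = 0 → 3 ≤ b) → (a = 1 → n ≤ b) → s.nat 20 a b = 0

/-- Calls the program `Q` for row `14` of the table in step `25`. -/
def callProg (Q : Prog) : Prog :=
  (Prog.for 32 (.get 0 (.lit 0) (.lit 0))
      (.setNat 20 (.lit 1) (.var 32) (.get 11 (.var 14) (.var 32)))).seq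
    ((Prog.setNat 20 (.lit 0) (.lit 0) (.get 0 (.lit 0) (.lit 0))).seq
      ((Prog.setNat 20 (.lit 0) (.lit 1) (.get 0 (.lit 0) (.lit 1))).seq
        ((Prog.setNat 20 (.lit 0) (.lit 2)
            (.sub (.get 0 (.lit 0) (.lit 1)) (.add (.lit 1) (.var 25)))).seq
          (.call Q 20 21 21))))

/-- The hypothesis on `Q` concerns one initial memory, so the whole argument array has to coincide
with `heisenbergArg`, including the cells that are meant to be zero; `ArgClean` maintains the latter
between calls. Step `i` treats the layer with index `L - (1 + i)`. -/
theorem callProg_runs {w : CircuitDesc} {Q : Prog} {n M L X i r t : ℕ} {x : Fin M → StabLabel n}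
    {y : Fin M → StabLabel n × ℝ} {s s' : Store} {l : List (Fin n → Fin 4)} (hX : 1 ≤ X)
    (hnX : n ≤ X) (hin : HasInput L x y s) (hl : HasTable s l) (hr : r < l.length)
    (hvr : s.nat 14 0 0 = r) (hvi : s.nat 25 0 0 = i) (hc : ArgClean n s)
    (hQ : Exec w Q (Store.ofArg (heisenbergArg L (L - (1 + i)) l[r])) t s') (htX : t ≤ X) :
    Runs w (callProg Q) s (200 * X ^ 1) (fun s'' => s''.nat 21 = s'.nat 0 ∧
      s''.real 21 = s'.real 0 ∧ ArgClean n s'') := by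
  refine Runs.seq_le 100 100 (by norm_num) (Runs.for_le (N := n) (c' := 50) (d' := 0)
    (fun u s' => ArgClean n s' ∧ ∀ i : Fin n, (i : ℕ) < u → s'.nat 20 1 i = (l[r] i : ℕ))
    (by norm_num) (by norm_num) hX hnX (by decide) rfl ?_ ?_ ?_ ?_) ?_
  · intro s₂ hs₂
    simp [NExp.eval, hs₂.1 0 rfl, hin.nat_n]
  · intro i s₂ m h; simpa [Store.setNat, ArgClean] using h
  · simpa using hc
  · intro u hu s₂ hs₂ hv hI
    refine Runs.setNat_le hX (by simp [NExp.cost, NExp.var]) ?_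
    simp only [NExp.eval, NExp.var, hv, hs₂.1 14 rfl, hs₂.1 11 rfl, hvr]
    refine ⟨fun a b ha hb => ?_, fun j hj => ?_⟩
    · have : ¬ (a = 1 ∧ b = u) := by rintro ⟨h, rfl⟩; have := hb h; omega
      simp [Store.setNat, this, hI.1 a b ha hb]
    · by_cases h : (j : ℕ) = u
      · have := hl.2 r hr j
        rw [h] at this
        simp [Store.setNat, h, this]
      · simp [Store.setNat, h, hI.2 j (by omega)]
  intro s₂ hs₂ ⟨hc₂, hl₂⟩
  have hin₂ := hin.of_off (N := [20, 32]) (R := []) (hs₂.off rfl rfl) rfl rfl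
  refine Runs.setNat_seq 10 90 (by norm_num) hX (by simp [NExp.cost]) ?_
  simp only [NExp.eval]
  refine Runs.setNat_seq 10 80 (by norm_num) hX (by simp [NExp.cost]) ?_
  simp only [NExp.eval]
  refine Runs.setNat_seq 20 60 (by norm_num) hX (by simp [NExp.cost, NExp.var]) ?_
  simp only [NExp.eval, NExp.var]
  simp only [Store.setNat]
  simp [hin₂.nat_n, hin₂.nat_L, hs₂.1 25 rfl, hvi]
  refine ⟨_, _, Exec.call (s₁ := s') (t := t) _ _ _ ?_, ?_, ?_⟩
  · convert hQ using 2
    funext a b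
    rcases a with _ | _ | a
    · rcases b with _ | _ | _ | b
      · simp [heisenbergArg]
      · simp [heisenbergArg]
      · simp [heisenbergArg]
      · simp [heisenbergArg, hc₂ 0 (b + 3) (by omega) (by omega)]
    · by_cases hb : b < n
      · simpa [heisenbergArg, hb] using hl₂ ⟨b, hb⟩ hb
      · simp [heisenbergArg, hb, hc₂ 1 b (by omega) (by omega)]
    · simp [heisenbergArg, hc₂ (a + 2) b (by omega) (by omega)]
  · omega
  · refine ⟨by simp [Store.afterCall], by simp [Store.afterCall], fun a b ha hb => ?_⟩
    simp only [Store.afterCall]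
    have h0 : ¬ (a = 0 ∧ b = 0) := by omega
    have h1 : ¬ (a = 0 ∧ b = 1) := by omega
    have h2 : ¬ (a = 0 ∧ b = 2) := by omega
    simp [h0, h1, h2, hc₂ a b ha hb]

/-- Distributes the coefficient in variable `15` over the terms in the arrays `21`. -/
def termsProg : Prog :=
  .for 26 (.get 21 (.lit 0) (.lit 0))
    ((codeProg 21 (.add (.var 26) (.lit 1))).seq
      ((Prog.setReal 13 (.add (.var 25) (.lit 1)) (.var 22)
          (.add (.get 13 (.add (.var 25) (.lit 1)) (.var 22))
            (.mul (.var 15) (.get 21 (.lit 0) (.var 26))))).seq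
        ((shotSum 21 (.add (.var 26) (.lit 1)) 1 2 (.ofNat (.lit 1))).seq
          (.setReal 14 (.lit 0) (.var 25)
            (.add (.get 14 (.lit 0) (.var 25))
              (.div (.mul (.mul (.var 15) (.get 21 (.lit 0) (.var 26))) (.var 12))
                (.ofNat (.get 0 (.lit 0) (.lit 2)))))))))

/-- The expansion returned by `Q` may list a Pauli operator several times, hence coefficients are
added and not assigned. Injectivity of the code keeps different operators in different cells. -/
theorem termsProg_runs {w : CircuitDesc} {n M L X i m : ℕ} {d : ℝ} {x : Fin M → StabLabel n}
    {y : Fin M → StabLabel n × ℝ} {s : Store} {T : ℕ → Fin n → Fin 4} {v : ℕ → ℝ} (hX : 1 ≤ X)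
    (hnX : n ≤ X) (hMX : M ≤ X) (hmX : m ≤ X) (hin : HasInput L x y s)
    (hvi : s.nat 25 0 0 = i) (hd : s.real 15 0 0 = d) (hm : s.nat 21 0 0 = m)
    (hT : ∀ q < m, ∀ u : Fin n, s.nat 21 (q + 1) u = (T q u : ℕ))
    (hv : ∀ q < m, s.real 21 0 q = v q) :
    Runs w termsProg s (800 * X ^ 3) (fun s' =>
      (∀ T', s'.real 13 (i + 1) (pauliCode T') = s.real 13 (i + 1) (pauliCode T') +
        d * ∑ q ∈ Finset.range m, if T q = T' then v q else 0) ∧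
      (∀ i' ≠ i + 1, s'.real 13 i' = s.real 13 i') ∧
      s'.real 14 0 i = s.real 14 0 i +
        d * ∑ q ∈ Finset.range m, v q * stateEstimate x (T q) ∧
      ∀ i' ≠ i, s'.real 14 0 i' = s.real 14 0 i') := by
  refine Runs.for_le (N := m) (c' := 700) (d' := 2) (fun m s' =>
      (∀ T', s'.real 13 (i + 1) (pauliCode T') = s.real 13 (i + 1) (pauliCode T') +
        d * ∑ q ∈ Finset.range m, if T q = T' then v q else 0) ∧
      (∀ i' ≠ i + 1, s'.real 13 i' = s.real 13 i') ∧
      s'.real 14 0 i = s.real 14 0 i +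
        d * ∑ q ∈ Finset.range m, v q * stateEstimate x (T q) ∧
      ∀ i' ≠ i, s'.real 14 0 i' = s.real 14 0 i') (by norm_num) (by norm_num) hX hmX (by decide)
      rfl ?_ ?_ ?_ ?_
  · intro s₂ hs₂
    simp [NExp.eval, hs₂.1 21 rfl, hm]
  · intro i s₂ m h; simpa [Store.setNat] using h
  · simp
  intro q hq s₂ hs₂ hvq hI
  have hin₂ := hin.of_off (N := [26, 22, 32, 31]) (R := [11, 12, 13, 14]) (hs₂.off rfl rfl) rfl rfl
  have e21 : s₂.nat 21 = s.nat 21 := hs₂.1 21 rfl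
  have r21 : s₂.real 21 = s.real 21 := hs₂.2 21 rfl
  have r15 : s₂.real 15 = s.real 15 := hs₂.2 15 rfl
  have e25 : s₂.nat 25 = s.nat 25 := hs₂.1 25 rfl
  refine Runs.seq_le 100 600 (by norm_num) ((codeProg_runs (r := q + 1) hX hin₂.nat_n hnX (by decide)
      ?_ ?_).pow_le hX (by norm_num) le_rfl) ?_
  · intro s₃ o₃
    simp [NExp.eval, NExp.var, o₃.1 26 (by decide), hvq]
  · simp [NExp.cost, NExp.var]
  intro s₃ hs₃ h₃
  have hin₃ := hin₂.of_off (N := [22, 32]) (R := []) (hs₃.off rfl rfl) rfl rfl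
  rw [hornerCode_eq_pauliCode fun u => by rw [e21, hT q hq u]] at h₃
  have v26 : s₃.nat 26 0 0 = q := by rw [hs₃.1 26 rfl, hvq]
  have v25 : s₃.nat 25 0 0 = i := by rw [hs₃.1 25 rfl, e25, hvi]
  have v15 : s₃.real 15 0 0 = d := by rw [hs₃.2 15 rfl, r15, hd]
  have v21 : s₃.real 21 0 q = v q := by rw [hs₃.2 21 rfl, r21, hv q hq]
  refine Runs.setReal_seq 50 550 (by norm_num) hX
    (by simp [NExp.cost, RExp.cost, NExp.var, RExp.var]) ?_
  simp only [NExp.eval, RExp.eval, NExp.var, RExp.var, v25, v26, v15, v21, h₃]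
  set s₄ := s₃.setReal 13 (i + 1) (pauliCode (T q))
    (s₃.real 13 (i + 1) (pauliCode (T q)) + d * v q) with hs₄
  have hin₄ := hin₃.of_off (s' := s₄) (N := []) (R := [13])
    (Off.refl.setReal (by decide) _ _ _) rfl rfl
  refine Runs.seq_le 400 100 (by norm_num) (shotSum_runs (r := q + 1) (y := fun _ => 1)
      hX hin₄.nat_n hin₄.nat_M hnX hMX (by decide) (by decide) (by decide) ?_ ?_ ?_ ?_) ?_
  · intro s₅ o₅
    simp only [NExp.eval, o₅.1 26 (by decide)]
    simp [hs₄, Store.setReal, v26]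
  · simp [NExp.cost]
  · intro _ _ _ _ _; simp [RExp.eval, NExp.eval]
  · simp [NExp.cost, RExp.cost]
  intro s₅ hs₅ h₅
  have hin₅ := hin₄.of_off (N := [31, 32]) (R := [11, 12]) (hs₅.off rfl rfl) rfl rfl
  rw [hin₄.state_sum (P := T q) fun u => by
    rw [← hT q hq u, ← e21]; simp [hs₄, Store.setReal, hs₃.1 21 rfl]] at h₅
  have w25 : s₅.nat 25 0 0 = i := by rw [hs₅.1 25 rfl]; exact v25
  have w26 : s₅.nat 26 0 0 = q := by rw [hs₅.1 26 rfl]; exact v26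
  have w15 : s₅.real 15 0 0 = d := by rw [hs₅.2 15 rfl, ← v15]; simp [hs₄, Store.setReal]
  have w21 : s₅.real 21 0 q = v q := by rw [hs₅.2 21 rfl, ← v21]; simp [hs₄, Store.setReal]
  have w14 : s₅.real 14 = s₂.real 14 := by
    rw [hs₅.2 14 rfl, ← hs₃.2 14 rfl]; funext a b; simp [hs₄, Store.setReal]
  have w13 : ∀ a b, s₅.real 13 a b = if a = i + 1 ∧ b = pauliCode (T q) then
      s₂.real 13 (i + 1) (pauliCode (T q)) + d * v q else s₂.real 13 a b := by
    intro a b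
    rw [hs₅.2 13 rfl, ← hs₃.2 13 rfl]; simp [hs₄, Store.setReal]
  refine Runs.setReal_le hX (by simp [NExp.cost, RExp.cost]) ?_
  simp only [NExp.eval, RExp.eval, w25, w26, w15, w21, h₅, hin₅.nat_M]
  refine ⟨fun T' => ?_, fun i' hi' => ?_, ?_, fun i' hi' => ?_⟩
  · simp only [Store.setReal, Finset.sum_range_succ]
    simp only [w13, pauliCode_injective.eq_iff, hI.1]
    by_cases h : T' = T q
    · subst h; simp; ring
    · simp [h, Ne.symm h]
  · funext a
    simp [Store.setReal, w13, hi', hI.2.1 i' hi']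
  · simp [Store.setReal, w14, hI.2.2.1, Finset.sum_range_succ, stateEstimate]; ring
  · simp [Store.setReal, w14, hI.2.2.2 i' hi', hi']

/-- Propagates row `14` of the table through one layer. -/
def rowProg (Q : Prog) : Prog :=
  (callProg Q).seq
    ((codeProg 11 (.var 14)).seq
      ((Prog.setRVar 15 (.get 13 (.var 25) (.var 22))).seq
        ((Prog.setReal 13 (.var 25) (.var 22) (.ofNat (.lit 0))).seq termsProg)))

/-- Within `X` steps, `Q` expands layer `j` applied to `P` with coefficients `G`. -/
def Expands {n : ℕ} (w : CircuitDesc) (Q : Prog) (X L j : ℕ) (P : Fin n → Fin 4)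
    (G : (Fin n → Fin 4) → ℝ) : Prop :=
  ∃ (t : ℕ) (s : Store) (m : ℕ) (T : ℕ → Fin n → Fin 4),
    Exec w Q (Store.ofArg (heisenbergArg L j P)) t s ∧ t ≤ X ∧ m ≤ X ∧ s.nat 0 0 0 = m ∧
    (∀ q < m, ∀ u : Fin n, s.nat 0 (q + 1) u = (T q u : ℕ)) ∧
    ∀ T', (∑ q ∈ Finset.range m, if T q = T' then s.real 0 0 q else 0) = G T'

/-- The coefficient is read and its cell cleared before the terms are distributed. Further
occurrences of the same operator in the table then contribute nothing. -/
theorem rowProg_runs {w : CircuitDesc} {Q : Prog} {n M L X i r : ℕ} {x : Fin M → StabLabel n}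
    {y : Fin M → StabLabel n × ℝ} {s : Store} {l : List (Fin n → Fin 4)}
    {G : (Fin n → Fin 4) → ℝ} (hX : 1 ≤ X)
    (hnX : n ≤ X) (hMX : M ≤ X) (hin : HasInput L x y s) (hl : HasTable s l) (hr : r < l.length)
    (hvr : s.nat 14 0 0 = r) (hvi : s.nat 25 0 0 = i) (hc : ArgClean n s)
    (hQ : Expands w Q X L (L - (1 + i)) l[r] G) :
    Runs w (rowProg Q) s (1300 * X ^ 3) (fun s' => ArgClean n s' ∧
      (∀ T', s'.real 13 i (pauliCode T') =
        if T' = l[r] then 0 else s.real 13 i (pauliCode T')) ∧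
      (∀ T', s'.real 13 (i + 1) (pauliCode T') = s.real 13 (i + 1) (pauliCode T') +
        s.real 13 i (pauliCode l[r]) * G T') ∧
      (∀ i', i' ≠ i → i' ≠ i + 1 → s'.real 13 i' = s.real 13 i') ∧
      s'.real 14 0 i = s.real 14 0 i +
        s.real 13 i (pauliCode l[r]) * ∑ T, G T * stateEstimate x T ∧
      ∀ i' ≠ i, s'.real 14 0 i' = s.real 14 0 i') := by
  obtain ⟨t, sQ, m, T, hQ, htX, hmX, hm, hT, hG⟩ := hQ
  refine Runs.seq_le 200 1100 (by norm_num)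
    ((callProg_runs hX hnX hin hl hr hvr hvi hc hQ htX).pow_le hX (by norm_num) le_rfl) ?_
  rintro s₁ hs₁ ⟨h21, hr21, hc₁⟩
  have hin₁ := hin.of_off (N := [20, 21, 32]) (R := [21]) (hs₁.off rfl rfl) rfl rfl
  refine Runs.seq_le 100 1000 (by norm_num) ((codeProg_runs (r := r) hX hin₁.nat_n hnX (by decide)
      ?_ ?_).pow_le hX (by norm_num) le_rfl) ?_
  · intro s₂ o₂
    simp [NExp.eval, NExp.var, o₂.1 14 (by decide), hs₁.1 14 rfl, hvr]
  · simp [NExp.cost, NExp.var]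
  intro s₂ hs₂ h₂
  have hin₂ := hin₁.of_off (N := [22, 32]) (R := []) (hs₂.off rfl rfl) rfl rfl
  rw [hornerCode_eq_pauliCode fun u => by rw [hs₁.1 11 rfl, hl.2 r hr u]] at h₂
  have v25 : s₂.nat 25 0 0 = i := by rw [hs₂.1 25 rfl, hs₁.1 25 rfl, hvi]
  have r13 : s₂.real 13 = s.real 13 := by rw [hs₂.2 13 rfl, hs₁.2 13 rfl]
  have r14 : s₂.real 14 = s.real 14 := by rw [hs₂.2 14 rfl, hs₁.2 14 rfl]
  have e21 : s₂.nat 21 = sQ.nat 0 := by rw [hs₂.1 21 rfl, h21]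
  have r21 : s₂.real 21 = sQ.real 0 := by rw [hs₂.2 21 rfl, hr21]
  have e20 : s₂.nat 20 = s₁.nat 20 := hs₂.1 20 rfl
  refine Runs.setReal_seq 50 950 (by norm_num) hX
    (by simp [NExp.cost, RExp.cost, NExp.var]) ?_
  simp only [NExp.eval, RExp.eval, NExp.var, v25, h₂, r13]
  refine Runs.setReal_seq 50 900 (by norm_num) hX
    (by simp [NExp.cost, RExp.cost]) ?_
  set s₃ := s₂.setReal 15 0 0 (s.real 13 i (pauliCode l[r])) with hs₃
  have n₃ : s₃.nat = s₂.nat := rfl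
  simp only [NExp.eval, RExp.eval, n₃, v25, h₂]
  set s₄ := s₃.setReal 13 i (pauliCode l[r]) ((0 : ℕ) : ℝ) with hs₄
  have n₄ : s₄.nat = s₂.nat := rfl
  have w13 : ∀ a b, s₄.real 13 a b = if a = i ∧ b = pauliCode l[r] then 0 else s.real 13 a b := by
    intro a b; simp [hs₄, hs₃, Store.setReal, r13]
  have w14 : s₄.real 14 = s.real 14 := by
    rw [← r14]; funext a b; simp [hs₄, hs₃, Store.setReal]
  have w21 : s₄.real 21 = sQ.real 0 := by
    rw [← r21]; funext a b; simp [hs₄, hs₃, Store.setReal]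
  refine Runs.mono ((termsProg_runs (T := T) (v := fun q => sQ.real 0 0 q) (i := i) (m := m)
    (d := s.real 13 i (pauliCode l[r])) hX hnX hMX hmX
    (hin₂.of_off (N := []) (R := [15, 13])
      ((Off.refl.setReal (by decide) _ _ _).setReal (by decide) _ _ _) rfl rfl)
    (by rw [n₄, v25]) (by simp [Store.setReal]) (by rw [n₄, e21, hm])
    (fun q hq u => by rw [n₄, e21, hT q hq u]) (fun q hq => by rw [w21])).pow_le hX le_rfl
    (by norm_num)) le_rfl ?_
  rintro s₅ hs₅ ⟨ha, hb, hd, he⟩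
  refine ⟨fun a b => ?_, fun T' => ?_, fun T' => ?_, fun i' h1 h2 => ?_, ?_, fun i' h => ?_⟩
  · rw [hs₅.1 20 rfl, n₄, e20]; exact hc₁ a b
  · rw [hb i (by omega), w13]; simp [pauliCode_injective.eq_iff]
  · rw [ha, w13, if_neg (by omega), hG]
  · rw [hb i' h2]; funext a; exact (w13 i' a).trans (if_neg fun h => h1 h.1)
  · rw [hd, w14]
    congr 2
    simp_rw [← hG, Finset.sum_mul]
    rw [Finset.sum_comm]
    refine Finset.sum_congr rfl fun q _ => ?_
    simp [ite_mul]
  · rw [he i' h, w14]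

/-! ### The sweep through all layers -/

/-- The Pauli operators of weight at most `k`. -/
def lowSet (n k : ℕ) : Finset (Fin n → Fin 4) := Finset.univ.filter fun P => pauliWeight P ≤ k

/-- The coefficients after the truncated Heisenberg evolution through `i` layers, the first one of
which is layer number `L - 1`. -/
noncomputable def evolvedCoeff {n : ℕ} (k L : ℕ) (G : ℕ → (Fin n → Fin 4) → (Fin n → Fin 4) → ℝ)
    (c : (Fin n → Fin 4) → ℝ) : ℕ → (Fin n → Fin 4) → ℝ
  | 0 => c
  | i + 1 => fun T => ∑ P ∈ lowSet n k, evolvedCoeff k L G c i P * G (L - (1 + i)) P T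

/-- Propagates all rows through all layers. -/
def layersProg (Q : Prog) : Prog :=
  .for 25 (.get 0 (.lit 0) (.lit 1)) (.for 14 (.var 12) (rowProg Q))

/-- Truncation takes place by omission: coefficients of all weights are written to row `i + 1`, but
only operators in the table are ever read from row `i`. -/
theorem layerProg_runs {w : CircuitDesc} {Q : Prog} {n M L X i k : ℕ} {x : Fin M → StabLabel n}
    {y : Fin M → StabLabel n × ℝ} {s : Store} {c : (Fin n → Fin 4) → ℝ}
    {G : (Fin n → Fin 4) → (Fin n → Fin 4) → ℝ} (hX : 1 ≤ X)
    (hnX : n ≤ X) (hMX : M ≤ X) (hkX : (4 * n + 1) ^ k ≤ X) (hin : HasInput L x y s)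
    (hl : HasTable s (lowList n k)) (hvi : s.nat 25 0 0 = i) (hc : ArgClean n s)
    (hQ : ∀ P, pauliWeight P ≤ k → Expands w Q X L (L - (1 + i)) P (G P))
    (h13 : ∀ P ∈ lowSet n k, s.real 13 i (pauliCode P) = c P)
    (h13' : ∀ i' > i, ∀ a, s.real 13 i' a = 0) (h14 : ∀ i' ≥ i, s.real 14 0 i' = 0) :
    Runs w (.for 14 (.var 12) (rowProg Q)) s (1400 * X ^ 4) (fun s' => ArgClean n s' ∧
      (∀ T, s'.real 13 (i + 1) (pauliCode T) = ∑ P ∈ lowSet n k, c P * G P T) ∧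
      (∀ i' > i + 1, ∀ a, s'.real 13 i' a = 0) ∧
      s'.real 14 0 i = ∑ P ∈ lowSet n k, c P * ∑ T, G P T * stateEstimate x T ∧
      ∀ i' ≠ i, s'.real 14 0 i' = s.real 14 0 i') := by
  have hlow : (lowList n k).toFinset = lowSet n k := by
    ext P; simp [mem_lowList, lowSet]
  refine Runs.mono (Runs.for_le (N := (lowList n k).length) (c' := 1300) (d' := 3) (fun r s' =>
    ArgClean n s' ∧
      (∀ P ∈ lowSet n k, s'.real 13 i (pauliCode P) =
        if P ∈ ((lowList n k).take r).toFinset then 0 else c P) ∧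
      (∀ T, s'.real 13 (i + 1) (pauliCode T) =
        ∑ P ∈ ((lowList n k).take r).toFinset, c P * G P T) ∧
      (∀ i' > i + 1, ∀ a, s'.real 13 i' a = 0) ∧
      s'.real 14 0 i = ∑ P ∈ ((lowList n k).take r).toFinset,
        c P * ∑ T, G P T * stateEstimate x T ∧
      ∀ i' ≠ i, s'.real 14 0 i' = s.real 14 0 i') (by norm_num) (by norm_num) hX (by rwa [length_lowList])
    (by decide) rfl ?_ ?_ ?_ ?_) le_rfl ?_
  · intro s₂ hs₂
    simp [NExp.eval, NExp.var, hs₂.1 12 rfl, hl.1]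
  · intro i s₂ m h; simpa [Store.setNat, ArgClean] using h
  · exact ⟨hc, by simpa using h13, by simp [h13' (i + 1) (by omega)],
      fun i' h => h13' i' (by omega), by simp [h14 i le_rfl], fun _ _ => rfl⟩
  · rintro r hr s₂ hs₂ hv ⟨hc₂, ha, hb, hb', hd, he⟩
    have o₂ : Off [14, 20, 21, 22, 26, 31, 32] [11, 12, 13, 14, 15, 21] s s₂ := hs₂.off rfl rfl
    have hmem : (lowList n k)[r] ∈ lowSet n k := by
      rw [← hlow, List.mem_toFinset]; exact List.getElem_mem _
    refine Runs.mono (rowProg_runs (i := i) (r := r) (l := lowList n k) hX hnX hMX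
      (hin.of_off o₂ rfl rfl) ?_ hr hv (by rw [o₂.1 25 (by decide), hvi]) hc₂
      (hQ _ (mem_lowList.1 (List.getElem_mem _)))) le_rfl ?_
    · unfold HasTable
      rw [o₂.1 12 (by decide), o₂.1 11 (by decide)]; exact hl
    rintro s₃ hs₃ ⟨hc₃, ka, kb, kb', kd, ke⟩
    have htake : ((lowList n k).take (r + 1)).toFinset =
        insert (lowList n k)[r] ((lowList n k).take r).toFinset := by
      rw [List.take_succ_eq_append_getElem hr, List.toFinset_append, Finset.union_comm]
      simp
    -- If the operator already occurred among the first `r` rows, its cell holds zero and the set of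
    -- treated operators does not grow; otherwise the cell holds `c` and one summand is new.
    have hsum : ∀ f : (Fin n → Fin 4) → ℝ,
        ∑ P ∈ ((lowList n k).take (r + 1)).toFinset, c P * f P =
          ∑ P ∈ ((lowList n k).take r).toFinset, c P * f P +
            s₂.real 13 i (pauliCode (lowList n k)[r]) * f (lowList n k)[r] := by
      intro f
      rw [htake, ha _ hmem]
      by_cases h : (lowList n k)[r] ∈ ((lowList n k).take r).toFinset
      · rw [Finset.insert_eq_of_mem h, if_pos h]; ring
      · rw [Finset.sum_insert h, if_neg h]; ring
    refine ⟨hc₃, fun P hP => ?_, fun T => ?_, fun i' h a => ?_, ?_, fun i' h => ?_⟩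
    · rw [ka, ha P hP]
      by_cases h : P = (lowList n k)[r]
      · simp [h, htake]
      · simp only [htake, Finset.mem_insert, h, if_false, false_or]
    · rw [kb, hb, hsum]
    · rw [kb' i' (by omega) (by omega), hb' i' h]
    · rw [kd, hd, hsum]
    · rw [ke i' h, he i' h]
  · rintro s₂ hs₂ ⟨hc₂, ha, hb, hb', hd, he⟩
    rw [List.take_length, hlow] at *
    exact ⟨hc₂, hb, hb', hd, he⟩

/-- Every step `i` leaves the pairing of its evolved coefficients with the state estimates in cell
`(0, i)` of array `14`. Only the last of them is the answer, but treating all steps alike avoids a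
special case. -/
theorem layersProg_runs {w : CircuitDesc} {Q : Prog} {n M L X k : ℕ} {x : Fin M → StabLabel n}
    {y : Fin M → StabLabel n × ℝ} {s : Store} {c : (Fin n → Fin 4) → ℝ}
    {G : ℕ → (Fin n → Fin 4) → (Fin n → Fin 4) → ℝ} (hX : 1 ≤ X)
    (hnX : n ≤ X) (hMX : M ≤ X) (hkX : (4 * n + 1) ^ k ≤ X) (hin : HasInput L x y s)
    (hl : HasTable s (lowList n k)) (hc : ArgClean n s)
    (hQ : ∀ j < L, ∀ P, pauliWeight P ≤ k → Expands w Q X L j P (G j P))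
    (h13 : ∀ P ∈ lowSet n k, s.real 13 0 (pauliCode P) = c P)
    (h13' : ∀ i' > 0, ∀ a, s.real 13 i' a = 0) (h14 : ∀ i', s.real 14 0 i' = 0) :
    Runs w (layersProg Q) s (L * (1420 * X ^ 4) + 20) (fun s' => ∀ i < L, s'.real 14 0 i =
      ∑ T, evolvedCoeff k L G c (i + 1) T * stateEstimate x T) := by
  have h1 : 1 ≤ X ^ 4 := Nat.pow_pos hX
  refine Runs.mono (Runs.for (N := L) (c := 1400 * X ^ 4) (fun i s' => ArgClean n s' ∧
    (∀ P ∈ lowSet n k, s'.real 13 i (pauliCode P) = evolvedCoeff k L G c i P) ∧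
    (∀ i' > i, ∀ a, s'.real 13 i' a = 0) ∧
    (∀ i' < i, s'.real 14 0 i' = ∑ T, evolvedCoeff k L G c (i' + 1) T * stateEstimate x T) ∧
    ∀ i' ≥ i, s'.real 14 0 i' = 0) rfl ?_ ?_ ?_ ?_)
    (T' := L * (1420 * X ^ 4) + 20) ?_ ?_
  · intro s₂ hs₂
    simp [NExp.eval, hs₂.1 0 rfl, hin.nat_L]
  · intro i s₂ m h; simpa [Store.setNat, ArgClean] using h
  · exact ⟨hc, h13, h13', by simp, fun i' _ => h14 i'⟩
  · rintro i hi s₂ hs₂ hv ⟨hc₂, ha, hb, hd, he⟩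
    have o₂ : Off [14, 20, 21, 22, 25, 26, 31, 32] [11, 12, 13, 14, 15, 21] s s₂ := hs₂.off rfl rfl
    refine Runs.mono (layerProg_runs (w := w) (Q := Q) (i := i) (c := evolvedCoeff k L G c i)
      (G := G (L - (1 + i))) hX hnX hMX hkX
      (hin.of_off o₂ rfl rfl) (by
        unfold HasTable
        rw [o₂.1 12 (by decide), o₂.1 11 (by decide)]; exact hl) hv hc₂
      (hQ (L - (1 + i)) (by omega)) ha hb he) le_rfl ?_
    rintro s₃ _ ⟨hc₃, kb, kb', kd, ke⟩
    refine ⟨hc₃, fun P _ => kb P, kb', fun i' h => ?_, fun i' h => ?_⟩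
    · by_cases h' : i' = i
      · subst h'
        rw [kd]
        simp_rw [Finset.mul_sum, evolvedCoeff, Finset.sum_mul]
        rw [Finset.sum_comm]
        exact Finset.sum_congr rfl fun T _ => Finset.sum_congr rfl fun P _ => by ring
      · rw [ke i' h', hd i' (by omega)]
    · rw [ke i' (by omega), he i' (by omega)]
  · simp only [NExp.cost]
    nlinarith
  · rintro s₂ _ ⟨-, -, -, h, -⟩
    exact h

/-- The simulation algorithm. -/
def simProg (Q : Prog) : Prog :=
  weightProg.seq (tableProg.seq (learnProg.seq ((layersProg Q).seq
    (.setReal 0 (.lit 0) (.lit 0) (.get 14 (.lit 0) (.sub (.get 0 (.lit 0) (.lit 1)) (.lit 1)))))))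

theorem simProg_runs {w : CircuitDesc} {Q : Prog} {n M L X k : ℕ} {ε δ : ℝ}
    {x : Fin M → StabLabel n} {y : Fin M → StabLabel n × ℝ}
    {G : ℕ → (Fin n → Fin 4) → (Fin n → Fin 4) → ℝ} (hL : 1 ≤ L) (hX : 4 ≤ X)
    (hnX : n ≤ X) (hMX : M ≤ X) (hkX : k ≤ X) (hTX : (4 * n + 1) ^ k ≤ X)
    (hk : ∀ i < k, ε * ε * δ < 8 * (2 / 3) ^ i) (hk' : 8 * (2 / 3) ^ k ≤ ε * ε * δ)
    (hQ : ∀ j < L, ∀ P, pauliWeight P ≤ k → Expands w Q X L j P (G j P)) :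
    Runs w (simProg Q) (simInput L ε δ x y) (L * (4000 * X ^ 5)) (fun s' => s'.real 0 0 0 =
      ∑ T, evolvedCoeff k L G (observableEstimate y) L T * stateEstimate x T) := by
  have hX1 : 1 ≤ X := by omega
  set s := simInput L ε δ x y with hs
  have hin : HasInput L x y s := ⟨fun a ha => rfl, by
    funext i m; rcases i with _ | i <;> rfl⟩
  -- The table dominates with `X ^ 5`; the sweep costs `X ^ 4` per layer. As `L ≥ 1`, the costs that
  -- do not depend on `L` are absorbed into `L * X ^ 5`.
  have hT : 100 * X ^ 1 + (500 * X ^ 5 + (1000 * X ^ 3 + (L * (1420 * X ^ 4) + 20 + 20))) ≤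
      L * (4000 * X ^ 5) := by
    have h1 : X ^ 1 ≤ X ^ 5 := Nat.pow_le_pow_right hX1 (by norm_num)
    have h3 : X ^ 3 ≤ X ^ 5 := Nat.pow_le_pow_right hX1 (by norm_num)
    have h4 : X ^ 4 ≤ X ^ 5 := Nat.pow_le_pow_right hX1 (by norm_num)
    have h0 : 1 ≤ X ^ 5 := Nat.pow_pos hX1
    have h5 : L * (1420 * X ^ 4) ≤ L * (1420 * X ^ 5) :=
      Nat.mul_le_mul_left _ (Nat.mul_le_mul_left _ h4)
    have h6 : 1 * X ^ 5 ≤ L * X ^ 5 := Nat.mul_le_mul_right _ hL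
    have h7 : L * (4000 * X ^ 5) = L * (1420 * X ^ 5) + 2580 * (L * X ^ 5) := by ring
    omega
  refine Runs.le ((weightProg_runs (K := k) (ε := ε) (δ := δ) hX1 rfl rfl rfl hk hk' hkX).seq
    fun s₁ hs₁ h₁ => ?_) hT
  have o₁ : Off [10] [10] s s₁ := hs₁.off rfl rfl
  have hin₁ := hin.of_off o₁ rfl rfl
  refine (tableProg_runs hX hin₁.nat_n hnX h₁ hkX hTX
    (fun i => by rw [o₁.1 11 (by decide)]; rfl)).seq fun s₂ hs₂ h₂ => ?_
  have o₂ : Off [10, 11, 12, 13, 14, 15, 16, 17, 18] [10] s s₂ :=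
    (o₁.mono (by decide) (by decide)).trans (hs₂.off rfl rfl)
  refine (learnProg_runs hX1 hnX hMX (by rwa [length_lowList]) (hin.of_off o₂ rfl rfl) h₂
    (fun i _ a => by rw [o₂.2 13 (by decide)]; rfl)).seq fun s₃ hs₃ h₃ => ?_
  have o₃ : Off [10, 11, 12, 13, 14, 15, 16, 17, 18, 22, 31, 32] [10, 11, 12, 13] s s₃ :=
    (o₂.mono (by decide) (by decide)).trans (hs₃.off rfl rfl)
  refine (layersProg_runs (k := k) (G := G) (c := observableEstimate y) hX1 hnX hMX hTX
    (hin.of_off o₃ rfl rfl) ?_ ?_ hQ ?_ h₃.2 ?_).seq fun s₄ hs₄ h₄ => ?_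
  · unfold HasTable
    rw [hs₃.1 12 rfl, hs₃.1 11 rfl]; exact h₂
  · intro a b _ _
    rw [o₃.1 20 (by decide)]; rfl
  · intro P hP
    exact h₃.1 P (mem_lowList.2 (Finset.mem_filter.1 hP).2)
  · intro i
    rw [o₃.2 14 (by decide)]; rfl
  · refine (Runs.setReal ?_).le (by simp [NExp.cost, RExp.cost])
    have hL₄ : s₄.nat 0 0 1 = L := by rw [hs₄.1 0 rfl, o₃.1 0 (by decide)]; rfl
    simp only [Store.setReal, NExp.eval, RExp.eval, hL₄]
    -- Step `L - 1` is the last one; after it all `L` layers have been applied.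
    rw [h₄ (L - 1) (by omega), Nat.sub_add_cancel hL]
    simp

/-! ## Pauli algebra -/

section Tensor

variable {ι : Type} [Fintype ι]

theorem conjTranspose_tensorOp (A : ι → Matrix (Fin 2) (Fin 2) ℂ) :
    (tensorOp A).conjTranspose = tensorOp fun i => (A i).conjTranspose := by
  ext x y
  simp [tensorOp, Matrix.conjTranspose_apply]

theorem tensorOp_one : tensorOp (fun _ : ι => (1 : Matrix (Fin 2) (Fin 2) ℂ)) = 1 := by
  ext x y
  simp only [tensorOp, Matrix.of_apply, Matrix.one_apply]
  rw [Finset.prod_ite_zero]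
  simp [funext_iff]

variable [DecidableEq ι]

/-- Distributivity; this is how single-qubit identities become identities for tensor products. -/
theorem sum_pi_prod {α R : Type*} [Fintype α] [DecidableEq α] [CommSemiring R] (f : ι → α → R) :
    ∑ x : ι → α, ∏ i, f i (x i) = ∏ i, ∑ a, f i a := by
  rw [Finset.prod_univ_sum, Fintype.piFinset_univ]

theorem tensorOp_mul (A B : ι → Matrix (Fin 2) (Fin 2) ℂ) :
    tensorOp A * tensorOp B = tensorOp fun i => A i * B i := by
  ext x z
  simp only [tensorOp, Matrix.mul_apply, Matrix.of_apply, ← Finset.prod_mul_distrib]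
  exact sum_pi_prod fun i b => A i (x i) b * B i b (z i)

theorem trace_tensorOp (A : ι → Matrix (Fin 2) (Fin 2) ℂ) :
    (tensorOp A).trace = ∏ i, (A i).trace :=
  sum_pi_prod fun i b => A i b b

end Tensor

theorem pauliOne_conjTranspose (p : Fin 4) : (pauliOne p).conjTranspose = pauliOne p := by
  fin_cases p <;> ext i j <;> fin_cases i <;> fin_cases j <;>
    simp [pauliOne, Matrix.conjTranspose_apply]

theorem pauliOne_mul_self (p : Fin 4) : pauliOne p * pauliOne p = 1 := by
  fin_cases p <;> ext i j <;> fin_cases i <;> fin_cases j <;>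
    simp [pauliOne, Matrix.mul_apply, Fin.sum_univ_two]

theorem trace_pauliOne_mul (p q : Fin 4) :
    (pauliOne p * pauliOne q).trace = if p = q then 2 else 0 := by
  fin_cases p <;> fin_cases q <;>
    simp [pauliOne, Matrix.trace, Fin.sum_univ_two] <;> norm_num

/-- The sum of `p ⊗ p` over the Pauli matrices is twice the swap; completeness of the Pauli basis
and Parseval's identity both follow from its tensor power. -/
theorem sum_pauliOne (x y z w : Fin 2) :
    ∑ p, pauliOne p x y * pauliOne p z w = if x = w ∧ y = z then 2 else 0 := by
  fin_cases x <;> fin_cases y <;> fin_cases z <;> fin_cases w <;>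
    simp [pauliOne, Fin.sum_univ_four] <;> norm_num

section Pauli

variable {ι : Type} [Fintype ι]

theorem pauliOp_conjTranspose (P : ι → Fin 4) : (pauliOp P).conjTranspose = pauliOp P := by
  rw [pauliOp, conjTranspose_tensorOp]
  simp [pauliOne_conjTranspose]

variable [DecidableEq ι]

theorem pauliOp_mul_self (P : ι → Fin 4) : pauliOp P * pauliOp P = 1 := by
  rw [pauliOp, tensorOp_mul]
  simp [pauliOne_mul_self, tensorOp_one]

theorem trace_pauliOp_mul (P Q : ι → Fin 4) :
    (pauliOp P * pauliOp Q).trace = if P = Q then 2 ^ Fintype.card ι else 0 := by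
  rw [pauliOp, pauliOp, tensorOp_mul, trace_tensorOp]
  simp_rw [trace_pauliOne_mul]
  rw [Finset.prod_ite_zero]
  simp [funext_iff]

theorem sum_pauliOp (x y z w : Bits ι) :
    ∑ P : ι → Fin 4, pauliOp P x y * pauliOp P z w =
      if x = w ∧ y = z then 2 ^ Fintype.card ι else 0 := by
  simp only [pauliOp, tensorOp, Matrix.of_apply, ← Finset.prod_mul_distrib]
  rw [sum_pi_prod fun i p => pauliOne p (x i) (y i) * pauliOne p (z i) (w i)]
  simp_rw [sum_pauliOne]
  rw [Finset.prod_ite_zero]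
  simp [funext_iff, forall_and]

/-- Parseval's identity for the Pauli basis: contracting `A ⊗ B` with the swap gives `Tr[A B]`. -/
theorem sum_trace_mul_trace (A B : QOp ι) :
    ∑ P : ι → Fin 4, (pauliOp P * A).trace * (pauliOp P * B).trace =
      2 ^ Fintype.card ι * (A * B).trace := by
  have : ∀ P : ι → Fin 4, (pauliOp P * A).trace * (pauliOp P * B).trace =
      ∑ x, ∑ z, ∑ y, ∑ w, pauliOp P x y * pauliOp P z w * (A y x * B w z) := by
    intro P
    simp only [Matrix.trace, Matrix.diag, Matrix.mul_apply, Finset.sum_mul_sum]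
    refine Finset.sum_congr rfl fun x _ => Finset.sum_congr rfl fun y _ =>
      Finset.sum_congr rfl fun z _ => Finset.sum_congr rfl fun w _ => by ring
  simp_rw [this]
  rw [Finset.sum_comm]
  simp_rw [Finset.sum_comm (s := (Finset.univ : Finset (ι → Fin 4))), ← Finset.sum_mul, sum_pauliOp]
  simp only [Matrix.trace, Matrix.diag, Matrix.mul_apply, Finset.mul_sum]
  rw [Finset.sum_comm]
  refine Finset.sum_congr rfl fun y _ => ?_
  simp [ite_and, ite_mul]

/-- Pauli expansion. -/
theorem sum_trace_smul_pauliOp (A : QOp ι) :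
    ∑ P : ι → Fin 4, ((pauliOp P * A).trace / 2 ^ Fintype.card ι) • pauliOp P = A := by
  ext z w
  have : ∀ P : ι → Fin 4, ((pauliOp P * A).trace / 2 ^ Fintype.card ι) * pauliOp P z w =
      ∑ x, ∑ y, pauliOp P x y * pauliOp P z w * (A y x / 2 ^ Fintype.card ι) := by
    intro P
    simp only [Matrix.trace, Matrix.diag, Matrix.mul_apply, Finset.sum_mul, Finset.sum_div]
    refine Finset.sum_congr rfl fun x _ => Finset.sum_congr rfl fun y _ => by ring
  simp only [Matrix.sum_apply, Matrix.smul_apply, smul_eq_mul, this]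
  rw [Finset.sum_comm]
  simp_rw [Finset.sum_comm (s := (Finset.univ : Finset (ι → Fin 4))), ← Finset.sum_mul, sum_pauliOp]
  simp [ite_and, ite_mul]
  field_simp

/-- The entry `(P, Q)` of the Pauli transfer matrix of `A ↦ U† A U`. -/
noncomputable def ptmC (U : QOp ι) (P Q : ι → Fin 4) : ℂ :=
  (pauliOp Q * (U.conjTranspose * pauliOp P * U)).trace / 2 ^ Fintype.card ι

/-- The entries of the Pauli transfer matrix, which are real. -/
noncomputable def ptm (U : QOp ι) (P Q : ι → Fin 4) : ℝ := (ptmC U P Q).re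

theorem ofReal_trace_mul {A B : QOp ι} (hA : A.conjTranspose = A) (hB : B.conjTranspose = B) :
    (((A * B).trace.re : ℝ) : ℂ) = (A * B).trace := by
  rw [← Complex.conj_eq_iff_re, starRingEnd_apply, ← Matrix.trace_conjTranspose,
    Matrix.conjTranspose_mul, hA, hB, Matrix.trace_mul_comm]

theorem conj_pauliOp_conjTranspose (U : QOp ι) (P : ι → Fin 4) :
    (U.conjTranspose * pauliOp P * U).conjTranspose = U.conjTranspose * pauliOp P * U := by
  simp [Matrix.conjTranspose_mul, pauliOp_conjTranspose, Matrix.mul_assoc]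

theorem ofReal_ptm (U : QOp ι) (P Q : ι → Fin 4) : (ptm U P Q : ℂ) = ptmC U P Q := by
  rw [ptm, ptmC]
  have h := ofReal_trace_mul (pauliOp_conjTranspose Q) (conj_pauliOp_conjTranspose U P)
  have h2 : ((2 : ℂ) ^ Fintype.card ι) = (((2 : ℝ) ^ Fintype.card ι : ℝ) : ℂ) := by simp
  rw [← h, h2, ← Complex.ofReal_div, Complex.ofReal_re]

theorem sum_ptm_smul (U : QOp ι) (P : ι → Fin 4) :
    ∑ Q, (ptm U P Q : ℂ) • pauliOp Q = U.conjTranspose * pauliOp P * U := by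
  simp_rw [ofReal_ptm]
  exact sum_trace_smul_pauliOp _

/-- By orthogonality of the Pauli operators, any expansion, also one with repeated terms, determines
the matrix entries; this links the output of `Q` to the transfer matrix. -/
theorem ptm_eq_of_sum {κ : Type*} [Fintype κ] {U : QOp ι} {P : ι → Fin 4} {T : κ → ι → Fin 4}
    {c : κ → ℝ} (h : U.conjTranspose * pauliOp P * U = ∑ k, (c k : ℂ) • pauliOp (T k))
    (Q : ι → Fin 4) : ptm U P Q = ∑ k, if T k = Q then c k else 0 := by
  have : (ptm U P Q : ℂ) = ((∑ k, if T k = Q then c k else 0 : ℝ) : ℂ) := by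
    rw [ofReal_ptm, ptmC, h, Matrix.mul_sum, Matrix.trace_sum, Finset.sum_div]
    push_cast
    refine Finset.sum_congr rfl fun k _ => ?_
    rw [Matrix.mul_smul, Matrix.trace_smul, trace_pauliOp_mul]
    by_cases hk : T k = Q
    · simp [hk]
    · simp [hk, Ne.symm hk]
  exact_mod_cast this

/-- The rows are orthonormal because `P ↦ U† P U` preserves the trace form; Parseval turns this into
a statement on coefficients. -/
theorem sum_ptm_mul_ptm {U : QOp ι} (hU : U * U.conjTranspose = 1)
    (P P' : ι → Fin 4) : ∑ Q, ptm U P Q * ptm U P' Q = if P = P' then 1 else 0 := by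
  have : ((∑ Q, ptm U P Q * ptm U P' Q : ℝ) : ℂ) = ((if P = P' then 1 else 0 : ℝ) : ℂ) := by
    push_cast
    simp_rw [ofReal_ptm, ptmC, div_mul_div_comm]
    rw [← Finset.sum_div, sum_trace_mul_trace]
    have : (U.conjTranspose * pauliOp P * U * (U.conjTranspose * pauliOp P' * U)).trace =
        (pauliOp P * pauliOp P').trace := by
      rw [show U.conjTranspose * pauliOp P * U * (U.conjTranspose * pauliOp P' * U) =
        U.conjTranspose * (pauliOp P * (U * U.conjTranspose) * pauliOp P' * U) by
          simp only [Matrix.mul_assoc], hU, Matrix.mul_one, Matrix.trace_mul_comm,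
          Matrix.mul_assoc, Matrix.mul_assoc, hU, Matrix.mul_one]
    rw [this, trace_pauliOp_mul]
    by_cases h : P = P'
    · simp [h]
    · simp [h]
  exact_mod_cast this

end Pauli

/-! ## Twirling over single-qubit Clifford gates -/

theorem ofReal_sqrt_two_inv_mul_self :
    ((Real.sqrt 2 : ℝ) : ℂ)⁻¹ * ((Real.sqrt 2 : ℝ) : ℂ)⁻¹ = 2⁻¹ := by
  rw [← mul_inv, ← Complex.ofReal_mul, Real.mul_self_sqrt (by norm_num)]
  norm_num

/-- Conjugation of a Pauli matrix by the Hadamard gate, without the sign. -/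
def hadamardPerm : Fin 4 → Fin 4 := ![0, 3, 2, 1]

/-- The sign in the conjugation of a Pauli matrix by the Hadamard gate. -/
def hadamardSign : Fin 4 → ℂ := ![1, 1, -1, 1]

/-- The cyclic permutation `X ↦ Y ↦ Z ↦ X`. -/
def pauliNext : Fin 4 → Fin 4 := ![0, 2, 3, 1]

theorem hadamard_conj (p : Fin 4) :
    hadamardGate.conjTranspose * pauliOne p * hadamardGate =
      hadamardSign p • pauliOne (hadamardPerm p) := by
  have h : ∀ A : Matrix (Fin 2) (Fin 2) ℂ, hadamardGate.conjTranspose * A * hadamardGate =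
      (2⁻¹ : ℂ) • (!![1, 1; 1, -1] * A * !![1, 1; 1, -1]) := by
    intro A
    rw [hadamardGate, Matrix.conjTranspose_smul, Matrix.smul_mul, Matrix.smul_mul, Matrix.mul_smul,
      smul_smul]
    congr 1
    · simp [ofReal_sqrt_two_inv_mul_self]
    · congr 2
      ext i j; fin_cases i <;> fin_cases j <;> simp [Matrix.conjTranspose_apply]
  rw [h]
  fin_cases p <;> ext i j <;> fin_cases i <;> fin_cases j <;>
    simp [pauliOne, hadamardSign, hadamardPerm] <;> ring

theorem phase_hadamard_conj (p : Fin 4) :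
    (phaseGate * hadamardGate).conjTranspose * pauliOne p * (phaseGate * hadamardGate) =
      pauliOne (pauliNext p) := by
  have h : phaseGate.conjTranspose * pauliOne p * phaseGate =
      (![1, -1, 1, 1] : Fin 4 → ℂ) p • pauliOne ((![0, 2, 1, 3] : Fin 4 → Fin 4) p) := by
    fin_cases p <;> ext i j <;> fin_cases i <;> fin_cases j <;>
      simp [pauliOne, phaseGate, Matrix.mul_apply, Fin.sum_univ_two, Matrix.conjTranspose_apply]
  rw [Matrix.conjTranspose_mul, show hadamardGate.conjTranspose * phaseGate.conjTranspose *
    pauliOne p * (phaseGate * hadamardGate) = hadamardGate.conjTranspose *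
      (phaseGate.conjTranspose * pauliOne p * phaseGate) * hadamardGate by
        simp only [Matrix.mul_assoc], h, Matrix.mul_smul, Matrix.smul_mul, hadamard_conj, smul_smul]
  fin_cases p <;> simp [hadamardSign, hadamardPerm, pauliNext]

/-- `1` or `-1` according as two Pauli matrices commute or anticommute. -/
def pauliSign (p q : Fin 4) : ℂ := if p = 0 ∨ q = 0 ∨ p = q then 1 else -1

theorem pauliOne_conj (p q : Fin 4) :
    pauliOne p * pauliOne q * pauliOne p = pauliSign p q • pauliOne q := by
  fin_cases p <;> fin_cases q <;> ext i j <;> fin_cases i <;> fin_cases j <;>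
    simp [pauliOne, Matrix.mul_apply, Fin.sum_univ_two, pauliSign]

/-- Orthogonality of the characters by which the Pauli group acts on Pauli matrices under
conjugation. -/
theorem sum_pauliSign (q q' : Fin 4) :
    ∑ p, pauliSign p q * pauliSign p q' = if q = q' then 4 else 0 := by
  fin_cases q <;> fin_cases q' <;> simp [pauliSign, Fin.sum_univ_four] <;> norm_num

/-- A Pauli matrix conjugated by a Clifford gate. -/
noncomputable def cliffordConj (v : CliffordLabel) (q : Fin 4) : Matrix (Fin 2) (Fin 2) ℂ :=
  (cliffordOne v).conjTranspose * pauliOne q * cliffordOne v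

theorem phase_hadamard_pow_conj (r : ℕ) (q : Fin 4) :
    ((phaseGate * hadamardGate) ^ r).conjTranspose * pauliOne q * (phaseGate * hadamardGate) ^ r =
      pauliOne (pauliNext^[r] q) := by
  induction r generalizing q with
  | zero => simp
  | succ r ih =>
    rw [pow_succ', Matrix.conjTranspose_mul, Function.iterate_succ_apply, ← ih,
      ← phase_hadamard_conj]
    simp only [Matrix.mul_assoc]

theorem cliffordConj_eq (p : Fin 4) (r : Fin 3) (h : Fin 2) (q : Fin 4) :
    cliffordConj (p, r, h) q = pauliSign p q • ((hadamardGate ^ (h : ℕ)).conjTranspose *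
      pauliOne (pauliNext^[(r : ℕ)] q) * hadamardGate ^ (h : ℕ)) := by
  rw [← phase_hadamard_pow_conj, cliffordConj, cliffordOne]
  simp only [Matrix.conjTranspose_mul, pauliOne_conjTranspose]
  have := pauliOne_conj p q
  rw [show (hadamardGate ^ (h : ℕ)).conjTranspose *
      (((phaseGate * hadamardGate) ^ (r : ℕ)).conjTranspose * pauliOne p) * pauliOne q *
      (pauliOne p * (phaseGate * hadamardGate) ^ (r : ℕ) * hadamardGate ^ (h : ℕ)) =
      (hadamardGate ^ (h : ℕ)).conjTranspose *
      (((phaseGate * hadamardGate) ^ (r : ℕ)).conjTranspose *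
        (pauliOne p * pauliOne q * pauliOne p) * (phaseGate * hadamardGate) ^ (r : ℕ)) *
          hadamardGate ^ (h : ℕ) by simp only [Matrix.mul_assoc], this]
  simp only [Matrix.mul_smul, Matrix.smul_mul]

/-- The Pauli factor of the gate enters only through two signs. Summing over it leaves `4` on the
diagonal and kills the terms with `q ≠ q'`. -/
theorem sum_cliffordConj (q q' : Fin 4) (a b a' b' : Fin 2) :
    ∑ v, cliffordConj v q a b * cliffordConj v q' a' b' =
      if q = q' then 4 * ∑ r : Fin 3, ∑ h : Fin 2, ((hadamardGate ^ (h : ℕ)).conjTranspose *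
        pauliOne (pauliNext^[(r : ℕ)] q) * hadamardGate ^ (h : ℕ)) a b *
          ((hadamardGate ^ (h : ℕ)).conjTranspose *
            pauliOne (pauliNext^[(r : ℕ)] q) * hadamardGate ^ (h : ℕ)) a' b' else 0 := by
  rw [Fintype.sum_prod_type]
  simp_rw [Fintype.sum_prod_type, cliffordConj_eq, Matrix.smul_apply, smul_eq_mul,
    mul_mul_mul_comm, ← Finset.mul_sum, ← Finset.sum_mul, sum_pauliSign]
  split_ifs with h
  · rw [h]
  · rw [zero_mul]

theorem sum_cliffordConj_of_ne {q q' : Fin 4} (h : q ≠ q') (a b a' b' : Fin 2) :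
    ∑ v, cliffordConj v q a b * cliffordConj v q' a' b' = 0 := by
  rw [sum_cliffordConj, if_neg h]

/-- The powers of the 3-cycle carry any non-identity letter to `X`, `Y` and `Z` once each, so the
sum over `r` is the same for all such letters. -/
theorem sum_cliffordConj_self {q q' : Fin 4} (h : q = 0 ↔ q' = 0) (a b a' b' : Fin 2) :
    ∑ v, cliffordConj v q a b * cliffordConj v q a' b' =
      ∑ v, cliffordConj v q' a b * cliffordConj v q' a' b' := by
  have key : ∀ (f : Fin 4 → ℂ) (q : Fin 4), q ≠ 0 →
      ∑ r : Fin 3, f (pauliNext^[(r : ℕ)] q) = f 1 + f 2 + f 3 := by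
    intro f q hq
    fin_cases q
    · exact absurd rfl hq
    all_goals simp [Fin.sum_univ_three, pauliNext]; try ring
  by_cases h0 : q = 0
  · rw [h0, h.1 h0]
  · rw [sum_cliffordConj, sum_cliffordConj, if_pos rfl, if_pos rfl]
    congr 1
    set f : Fin 4 → ℂ := fun t => ∑ h : Fin 2, ((hadamardGate ^ (h : ℕ)).conjTranspose *
        pauliOne t * hadamardGate ^ (h : ℕ)) a b *
          ((hadamardGate ^ (h : ℕ)).conjTranspose *
            pauliOne t * hadamardGate ^ (h : ℕ)) a' b'
    exact (key f q h0).trans (key f q' fun h' => h0 (h.2 h')).symm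

section

variable {ι : Type} [Fintype ι] [DecidableEq ι]

theorem ptmC_tensorOp_mul (V : ι → CliffordLabel) (U : QOp ι) (P Q : ι → Fin 4) :
    ptmC (tensorOp (fun i => cliffordOne (V i)) * U) P Q =
      ∑ x, ∑ y, tensorOp (fun i => cliffordConj (V i) (P i)) x y *
        ((U * pauliOp Q * U.conjTranspose) y x / 2 ^ Fintype.card ι) := by
  have h : (tensorOp (fun i => cliffordOne (V i))).conjTranspose * pauliOp P *
      tensorOp (fun i => cliffordOne (V i)) = tensorOp fun i => cliffordConj (V i) (P i) := by
    rw [conjTranspose_tensorOp, pauliOp, tensorOp_mul, tensorOp_mul]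
    rfl
  rw [ptmC, Matrix.conjTranspose_mul, show pauliOp Q * (U.conjTranspose *
    (tensorOp (fun i => cliffordOne (V i))).conjTranspose * pauliOp P *
      (tensorOp (fun i => cliffordOne (V i)) * U)) = (pauliOp Q * U.conjTranspose) *
      (((tensorOp (fun i => cliffordOne (V i))).conjTranspose * pauliOp P *
      tensorOp (fun i => cliffordOne (V i))) * U) by simp only [Matrix.mul_assoc], h,
      Matrix.trace_mul_comm, Matrix.mul_assoc, ← Matrix.mul_assoc U]
  simp [Matrix.trace, Matrix.mul_apply (M := tensorOp _), Finset.sum_div, mul_div_assoc]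

/-- The Clifford sum factorizes over the qubits, so that a single qubit on which the twirl vanishes
makes everything vanish. -/
theorem sum_ptmC_mul (U : QOp ι) (P Q P' Q' : ι → Fin 4) :
    ∑ V : ι → CliffordLabel, ptmC (tensorOp (fun i => cliffordOne (V i)) * U) P Q *
      ptmC (tensorOp (fun i => cliffordOne (V i)) * U) P' Q' =
      ∑ x, ∑ x', ∑ y, ∑ y', (∏ i, ∑ v, cliffordConj v (P i) (x i) (y i) *
        cliffordConj v (P' i) (x' i) (y' i)) *
        (((U * pauliOp Q * U.conjTranspose) y x / 2 ^ Fintype.card ι) *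
          ((U * pauliOp Q' * U.conjTranspose) y' x' / 2 ^ Fintype.card ι)) := by
  simp_rw [ptmC_tensorOp_mul, Finset.sum_mul_sum]
  rw [Finset.sum_comm]
  refine Finset.sum_congr rfl fun x _ => ?_
  rw [Finset.sum_comm]
  refine Finset.sum_congr rfl fun x' _ => ?_
  rw [Finset.sum_comm]
  refine Finset.sum_congr rfl fun y _ => ?_
  rw [Finset.sum_comm]
  refine Finset.sum_congr rfl fun y' _ => ?_
  simp_rw [mul_mul_mul_comm, ← Finset.sum_mul]
  congr 1
  simp only [tensorOp, Matrix.of_apply, ← Finset.prod_mul_distrib]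
  exact sum_pi_prod fun i v => cliffordConj v (P i) (x i) (y i) *
        cliffordConj v (P' i) (x' i) (y' i)

theorem sum_ptmC_mul_of_ne {P P' : ι → Fin 4} (h : P ≠ P') (U : QOp ι) (Q Q' : ι → Fin 4) :
    ∑ V : ι → CliffordLabel, ptmC (tensorOp (fun i => cliffordOne (V i)) * U) P Q *
      ptmC (tensorOp (fun i => cliffordOne (V i)) * U) P' Q' = 0 := by
  obtain ⟨i, hi⟩ := Function.ne_iff.1 h
  rw [sum_ptmC_mul]
  refine Finset.sum_eq_zero fun x _ => Finset.sum_eq_zero fun x' _ =>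
    Finset.sum_eq_zero fun y _ => Finset.sum_eq_zero fun y' _ => ?_
  rw [Finset.prod_eq_zero (Finset.mem_univ i) (sum_cliffordConj_of_ne hi _ _ _ _), zero_mul]

theorem sum_ptmC_mul_congr {P P' : ι → Fin 4} (h : ∀ i, P i = 0 ↔ P' i = 0) (U : QOp ι)
    (Q Q' : ι → Fin 4) :
    ∑ V : ι → CliffordLabel, ptmC (tensorOp (fun i => cliffordOne (V i)) * U) P Q *
      ptmC (tensorOp (fun i => cliffordOne (V i)) * U) P Q' =
    ∑ V : ι → CliffordLabel, ptmC (tensorOp (fun i => cliffordOne (V i)) * U) P' Q *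
      ptmC (tensorOp (fun i => cliffordOne (V i)) * U) P' Q' := by
  rw [sum_ptmC_mul, sum_ptmC_mul]
  simp_rw [fun i => sum_cliffordConj_self (h i)]

end

/-! ### Second moments of Pauli transfer matrices -/

section

variable {ι : Type} [Fintype ι] [DecidableEq ι]

/-- A closed subset of a product of unit discs. Its use is that every continuous function of the
unitary is bounded, hence integrable for every finite measure. -/
instance : CompactSpace (QUnitary ι) := by
  refine isCompact_iff_compactSpace.1 (IsCompact.of_isClosed_subset
    (s := {M : QOp ι | ∀ x y, M x y ∈ Metric.closedBall (0 : ℂ) 1}) ?_ ?_ ?_)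
  · have : {M : QOp ι | ∀ x y, M x y ∈ Metric.closedBall (0 : ℂ) 1} =
        Set.pi Set.univ fun _ => Set.pi Set.univ fun _ => Metric.closedBall (0 : ℂ) 1 := by
      ext M; exact ⟨fun h x _ y _ => h x y, fun h x y => h x trivial y trivial⟩
    rw [this]
    exact isCompact_univ_pi fun _ => isCompact_univ_pi fun _ => isCompact_closedBall _ _
  · have : (Matrix.unitaryGroup (Bits ι) ℂ : Set (QOp ι)) = {M | M * star M = 1} := by
      ext M; exact Matrix.mem_unitaryGroup_iff
    rw [this]
    refine isClosed_eq ?_ continuous_const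
    exact continuous_id.matrix_mul continuous_id.matrix_conjTranspose
  · intro M hM x y
    simpa using entry_norm_bound_of_unitary hM x y

theorem integrable_of_continuous {E : Type*} [NormedAddCommGroup E]
    [SecondCountableTopology E] {μ : Measure (QUnitary ι)} [IsFiniteMeasure μ] {f : QUnitary ι → E}
    (hf : Continuous f) : Integrable f μ := by
  obtain ⟨C, hC⟩ := (isCompact_range hf).isBounded.exists_norm_le
  exact Integrable.of_bound hf.aestronglyMeasurable C
    (ae_of_all _ fun U => hC _ ⟨U, rfl⟩)

theorem continuous_coe_apply (x y : Bits ι) : Continuous fun U : QUnitary ι => (U : QOp ι) x y :=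
  continuous_subtype_val.matrix_elem x y

theorem continuous_ptmC (A : QOp ι) (P Q : ι → Fin 4) :
    Continuous fun U : QUnitary ι => ptmC (A * (U : QOp ι)) P Q := by
  unfold ptmC
  refine Continuous.div_const (Continuous.matrix_trace ?_) _
  have h : Continuous fun U : QUnitary ι => A * (U : QOp ι) :=
    continuous_const.matrix_mul continuous_subtype_val
  exact continuous_const.matrix_mul ((h.matrix_conjTranspose.matrix_mul continuous_const).matrix_mul
    h)

theorem continuous_ptm (P Q : ι → Fin 4) :
    Continuous fun U : QUnitary ι => ptm (U : QOp ι) P Q := by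
  have := Complex.continuous_re.comp (continuous_ptmC (1 : QOp ι) P Q)
  simpa [Function.comp_def, ptm] using this

theorem continuous_doubled (A : QOp ι) (r c) :
    Continuous fun U : QUnitary ι => doubled (A * (U : QOp ι)) r c := by
  have h : ∀ x y, Continuous fun U : QUnitary ι => (A * (U : QOp ι)) x y := fun x y =>
    (continuous_const.matrix_mul continuous_subtype_val).matrix_elem x y
  unfold doubled
  simp only [Matrix.kroneckerMap_apply, Matrix.map_apply]
  exact ((h _ _).mul (h _ _)).mul ((h _ _).star.mul (h _ _).star)

theorem sum_sum_comm {α R : Type*} [Fintype α] [AddCommMonoid R] (F : α → α → α → α → R) :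
    ∑ b, ∑ a, ∑ y, ∑ x, F b a y x = ∑ y, ∑ x, ∑ b, ∑ a, F b a y x := by
  have := Finset.sum_comm (s := Finset.univ) (t := Finset.univ)
    (f := fun (p : α × α) (q : α × α) => F p.1 p.2 q.1 q.2)
  simpa only [Fintype.sum_prod_type] using this

theorem ptmC_eq_sum (U : QOp ι) (P Q : ι → Fin 4) :
    ptmC U P Q = ∑ y, ∑ x, ∑ b, ∑ a, (pauliOp Q b a * pauliOp P x y / 2 ^ Fintype.card ι) *
      (U y b * star (U x a)) := by
  simp only [ptmC, Matrix.trace, Matrix.diag, Matrix.mul_apply, Matrix.conjTranspose_apply,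
    Finset.mul_sum, Finset.sum_mul, Finset.sum_div]
  rw [sum_sum_comm]
  refine Finset.sum_congr rfl fun y _ => Finset.sum_congr rfl fun x _ =>
    Finset.sum_congr rfl fun b _ => Finset.sum_congr rfl fun a _ => ?_
  ring

/-- A product of two transfer matrix entries is linear in `U ⊗ U ⊗ U^* ⊗ U^*`; this is exactly the
information that local scrambling gives. -/
theorem ptmC_mul_ptmC_eq_sum (U : QOp ι) (P Q P' Q' : ι → Fin 4) :
    ptmC U P Q * ptmC U P' Q' = ∑ r : (Bits ι × Bits ι) × (Bits ι × Bits ι),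
      ∑ c : (Bits ι × Bits ι) × (Bits ι × Bits ι),
      (pauliOp Q c.1.1 c.2.1 * pauliOp P r.2.1 r.1.1 / 2 ^ Fintype.card ι *
        (pauliOp Q' c.1.2 c.2.2 * pauliOp P' r.2.2 r.1.2 / 2 ^ Fintype.card ι)) *
        doubled U r c := by
  simp_rw [ptmC_eq_sum, Finset.sum_mul_sum, Fintype.sum_prod_type]
  refine Finset.sum_congr rfl fun y _ => Finset.sum_congr rfl fun y' _ =>
    Finset.sum_congr rfl fun x _ => Finset.sum_congr rfl fun x' _ =>
    Finset.sum_congr rfl fun b _ => Finset.sum_congr rfl fun b' _ =>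
    Finset.sum_congr rfl fun a _ => Finset.sum_congr rfl fun a' _ => ?_
  simp only [doubled, Matrix.kroneckerMap_apply, Matrix.map_apply]
  ring

theorem integral_ptmC_mul {μ : Measure (QUnitary ι)} [IsProbabilityMeasure μ]
    (hμ : IsLocallyScrambling μ) (P Q P' Q' : ι → Fin 4) :
    ∫ U, ptmC (U : QOp ι) P Q * ptmC (U : QOp ι) P' Q' ∂μ =
      ∫ U, (Fintype.card (ι → CliffordLabel) : ℂ)⁻¹ * ∑ V : ι → CliffordLabel,
        ptmC (tensorOp (fun i => cliffordOne (V i)) * (U : QOp ι)) P Q *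
        ptmC (tensorOp (fun i => cliffordOne (V i)) * (U : QOp ι)) P' Q' ∂μ := by
  simp_rw [ptmC_mul_ptmC_eq_sum]
  have hc : ∀ r c, Continuous fun U : QUnitary ι => doubled (U : QOp ι) r c := fun r c => by
    simpa using continuous_doubled (1 : QOp ι) r c
  rw [integral_finsetSum]
  swap
  · intro r _
    exact integrable_finsetSum _ fun c _ =>
      (integrable_of_continuous (hc r c)).const_mul _
  have hswap : ∀ (U : QUnitary ι) (κ : (Bits ι × Bits ι) × (Bits ι × Bits ι) →
      (Bits ι × Bits ι) × (Bits ι × Bits ι) → ℂ),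
      (Fintype.card (ι → CliffordLabel) : ℂ)⁻¹ * ∑ V : ι → CliffordLabel, ∑ r, ∑ c,
        κ r c * doubled (tensorOp (fun i => cliffordOne (V i)) * (U : QOp ι)) r c =
      ∑ r, ∑ c, κ r c * ((Fintype.card (ι → CliffordLabel) : ℂ)⁻¹ * ∑ V : ι → CliffordLabel,
        doubled (tensorOp (fun i => cliffordOne (V i)) * (U : QOp ι)) r c) := by
    intro U κ
    rw [Finset.sum_comm, Finset.mul_sum]
    refine Finset.sum_congr rfl fun r _ => ?_
    rw [Finset.sum_comm, Finset.mul_sum]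
    refine Finset.sum_congr rfl fun c _ => ?_
    rw [← Finset.mul_sum]
    ring
  simp_rw [hswap]
  have hi : ∀ r c, Integrable (fun U : QUnitary ι => (Fintype.card (ι → CliffordLabel) : ℂ)⁻¹ *
      ∑ V : ι → CliffordLabel,
        doubled (tensorOp (fun i => cliffordOne (V i)) * (U : QOp ι)) r c) μ := fun r c =>
    (integrable_finsetSum _ fun V _ =>
      integrable_of_continuous (continuous_doubled _ r c)).const_mul _
  rw [integral_finsetSum]
  swap
  · intro r _
    exact integrable_finsetSum _ fun c _ => (hi r c).const_mul _
  refine Finset.sum_congr rfl fun r _ => ?_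
  rw [integral_finsetSum _ fun c _ => (integrable_of_continuous (hc r c)).const_mul _,
    integral_finsetSum _ fun c _ => (hi r c).const_mul _]
  refine Finset.sum_congr rfl fun c _ => ?_
  rw [integral_const_mul, integral_const_mul, hμ r c]

theorem ofReal_integral_ptm_mul (μ : Measure (QUnitary ι)) (P Q P' Q' : ι → Fin 4) :
    ((∫ U, ptm (U : QOp ι) P Q * ptm (U : QOp ι) P' Q' ∂μ : ℝ) : ℂ) =
      ∫ U, ptmC (U : QOp ι) P Q * ptmC (U : QOp ι) P' Q' ∂μ := by
  rw [← integral_complex_ofReal]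
  simp [ofReal_ptm]

theorem integral_ptm_mul_of_ne {μ : Measure (QUnitary ι)} [IsProbabilityMeasure μ]
    (hμ : IsLocallyScrambling μ) {P P' : ι → Fin 4} (h : P ≠ P') (Q Q' : ι → Fin 4) :
    ∫ U, ptm (U : QOp ι) P Q * ptm (U : QOp ι) P' Q' ∂μ = 0 := by
  have := ofReal_integral_ptm_mul μ P Q P' Q'
  rw [integral_ptmC_mul hμ] at this
  simp_rw [sum_ptmC_mul_of_ne h] at this
  simpa using this

theorem integral_ptm_mul_congr {μ : Measure (QUnitary ι)} [IsProbabilityMeasure μ]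
    (hμ : IsLocallyScrambling μ) {P P' : ι → Fin 4} (h : ∀ i, P i = 0 ↔ P' i = 0)
    (Q Q' : ι → Fin 4) :
    ∫ U, ptm (U : QOp ι) P Q * ptm (U : QOp ι) P Q' ∂μ =
      ∫ U, ptm (U : QOp ι) P' Q * ptm (U : QOp ι) P' Q' ∂μ := by
  have h1 := ofReal_integral_ptm_mul μ P Q P Q'
  have h2 := ofReal_integral_ptm_mul μ P' Q P' Q'
  rw [integral_ptmC_mul hμ] at h1 h2
  simp_rw [sum_ptmC_mul_congr h] at h1
  exact_mod_cast h1.trans h2.symm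

end

/-! ## Gates that act on a subset of the qubits -/

section

variable {n : ℕ} (A : Finset (Fin n))

theorem pauliOp_eq_submatrix (P : Fin n → Fin 4) :
    pauliOp P = (pauliOp (fun i : {i // i ∈ A} => P i) ⊗ₖ
      pauliOp (fun i : {i // i ∉ A} => P i)).submatrix
        (Equiv.piEquivPiSubtypeProd (fun i => i ∈ A) fun _ => Fin 2)
        (Equiv.piEquivPiSubtypeProd (fun i => i ∈ A) fun _ => Fin 2) := by
  ext x y
  simp only [pauliOp, tensorOp, Matrix.of_apply, Matrix.submatrix_apply, Matrix.kroneckerMap_apply]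
  convert (Fintype.prod_subtype_mul_prod_subtype (fun i => i ∈ A)
    fun i => pauliOne (P i) (x i) (y i)).symm <;> rfl

theorem trace_submatrix_equiv {α β R : Type*} [Fintype α] [Fintype β] [AddCommMonoid R]
    (M : Matrix α α R) (e : β ≃ α) : (M.submatrix e e).trace = M.trace := by
  simp only [Matrix.trace, Matrix.diag, Matrix.submatrix_apply]
  exact e.sum_comp fun i => M i i

/-- The trace factorizes. On the qubits outside `A` the gate is trivial, and orthogonality of the
Pauli operators forces the letters there to agree. -/
theorem ptm_actOn (V : QUnitary {i // i ∈ A}) (P Q : Fin n → Fin 4) :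
    ptm (actOn A V : QOp (Fin n)) P Q = if ∀ i ∉ A, P i = Q i then
      ptm (V : QOp {i // i ∈ A}) (fun i => P i) (fun i => Q i) else 0 := by
  have hcard : Fintype.card {i // i ∈ A} + Fintype.card {i // i ∉ A} = Fintype.card (Fin n) := by
    rw [Fintype.card_subtype_compl, Fintype.card_coe]
    have := Finset.card_le_univ A
    omega
  have h : ptmC (actOn A V : QOp (Fin n)) P Q = ptmC (V : QOp {i // i ∈ A}) (fun i => P i)
      (fun i => Q i) * ((pauliOp (fun i : {i // i ∉ A} => Q i) *
        pauliOp (fun i : {i // i ∉ A} => P i)).trace / 2 ^ Fintype.card {i // i ∉ A}) := by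
    rw [ptmC, ptmC, actOn, pauliOp_eq_submatrix A P, pauliOp_eq_submatrix A Q]
    simp only
    rw [Matrix.conjTranspose_submatrix, Matrix.submatrix_mul_equiv, Matrix.submatrix_mul_equiv,
      Matrix.submatrix_mul_equiv, trace_submatrix_equiv, Matrix.conjTranspose_kronecker,
      ← Matrix.mul_kronecker_mul, ← Matrix.mul_kronecker_mul, ← Matrix.mul_kronecker_mul,
      Matrix.trace_kronecker, div_mul_div_comm, ← pow_add, hcard]
    simp
  have h' : (ptm (actOn A V : QOp (Fin n)) P Q : ℂ) = ((if ∀ i ∉ A, P i = Q i then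
      ptm (V : QOp {i // i ∈ A}) (fun i => P i) (fun i => Q i) else 0 : ℝ) : ℂ) := by
    rw [ofReal_ptm, h, trace_pauliOp_mul]
    by_cases hPQ : ∀ i ∉ A, P i = Q i
    · rw [if_pos hPQ, if_pos (by funext i; exact (hPQ i i.2).symm), ofReal_ptm]
      simp
    · rw [if_neg hPQ, if_neg]
      · simp
      · intro h; exact hPQ fun i hi => (congrFun h ⟨i, hi⟩).symm
  exact_mod_cast h'

theorem continuous_actOn : Continuous (actOn A) := by
  refine Continuous.subtype_mk ?_ _
  refine continuous_matrix fun x y => ?_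
  simp only [Matrix.submatrix_apply, Matrix.kroneckerMap_apply]
  exact (continuous_coe_apply _ _).mul continuous_const

end

/-! ## Purity bounds -/

/-- The principal `2 × 2` minors of a positive semidefinite matrix give `|τ x y|² ≤ τ x x * τ y y`;
summing this over `x` and `y` gives the claim. -/
theorem re_trace_mul_self_le {κ : Type*} [Fintype κ] [DecidableEq κ] {τ : Matrix κ κ ℂ}
    (h : τ.PosSemidef) : (τ * τ).trace.re ≤ τ.trace.re ^ 2 := by
  have key : ∀ x y, (τ x y * τ y x).re ≤ (τ x x).re * (τ y y).re := by
    intro x y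
    have h2 := (h.submatrix ![x, y]).det_nonneg
    rw [Matrix.det_fin_two] at h2
    have h3 := (Complex.le_def.1 h2).1
    have hx : ∀ z, (τ z z).im = 0 := fun z => by
      have := congrArg Complex.im (h.1.apply z z)
      simp at this
      linarith
    simp [Complex.mul_re, hx] at h3 ⊢
    linarith
  simp only [Matrix.trace, Matrix.diag, Matrix.mul_apply, Complex.re_sum, sq, Finset.sum_mul_sum]
  exact Finset.sum_le_sum fun x _ => Finset.sum_le_sum fun y _ => key x y

section

variable {n : ℕ}

/-- The reduced state on the qubits in `A`. -/
def reducedState (A : Finset (Fin n)) (ρ : QOp (Fin n)) : QOp {i // i ∈ A} :=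
  Matrix.of fun x y => ∑ z : Bits {i // i ∉ A},
    ρ ((Equiv.piEquivPiSubtypeProd (fun i => i ∈ A) fun _ => Fin 2).symm (x, z))
      ((Equiv.piEquivPiSubtypeProd (fun i => i ∈ A) fun _ => Fin 2).symm (y, z))

theorem reducedState_posSemidef (A : Finset (Fin n)) {ρ : QOp (Fin n)} (h : ρ.PosSemidef) :
    (reducedState A ρ).PosSemidef := by
  have : reducedState A ρ = ∑ z : Bits {i // i ∉ A}, ρ.submatrix
      (fun x => (Equiv.piEquivPiSubtypeProd (fun i => i ∈ A) fun _ => Fin 2).symm (x, z))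
      (fun x => (Equiv.piEquivPiSubtypeProd (fun i => i ∈ A) fun _ => Fin 2).symm (x, z)) := by
    ext x y
    simp [reducedState, Matrix.sum_apply]
  rw [this]
  exact Matrix.posSemidef_sum _ fun z _ => h.submatrix _

theorem trace_pauliOp_mul_reducedState (A : Finset (Fin n)) (ρ : QOp (Fin n)) {P : Fin n → Fin 4}
    (hP : ∀ i ∉ A, P i = 0) :
    (pauliOp (fun i : {i // i ∈ A} => P i) * reducedState A ρ).trace = (pauliOp P * ρ).trace := by
  have h1 : pauliOp (fun i : {i // i ∉ A} => P i) = 1 := by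
    rw [show (fun i : {i // i ∉ A} => P i) = fun _ => 0 from funext fun i => hP i i.2]
    exact tensorOp_one
  have h2 : ρ = (ρ.submatrix (Equiv.piEquivPiSubtypeProd (fun i => i ∈ A) fun _ => Fin 2).symm
      (Equiv.piEquivPiSubtypeProd (fun i => i ∈ A) fun _ => Fin 2).symm).submatrix
      (Equiv.piEquivPiSubtypeProd (fun i => i ∈ A) fun _ => Fin 2)
      (Equiv.piEquivPiSubtypeProd (fun i => i ∈ A) fun _ => Fin 2) := by
    ext x y
    rw [Matrix.submatrix_apply, Matrix.submatrix_apply, Equiv.symm_apply_apply,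
      Equiv.symm_apply_apply]
  conv_rhs => rw [pauliOp_eq_submatrix A P, h1, h2, Matrix.submatrix_mul_equiv,
    trace_submatrix_equiv]
  simp only [Matrix.trace, Matrix.diag, Matrix.mul_apply, Fintype.sum_prod_type,
    Matrix.kroneckerMap_apply, Matrix.submatrix_apply, Matrix.one_apply, reducedState,
    Matrix.of_apply]
  refine Finset.sum_congr rfl fun x _ => ?_
  rw [Finset.sum_comm]
  refine Finset.sum_congr rfl fun y _ => ?_
  simp [Finset.mul_sum]

/-- Operators supported on `A` see only the reduced state on `A`. Adding the other Pauli operators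
on `A` and applying Parseval gives `2 ^ |A|` times its purity, which is at most one. -/
theorem sum_trace_sq_le {ρ : QOp (Fin n)} (h : IsState ρ) (A : Finset (Fin n)) :
    ∑ P ∈ Finset.univ.filter (fun P : Fin n → Fin 4 => ∀ i, P i ≠ 0 ↔ i ∈ A),
      (pauliOp P * ρ).trace.re ^ 2 ≤ 2 ^ A.card := by
  set τ := reducedState A ρ
  have hτ := reducedState_posSemidef A h.1
  have hτ1 : τ.trace = 1 := by
    have := trace_pauliOp_mul_reducedState A ρ (P := fun _ => 0) fun _ _ => rfl
    have e : ∀ (ι : Type) [Fintype ι] [DecidableEq ι], pauliOp (fun _ : ι => (0 : Fin 4)) = 1 :=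
      fun ι _ _ => tensorOp_one
    rw [e, e, Matrix.one_mul, Matrix.one_mul, h.2] at this
    exact this
  calc _ ≤ ∑ P : {i // i ∈ A} → Fin 4, (pauliOp P * τ).trace.re ^ 2 := by
        have hinj : Set.InjOn (fun (P : Fin n → Fin 4) (i : {i // i ∈ A}) => P i)
            (Finset.univ.filter (fun P : Fin n → Fin 4 => ∀ i, P i ≠ 0 ↔ i ∈ A)) := by
          intro P hP P' hP' hPP
          simp only [Finset.coe_filter, Finset.mem_univ, true_and, Set.mem_ofPred_eq] at hP hP'
          funext i
          by_cases hi : i ∈ A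
          · exact congrFun hPP ⟨i, hi⟩
          · rw [not_not.1 (mt (hP i).1 hi), not_not.1 (mt (hP' i).1 hi)]
        refine le_trans (le_of_eq ?_) (Finset.sum_le_sum_of_subset_of_nonneg
          (Finset.subset_univ (Finset.image (fun (P : Fin n → Fin 4) (i : {i // i ∈ A}) => P i)
            (Finset.univ.filter (fun P : Fin n → Fin 4 => ∀ i, P i ≠ 0 ↔ i ∈ A))))
          fun _ _ _ => sq_nonneg _)
        rw [Finset.sum_image hinj]
        refine Finset.sum_congr rfl fun P hP => ?_
        rw [trace_pauliOp_mul_reducedState A ρ]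
        intro i hi
        exact not_not.1 (mt ((Finset.mem_filter.1 hP).2 i).1 hi)
    _ = (∑ P : {i // i ∈ A} → Fin 4, (pauliOp P * τ).trace * (pauliOp P * τ).trace).re := by
        rw [Complex.re_sum]
        refine Finset.sum_congr rfl fun P _ => ?_
        rw [← ofReal_trace_mul (pauliOp_conjTranspose P) hτ.1.eq, ← Complex.ofReal_mul,
          Complex.ofReal_re, sq]
        simp
    _ = 2 ^ A.card * (τ * τ).trace.re := by
        rw [sum_trace_mul_trace, Fintype.card_coe,
          show (2 : ℂ) ^ A.card = ((2 ^ A.card : ℝ) : ℂ) by simp, Complex.re_ofReal_mul]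
    _ ≤ 2 ^ A.card := by
        have := re_trace_mul_self_le hτ
        rw [hτ1] at this
        simp at this
        have h2 : (0 : ℝ) < 2 ^ A.card := by positivity
        nlinarith

theorem card_same_support (A : Finset (Fin n)) :
    (Finset.univ.filter (fun P : Fin n → Fin 4 => ∀ i, P i ≠ 0 ↔ i ∈ A)).card = 3 ^ A.card := by
  have : Finset.univ.filter (fun P : Fin n → Fin 4 => ∀ i, P i ≠ 0 ↔ i ∈ A) =
      Fintype.piFinset fun i => if i ∈ A then Finset.univ.filter (· ≠ (0 : Fin 4)) else {0} := by
    ext P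
    simp only [Finset.mem_filter, Finset.mem_univ, true_and, Fintype.mem_piFinset]
    refine forall_congr' fun i => ?_
    by_cases hi : i ∈ A <;> simp [hi]
  rw [this, Fintype.card_piFinset]
  have : ∀ i, (if i ∈ A then Finset.univ.filter (· ≠ (0 : Fin 4)) else {0}).card =
      if i ∈ A then 3 else 1 := by
    intro i; split_ifs <;> rfl
  simp_rw [this]
  rw [Finset.prod_ite]
  simp

end

/-! ## Heisenberg evolution with and without truncation -/

/-- The expectation values of the Pauli operators after `j` layers with transfer matrices `R`
(for `α = true`), and the part of them that is lost when in every Heisenberg step the operators of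
weight above `k` are discarded (for `α = false`). -/
noncomputable def pathValue {n : ℕ} (k : ℕ) (R : ℕ → (Fin n → Fin 4) → (Fin n → Fin 4) → ℝ)
    (r : (Fin n → Fin 4) → ℝ) : ℕ → Bool → (Fin n → Fin 4) → ℝ
  | 0, α, P => if α then r P else 0
  | j + 1, α, P => ∑ Q, R j P Q * pathValue k R r j (α || decide (k < pauliWeight P)) Q

theorem pathValue_congr {n k j : ℕ} {R R' : ℕ → (Fin n → Fin 4) → (Fin n → Fin 4) → ℝ}
    {r : (Fin n → Fin 4) → ℝ} (h : ∀ i < j, R i = R' i) (α : Bool) (P : Fin n → Fin 4) :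
    pathValue k R r j α P = pathValue k R' r j α P := by
  induction j generalizing α P with
  | zero => rfl
  | succ j ih =>
    simp only [pathValue, h j (by omega)]
    exact Finset.sum_congr rfl fun Q _ => by rw [ih fun i hi => h i (by omega)]

section

variable {n L : ℕ}

/-- Layer number `j` of a circuit. -/
noncomputable def layerAt (U : Fin L → QUnitary (Fin n)) (j : ℕ) : QUnitary (Fin n) :=
  if h : j < L then U ⟨j, h⟩ else 1

/-- The Pauli transfer matrices of the layers of a circuit. -/
noncomputable def layerPtm (U : Fin L → QUnitary (Fin n)) (j : ℕ) (P Q : Fin n → Fin 4) : ℝ :=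
  ptm (layerAt U j : QOp (Fin n)) P Q

instance : SecondCountableTopology (QUnitary (Fin n)) := by
  have : SecondCountableTopology (QOp (Fin n)) :=
    inferInstanceAs (SecondCountableTopology (Bits (Fin n) → Bits (Fin n) → ℂ))
  exact TopologicalSpace.Subtype.secondCountableTopology _

theorem continuous_layerPtm (j : ℕ) (P Q : Fin n → Fin 4) :
    Continuous fun U : Fin L → QUnitary (Fin n) => layerPtm U j P Q := by
  unfold layerPtm layerAt
  by_cases h : j < L
  · simp only [h, dif_pos]
    exact (continuous_ptm P Q).comp (continuous_apply (⟨j, h⟩ : Fin L))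
  · simp only [h, dif_neg, not_false_eq_true]
    exact continuous_const

theorem continuous_pathValue (k : ℕ) (r : (Fin n → Fin 4) → ℝ) (j : ℕ) (α : Bool)
    (P : Fin n → Fin 4) :
    Continuous fun U : Fin L → QUnitary (Fin n) => pathValue k (layerPtm U) r j α P := by
  induction j generalizing α P with
  | zero => exact continuous_const
  | succ j ih =>
    exact continuous_finsetSum _ fun Q _ => (continuous_layerPtm j P Q).mul (ih _ Q)

theorem integrable_of_continuous_pi {D : Fin L → Measure (QUnitary (Fin n))}
    [∀ j, IsProbabilityMeasure (D j)] {f : (Fin L → QUnitary (Fin n)) → ℝ} (hf : Continuous f) :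
    Integrable f (Measure.pi D) := by
  obtain ⟨C, hC⟩ := (isCompact_range hf).isBounded.exists_norm_le
  exact Integrable.of_bound hf.aestronglyMeasurable C (ae_of_all _ fun U => hC _ ⟨U, rfl⟩)

/-- The function `g` depends only on the layers before `j`, which are independent of layer `j`. -/
theorem integral_layer_mul {D : Fin L → Measure (QUnitary (Fin n))}
    [∀ j, IsProbabilityMeasure (D j)] {j : Fin L} {f : QUnitary (Fin n) → ℝ}
    {g : (Fin L → QUnitary (Fin n)) → ℝ} (hf : Continuous f) (hg : Continuous g)
    (hloc : ∀ U U' : Fin L → QUnitary (Fin n), (∀ i < j, U i = U' i) → g U = g U') :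
    ∫ U, f (U j) * g U ∂(Measure.pi D) = (∫ V, f V ∂(D j)) * ∫ U, g U ∂(Measure.pi D) := by
  have hind := ProbabilityTheory.iIndepFun_pi (μ := D) (X := fun _ U => U) fun _ => aemeasurable_id
  have hdis : Disjoint ({j} : Finset (Fin L)) (Finset.univ.filter (· < j)) := by simp
  have h2 := hind.indepFun_finset _ _ hdis fun i => measurable_pi_apply i
  have hφ : Measurable fun a : ({j} : Finset (Fin L)) → QUnitary (Fin n) =>
      f (a ⟨j, Finset.mem_singleton_self j⟩) := hf.measurable.comp (measurable_pi_apply _)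
  -- The function `g` is expressed through the earlier coordinates alone by filling the others with
  -- the identity; `hloc` says that this does not change its value.
  have hψ : Measurable fun a : (Finset.univ.filter (· < j) : Finset (Fin L)) → QUnitary (Fin n) =>
      g fun i => if h : i ∈ Finset.univ.filter (· < j) then a ⟨i, h⟩ else 1 := by
    refine hg.measurable.comp (measurable_pi_lambda _ fun i => ?_)
    by_cases h : i ∈ Finset.univ.filter (· < j)
    · simp only [h, dif_pos]; exact measurable_pi_apply _
    · simp only [h, dif_neg, not_false_eq_true]; exact measurable_const
  have h3 := h2.comp hφ hψ
  have hg' : ∀ U : Fin L → QUnitary (Fin n),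
      g (fun i => if i ∈ Finset.univ.filter (· < j) then U i else 1) = g U := fun U =>
    hloc _ _ fun i hi => by simp [hi]
  have h4 := h3.integral_fun_mul_eq_mul_integral
    (hφ.comp (measurable_pi_lambda _ fun i => measurable_pi_apply _)).aestronglyMeasurable
    (hψ.comp (measurable_pi_lambda _ fun i => measurable_pi_apply _)).aestronglyMeasurable
  simp only [Function.comp_def, dite_eq_ite, hg'] at h4
  rw [h4, integral_comp_eval hf.aestronglyMeasurable]

theorem layerPtm_of_lt (U : Fin L → QUnitary (Fin n)) {j : ℕ} (hj : j < L) :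
    layerPtm U j = ptm (U ⟨j, hj⟩ : QOp (Fin n)) := by
  funext P Q
  simp [layerPtm, layerAt, hj]

variable {D : Fin L → Measure (QUnitary (Fin n))} [∀ j, IsProbabilityMeasure (D j)]

theorem integral_pathValue_succ (k : ℕ) (r : (Fin n → Fin 4) → ℝ) {j : ℕ} (hj : j < L)
    (α β : Bool) (P P' : Fin n → Fin 4) :
    ∫ U, pathValue k (layerPtm U) r (j + 1) α P * pathValue k (layerPtm U) r (j + 1) β P'
      ∂(Measure.pi D) =
    ∑ Q, ∑ Q', (∫ V, ptm (V : QOp (Fin n)) P Q * ptm (V : QOp (Fin n)) P' Q' ∂(D ⟨j, hj⟩)) *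
      ∫ U, pathValue k (layerPtm U) r j (α || decide (k < pauliWeight P)) Q *
        pathValue k (layerPtm U) r j (β || decide (k < pauliWeight P')) Q' ∂(Measure.pi D) := by
  have hc : ∀ (Q Q' : Fin n → Fin 4), Continuous fun U : Fin L → QUnitary (Fin n) =>
      pathValue k (layerPtm U) r j (α || decide (k < pauliWeight P)) Q *
        pathValue k (layerPtm U) r j (β || decide (k < pauliWeight P')) Q' := fun Q Q' =>
    (continuous_pathValue _ _ _ _ _).mul (continuous_pathValue _ _ _ _ _)
  have hc' : ∀ (Q Q' : Fin n → Fin 4), Continuous fun V : QUnitary (Fin n) =>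
      ptm (V : QOp (Fin n)) P Q * ptm (V : QOp (Fin n)) P' Q' := fun Q Q' =>
    (continuous_ptm _ _).mul (continuous_ptm _ _)
  simp_rw [pathValue, Finset.sum_mul_sum, layerPtm_of_lt _ hj, mul_mul_mul_comm]
  have hi : ∀ (Q Q' : Fin n → Fin 4), Integrable (fun U : Fin L → QUnitary (Fin n) =>
      ptm (U ⟨j, hj⟩ : QOp (Fin n)) P Q * ptm (U ⟨j, hj⟩ : QOp (Fin n)) P' Q' *
      (pathValue k (layerPtm U) r j (α || decide (k < pauliWeight P)) Q *
        pathValue k (layerPtm U) r j (β || decide (k < pauliWeight P')) Q')) (Measure.pi D) :=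
    fun Q Q' => integrable_of_continuous_pi
      (((hc' Q Q').comp (continuous_apply (⟨j, hj⟩ : Fin L))).mul (hc Q Q'))
  rw [integral_finsetSum _ fun Q _ => integrable_finsetSum _ fun Q' _ => hi Q Q']
  refine Finset.sum_congr rfl fun Q _ => ?_
  rw [integral_finsetSum _ fun Q' _ => hi Q Q']
  refine Finset.sum_congr rfl fun Q' _ => ?_
  refine integral_layer_mul (hc' Q Q') (hc Q Q') fun U U' h => ?_
  have : ∀ i < j, layerPtm U i = layerPtm U' i := fun i hi => by
    rw [layerPtm_of_lt U (hi.trans hj), layerPtm_of_lt U' (hi.trans hj), h ⟨i, _⟩ hi]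
  rw [pathValue_congr this, pathValue_congr this]

/-! ### Twirled layers and vanishing correlations -/

/-- A distribution over unitaries on all qubits is twirled by Pauli gates and by Clifford gates as
far as Pauli-diagonal second moments are concerned. -/
structure IsDiagonallyTwirled (μ : Measure (QUnitary (Fin n))) : Prop where
  ne : ∀ {P P' : Fin n → Fin 4}, P ≠ P' → ∀ Q,
    ∫ V, ptm (V : QOp (Fin n)) P Q * ptm (V : QOp (Fin n)) P' Q ∂μ = 0
  congr : ∀ {P P' : Fin n → Fin 4}, (∀ i, P i = 0 ↔ P' i = 0) →
    ∀ w : (Fin n → Fin 4) → ℝ, (∀ Q Q', (∀ i, Q i = 0 ↔ Q' i = 0) → w Q = w Q') →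
      ∑ Q, (∫ V, ptm (V : QOp (Fin n)) P Q * ptm (V : QOp (Fin n)) P Q ∂μ) * w Q =
        ∑ Q, (∫ V, ptm (V : QOp (Fin n)) P' Q * ptm (V : QOp (Fin n)) P' Q ∂μ) * w Q

/-- If `P ≠ P'` differ inside `A`, the twirl on `A` kills the moment; if they differ outside `A`,
they cannot both agree there with `Q`. The invariance under change of letters holds only after
summation against a weight `w` that depends on supports: `Q` inherits the outer letters of `P`, so
an entrywise statement would be false. -/
theorem IsLocallyScrambling.isDiagonallyTwirled_map {A : Finset (Fin n)}
    {ν : Measure (QUnitary {i // i ∈ A})} [IsProbabilityMeasure ν] (hν : IsLocallyScrambling ν) :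
    IsDiagonallyTwirled (ν.map (actOn A)) := by
  have hmap : ∀ P Q P' Q' : Fin n → Fin 4,
      ∫ V, ptm (V : QOp (Fin n)) P Q * ptm (V : QOp (Fin n)) P' Q' ∂(ν.map (actOn A)) =
      ∫ V, ptm (actOn A V : QOp (Fin n)) P Q * ptm (actOn A V : QOp (Fin n)) P' Q' ∂ν :=
    fun P Q P' Q' => integral_map (continuous_actOn A).measurable.aemeasurable
      ((continuous_ptm _ _).mul (continuous_ptm _ _)).aestronglyMeasurable
  refine ⟨fun {P P'} hP Q => ?_, fun {P P'} hP w hw => ?_⟩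
  · rw [hmap]
    simp_rw [ptm_actOn]
    by_cases h : (∀ i ∉ A, P i = Q i) ∧ ∀ i ∉ A, P' i = Q i
    · simp_rw [if_pos h.1, if_pos h.2]
      refine integral_ptm_mul_of_ne hν (fun he => hP ?_) _ _
      funext i
      by_cases hi : i ∈ A
      · exact congrFun he ⟨i, hi⟩
      · rw [h.1 i hi, h.2 i hi]
    · rw [not_and_or] at h
      rcases h with h | h <;> simp [h]
  · simp_rw [hmap, ptm_actOn]
    have key : ∀ P : Fin n → Fin 4, ∑ Q, (∫ V : QUnitary {i // i ∈ A},
        (if ∀ i ∉ A, P i = Q i then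
          ptm (V : QOp {i // i ∈ A}) (fun i => P i) (fun i => Q i) else 0) *
        (if ∀ i ∉ A, P i = Q i then
          ptm (V : QOp {i // i ∈ A}) (fun i => P i) (fun i => Q i) else 0) ∂ν) * w Q =
        ∑ Q ∈ Finset.univ.filter (fun Q : Fin n → Fin 4 => ∀ i ∉ A, P i = Q i),
          (∫ V : QUnitary {i // i ∈ A}, ptm (V : QOp {i // i ∈ A}) (fun i => P i) (fun i => Q i) *
            ptm (V : QOp {i // i ∈ A}) (fun i => P i) (fun i => Q i) ∂ν) * w Q := by
      intro P
      rw [Finset.sum_filter]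
      refine Finset.sum_congr rfl fun Q _ => ?_
      split_ifs <;> simp
    rw [key, key]
    -- The bijection keeps the letters inside `A` and exchanges the outer letters of `P` for those
    -- of `P'`; this preserves the support of `Q`, hence `w`.
    refine Finset.sum_bij' (fun Q _ i => if i ∈ A then Q i else P' i)
      (fun Q _ i => if i ∈ A then Q i else P i) ?_ ?_ ?_ ?_ ?_
    · intro Q _; simp +contextual
    · intro Q _; simp +contextual
    · intro Q hQ
      funext i
      by_cases hi : i ∈ A
      · simp [hi]
      · simp [hi, (Finset.mem_filter.1 hQ).2 i hi]
    · intro Q hQ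
      funext i
      by_cases hi : i ∈ A
      · simp [hi]
      · simp [hi, (Finset.mem_filter.1 hQ).2 i hi]
    · intro Q hQ
      rw [integral_ptm_mul_congr hν fun i => hP i]
      congr 1
      · simp
      · refine hw _ _ fun i => ?_
        by_cases hi : i ∈ A
        · simp [hi]
        · simp [hi, ← (Finset.mem_filter.1 hQ).2 i hi, hP i]

/-- The properties of a sequence of layers that the analysis of the truncation uses. -/
structure IsTwirledSequence (D : Fin L → Measure (QUnitary (Fin n))) : Prop where
  first : ∀ j : Fin L, (j : ℕ) = 0 → IsLocallyScrambling (D j)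
  later : ∀ j : Fin L, (j : ℕ) ≠ 0 → IsDiagonallyTwirled (D j)

/-- In the first layer all qubits are twirled, so every pair `Q, Q'` contributes zero. In later
layers the pairs with `Q ≠ Q'` vanish by induction and those with `Q = Q'` by the twirl. The flags
`α, β` are arbitrary because the loss flag of a path depends on its own operators only. -/
theorem integral_pathValue_of_ne (hD : IsTwirledSequence D) (k : ℕ) (r : (Fin n → Fin 4) → ℝ)
    {j : ℕ} (hj : j < L) (α β : Bool) {P P' : Fin n → Fin 4} (hP : P ≠ P') :
    ∫ U, pathValue k (layerPtm U) r (j + 1) α P * pathValue k (layerPtm U) r (j + 1) β P'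
      ∂(Measure.pi D) = 0 := by
  induction j generalizing α β P P' with
  | zero =>
    rw [integral_pathValue_succ k r hj]
    refine Finset.sum_eq_zero fun Q _ => Finset.sum_eq_zero fun Q' _ => ?_
    rw [integral_ptm_mul_of_ne (hD.first _ rfl) hP, zero_mul]
  | succ j ih =>
    rw [integral_pathValue_succ k r hj]
    refine Finset.sum_eq_zero fun Q _ => Finset.sum_eq_zero fun Q' _ => ?_
    by_cases h : Q = Q'
    · rw [← h, (hD.later _ (by simp)).ne hP, zero_mul]
    · rw [ih (by omega) _ _ h, mul_zero]

theorem integral_pathValue_self_succ (hD : IsTwirledSequence D) (k : ℕ) (r : (Fin n → Fin 4) → ℝ)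
    {j : ℕ} (hj : j + 1 < L) (α : Bool) (P : Fin n → Fin 4) :
    ∫ U, pathValue k (layerPtm U) r (j + 2) α P * pathValue k (layerPtm U) r (j + 2) α P
      ∂(Measure.pi D) =
    ∑ Q, (∫ V, ptm (V : QOp (Fin n)) P Q * ptm (V : QOp (Fin n)) P Q ∂(D ⟨j + 1, hj⟩)) *
      ∫ U, pathValue k (layerPtm U) r (j + 1) (α || decide (k < pauliWeight P)) Q *
        pathValue k (layerPtm U) r (j + 1) (α || decide (k < pauliWeight P)) Q
          ∂(Measure.pi D) := by
  rw [integral_pathValue_succ k r hj]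
  refine Finset.sum_congr rfl fun Q _ => ?_
  rw [Finset.sum_eq_single Q]
  · intro Q' _ h
    rw [integral_pathValue_of_ne hD k r (by omega) _ _ h.symm, mul_zero]
  · simp

/-- By induction the mean squares after fewer layers depend only on the support, so they are an
admissible weight `w` for the next twirl. -/
theorem integral_pathValue_congr (hD : IsTwirledSequence D) (k : ℕ) (r : (Fin n → Fin 4) → ℝ)
    {j : ℕ} (hj : j < L) {P P' : Fin n → Fin 4} (hP : ∀ i, P i = 0 ↔ P' i = 0) :
    ∫ U, pathValue k (layerPtm U) r (j + 1) true P * pathValue k (layerPtm U) r (j + 1) true P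
      ∂(Measure.pi D) =
    ∫ U, pathValue k (layerPtm U) r (j + 1) true P' * pathValue k (layerPtm U) r (j + 1) true P'
      ∂(Measure.pi D) := by
  induction j generalizing P P' with
  | zero =>
    rw [integral_pathValue_succ k r hj, integral_pathValue_succ k r hj]
    refine Finset.sum_congr rfl fun Q _ => Finset.sum_congr rfl fun Q' _ => ?_
    rw [integral_ptm_mul_congr (hD.first _ rfl) hP]
    rfl
  | succ j ih =>
    rw [integral_pathValue_self_succ hD k r hj, integral_pathValue_self_succ hD k r hj]
    exact (hD.later _ (by simp)).congr hP _ fun Q Q' h => ih (by omega) h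

end

/-! ### Expectation values as path sums and the mean squared loss -/

section

variable {n L : ℕ}

/-- The state after `j` layers. -/
noncomputable def stateAt (ρ : QOp (Fin n)) (U : Fin L → QUnitary (Fin n)) : ℕ → QOp (Fin n)
  | 0 => ρ
  | j + 1 => (layerAt U j : QOp (Fin n)) * stateAt ρ U j *
      (layerAt U j : QOp (Fin n)).conjTranspose

/-- The expectation value of a Pauli operator. -/
noncomputable def pauliValue (ρ : QOp (Fin n)) (P : Fin n → Fin 4) : ℝ :=
  (pauliOp P * ρ).trace.re

theorem QUnitary.conjTranspose_mul_self {ι : Type} [Fintype ι] [DecidableEq ι] (V : QUnitary ι) :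
    (V : QOp ι).conjTranspose * (V : QOp ι) = 1 :=
  Matrix.mem_unitaryGroup_iff'.1 V.2

theorem QUnitary.mul_conjTranspose_self {ι : Type} [Fintype ι] [DecidableEq ι] (V : QUnitary ι) :
    (V : QOp ι) * (V : QOp ι).conjTranspose = 1 :=
  Matrix.mem_unitaryGroup_iff.1 V.2

theorem isState_stateAt {ρ : QOp (Fin n)} (h : IsState ρ) (U : Fin L → QUnitary (Fin n)) (j : ℕ) :
    IsState (stateAt ρ U j) := by
  induction j with
  | zero => exact h
  | succ j ih =>
    refine ⟨ih.1.mul_mul_conjTranspose_same _, ?_⟩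
    rw [stateAt, Matrix.trace_mul_comm, ← Matrix.mul_assoc, QUnitary.conjTranspose_mul_self,
      Matrix.one_mul, ih.2]

theorem pauliValue_conj (V : QOp (Fin n)) (σ : QOp (Fin n)) (P : Fin n → Fin 4) :
    pauliValue (V * σ * V.conjTranspose) P = ∑ Q, ptm V P Q * pauliValue σ Q := by
  have h : pauliOp P * (V * σ * V.conjTranspose) = pauliOp P * V * σ * V.conjTranspose := by
    simp only [Matrix.mul_assoc]
  rw [pauliValue, h, Matrix.trace_mul_comm, ← Matrix.mul_assoc, ← Matrix.mul_assoc,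
    ← sum_ptm_smul, Matrix.sum_mul, Matrix.trace_sum, Complex.re_sum]
  refine Finset.sum_congr rfl fun Q _ => ?_
  rw [Matrix.smul_mul, Matrix.trace_smul, smul_eq_mul, Complex.re_ofReal_mul, pauliValue]

theorem pathValue_true (k : ℕ) (ρ : QOp (Fin n)) (U : Fin L → QUnitary (Fin n)) (j : ℕ)
    (P : Fin n → Fin 4) :
    pathValue k (layerPtm U) (pauliValue ρ) j true P = pauliValue (stateAt ρ U j) P := by
  induction j generalizing P with
  | zero => simp [pathValue, stateAt]
  | succ j ih =>
    rw [stateAt, pauliValue_conj, pathValue]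
    simp only [Bool.true_or, ih]
    rfl

theorem pauliValue_sq_le {ρ : QOp (Fin n)} (h : IsState ρ) (A : Finset (Fin n)) :
    ∑ P ∈ Finset.univ.filter (fun P : Fin n → Fin 4 => ∀ i, P i ≠ 0 ↔ i ∈ A),
      pauliValue ρ P * pauliValue ρ P ≤ 2 ^ A.card := by
  simpa only [sq, pauliValue] using sum_trace_sq_le h A

variable {D : Fin L → Measure (QUnitary (Fin n))} [∀ j, IsProbabilityMeasure (D j)]

/-- All `3 ^ |A|` operators with the support `A` of `P` have the same mean square, and for every
circuit the sum of their squares is at most `2 ^ |A|`. -/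
theorem integral_pathValue_true_le (hD : IsTwirledSequence D) (k : ℕ) {ρ : QOp (Fin n)}
    (hρ : IsState ρ) {j : ℕ} (hj : j < L) (P : Fin n → Fin 4) :
    ∫ U, pathValue k (layerPtm U) (pauliValue ρ) (j + 1) true P *
      pathValue k (layerPtm U) (pauliValue ρ) (j + 1) true P ∂(Measure.pi D) ≤
        (2 / 3) ^ pauliWeight P := by
  set A := Finset.univ.filter fun i => P i ≠ 0 with hA
  set I := ∫ U, pathValue k (layerPtm U) (pauliValue ρ) (j + 1) true P *
      pathValue k (layerPtm U) (pauliValue ρ) (j + 1) true P ∂(Measure.pi D) with hI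
  have h1 : ∑ P' ∈ Finset.univ.filter (fun P : Fin n → Fin 4 => ∀ i, P i ≠ 0 ↔ i ∈ A),
      ∫ U, pathValue k (layerPtm U) (pauliValue ρ) (j + 1) true P' *
      pathValue k (layerPtm U) (pauliValue ρ) (j + 1) true P' ∂(Measure.pi D) =
        3 ^ A.card * I := by
    rw [Finset.sum_congr rfl (g := fun _ => I), Finset.sum_const, card_same_support]
    · simp
    · intro P' hP'
      refine integral_pathValue_congr hD k _ hj fun i => ?_
      have := (Finset.mem_filter.1 hP').2 i
      simp only [hA, Finset.mem_filter, Finset.mem_univ, true_and] at this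
      exact not_iff_not.1 this
  have hi : ∀ P', Integrable (fun U => pathValue k (layerPtm U) (pauliValue ρ) (j + 1) true P' *
      pathValue k (layerPtm U) (pauliValue ρ) (j + 1) true P') (Measure.pi D) := fun P' =>
    integrable_of_continuous_pi
      ((continuous_pathValue _ _ _ _ _).mul (continuous_pathValue _ _ _ _ _))
  rw [← integral_finsetSum _ fun P' _ => hi P'] at h1
  have h2 : ∫ U, ∑ P' ∈ Finset.univ.filter (fun P : Fin n → Fin 4 => ∀ i, P i ≠ 0 ↔ i ∈ A),
      pathValue k (layerPtm U) (pauliValue ρ) (j + 1) true P' *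
      pathValue k (layerPtm U) (pauliValue ρ) (j + 1) true P' ∂(Measure.pi D) ≤
      ∫ _, 2 ^ A.card ∂(Measure.pi D) := by
    refine integral_mono (integrable_of_continuous_pi (continuous_finsetSum _ fun P' _ =>
      (continuous_pathValue _ _ _ _ _).mul (continuous_pathValue _ _ _ _ _)))
      (integrable_const _) fun U => ?_
    simp only [pathValue_true]
    exact pauliValue_sq_le (isState_stateAt hρ U _) A
  rw [h1] at h2
  simp only [integral_const, probReal_univ, one_smul] at h2
  rw [div_pow, le_div_iff₀ (by positivity), mul_comm]
  exact h2

/-- Above weight `k` the loss is the whole expectation value, of mean square at most `(2/3)^(k+1)`.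
Otherwise it is a combination of uncorrelated losses after one layer less, whose squared
coefficients add up to one; the bound does not deteriorate. -/
theorem integral_pathValue_false_le (hD : IsTwirledSequence D) (k : ℕ) {ρ : QOp (Fin n)}
    (hρ : IsState ρ) {j : ℕ} (hj : j < L) (P : Fin n → Fin 4) :
    ∫ U, pathValue k (layerPtm U) (pauliValue ρ) (j + 1) false P *
      pathValue k (layerPtm U) (pauliValue ρ) (j + 1) false P ∂(Measure.pi D) ≤
        (2 / 3) ^ (k + 1) := by
  induction j generalizing P with
  | zero =>
    by_cases hP : k < pauliWeight P
    · have : ∀ U : Fin L → QUnitary (Fin n), pathValue k (layerPtm U) (pauliValue ρ) 1 false P =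
          pathValue k (layerPtm U) (pauliValue ρ) 1 true P := fun U => by simp [pathValue, hP]
      simp only [zero_add, this]
      exact (integral_pathValue_true_le hD k hρ hj P).trans
        (pow_le_pow_of_le_one (by norm_num) (by norm_num) hP)
    · simp only [pathValue, hP]
      simp
      positivity
  | succ j ih =>
    by_cases hP : k < pauliWeight P
    · have : ∀ U : Fin L → QUnitary (Fin n),
          pathValue k (layerPtm U) (pauliValue ρ) (j + 1 + 1) false P =
          pathValue k (layerPtm U) (pauliValue ρ) (j + 1 + 1) true P := fun U => by
        rw [pathValue, pathValue]; simp [hP]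
      simp only [this]
      exact (integral_pathValue_true_le hD k hρ hj P).trans
        (pow_le_pow_of_le_one (by norm_num) (by norm_num) hP)
    · rw [integral_pathValue_self_succ hD k _ hj]
      simp only [hP, decide_false, Bool.or_false]
      have hc : ∀ Q : Fin n → Fin 4, Continuous fun V : QUnitary (Fin n) =>
          ptm (V : QOp (Fin n)) P Q * ptm (V : QOp (Fin n)) P Q := fun Q =>
        (continuous_ptm P Q).mul (continuous_ptm P Q)
      calc _ ≤ ∑ Q, (∫ V, ptm (V : QOp (Fin n)) P Q * ptm (V : QOp (Fin n)) P Q ∂(D ⟨j + 1, hj⟩)) *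
            (2 / 3) ^ (k + 1) := by
            refine Finset.sum_le_sum fun Q _ => mul_le_mul_of_nonneg_left (ih (by omega) Q) ?_
            exact integral_nonneg fun V => mul_self_nonneg _
        _ = (2 / 3) ^ (k + 1) := by
            rw [← Finset.sum_mul, ← integral_finsetSum _ fun Q _ => integrable_of_continuous (hc Q)]
            have : ∀ V : QUnitary (Fin n),
                ∑ Q, ptm (V : QOp (Fin n)) P Q * ptm (V : QOp (Fin n)) P Q = 1 := fun V => by
              rw [sum_ptm_mul_ptm (QUnitary.mul_conjTranspose_self V), if_pos rfl]
            simp [this]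

/-- The mean squared error of the truncation does not depend on the number of layers. -/
theorem integral_truncation_sq_le (hD : IsTwirledSequence D) (hL : 1 ≤ L) (k : ℕ)
    {ρ : QOp (Fin n)} (hρ : IsState ρ) (a : (Fin n → Fin 4) → ℝ) :
    ∫ U, (∑ P, a P * pathValue k (layerPtm U) (pauliValue ρ) L false P) ^ 2 ∂(Measure.pi D) ≤
      (2 / 3) ^ (k + 1) * ∑ P, a P ^ 2 := by
  obtain ⟨l, rfl⟩ : ∃ l, L = l + 1 := ⟨L - 1, by omega⟩
  have hi : ∀ P P' : Fin n → Fin 4, Integrable (fun U : Fin (l + 1) → QUnitary (Fin n) =>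
      a P * a P' * (pathValue k (layerPtm U) (pauliValue ρ) (l + 1) false P *
        pathValue k (layerPtm U) (pauliValue ρ) (l + 1) false P')) (Measure.pi D) := fun P P' =>
    integrable_of_continuous_pi (continuous_const.mul
      ((continuous_pathValue _ _ _ _ _).mul (continuous_pathValue _ _ _ _ _)))
  simp_rw [sq, Finset.sum_mul_sum, mul_mul_mul_comm]
  rw [integral_finsetSum _ fun Q _ => integrable_finsetSum _ fun Q' _ => hi Q Q', Finset.mul_sum]
  refine Finset.sum_le_sum fun P _ => ?_
  rw [integral_finsetSum _ fun Q' _ => hi P Q', Finset.sum_eq_single P, integral_const_mul, mul_comm]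
  · exact mul_le_mul_of_nonneg_right (integral_pathValue_false_le hD k hρ (by omega) P)
      (mul_self_nonneg _)
  · intro P' _ h
    rw [integral_const_mul, integral_pathValue_of_ne hD k _ (by omega) _ _ h.symm, mul_zero]
  · simp

end

/-! ### Duality between the evolved coefficients and the path sums -/

section

variable {n L : ℕ}

theorem IsLocallyScramblingCircuit.isTwirledSequence {D : Fin L → Measure (QUnitary (Fin n))}
    {b : ℕ} {Q : Prog}
    {desc : (Fin L → QUnitary (Fin n)) → CircuitDesc}
    (h : IsLocallyScramblingCircuit b Q D desc) : IsTwirledSequence D := by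
  refine ⟨h.first, fun j hj => ?_⟩
  obtain ⟨A, ν, hν, hs, hD⟩ := h.later j hj
  rw [hD]
  exact hs.isDiagonallyTwirled_map

theorem layerAt_castSucc (U : Fin (L + 1) → QUnitary (Fin n)) {j : ℕ} (hj : j < L) :
    layerAt (fun i : Fin L => U i.castSucc) j = layerAt U j := by
  simp [layerAt, hj, Nat.lt_succ_of_lt hj]

theorem stateAt_castSucc (ρ : QOp (Fin n)) (U : Fin (L + 1) → QUnitary (Fin n)) {j : ℕ}
    (hj : j ≤ L) : stateAt ρ (fun i : Fin L => U i.castSucc) j = stateAt ρ U j := by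
  induction j with
  | zero => rfl
  | succ j ih => rw [stateAt, stateAt, layerAt_castSucc U hj, ih (by omega)]

theorem circuitProd_conj (ρ : QOp (Fin n)) (U : Fin L → QUnitary (Fin n)) :
    (circuitProd U : QOp (Fin n)) * ρ * (circuitProd U : QOp (Fin n)).conjTranspose =
      stateAt ρ U L := by
  induction L with
  | zero => simp [circuitProd, stateAt]
  | succ L ih =>
    have h : circuitProd U = U (Fin.last L) * circuitProd fun i : Fin L => U i.castSucc := by
      rw [circuitProd, List.ofFn_succ', List.concat_eq_append, List.reverse_append]
      simp only [List.reverse_singleton, List.singleton_append, List.prod_cons]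
      rfl
    have hl : layerAt U L = U (Fin.last L) := by simp [layerAt, Fin.last]
    rw [h, stateAt, ← stateAt_castSucc ρ U le_rfl, ← ih, hl]
    simp only [Submonoid.coe_mul, Matrix.conjTranspose_mul, Matrix.mul_assoc]

theorem expectationValue_eq (k : ℕ) {O : QOp (Fin n)} (hO : O.IsHermitian) (ρ : QOp (Fin n))
    (U : Fin L → QUnitary (Fin n)) :
    expectationValue O ρ U = ∑ P, (pauliCoeff O P).re *
      pathValue k (layerPtm U) (pauliValue ρ) L true P := by
  have h : O * (circuitProd U : QOp (Fin n)) * ρ * (circuitProd U : QOp (Fin n)).conjTranspose =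
      O * stateAt ρ U L := by
    rw [← circuitProd_conj]; simp only [Matrix.mul_assoc]
  simp_rw [pathValue_true]
  rw [expectationValue, h]
  conv_lhs => rw [← sum_trace_smul_pauliOp O, Matrix.sum_mul, Matrix.trace_sum, Complex.re_sum]
  refine Finset.sum_congr rfl fun P _ => ?_
  have h2 : ((pauliOp P * O).trace / 2 ^ Fintype.card (Fin n)) = ((pauliCoeff O P).re : ℂ) := by
    have h3 := ofReal_trace_mul (pauliOp_conjTranspose P) hO.eq
    have h4 : ((2 : ℂ) ^ n) = (((2 : ℝ) ^ n : ℝ) : ℂ) := by simp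
    rw [pauliCoeff, Fintype.card_fin, ← h3, h4, ← Complex.ofReal_div, Complex.ofReal_re]
  rw [h2, Matrix.smul_mul, Matrix.trace_smul, smul_eq_mul, Complex.re_ofReal_mul, pauliValue]

/-- Evolving the coefficients backwards is dual to evolving the truncated values forwards. -/
theorem sum_evolvedCoeff_mul (k : ℕ) (R : ℕ → (Fin n → Fin 4) → (Fin n → Fin 4) → ℝ)
    (c r : (Fin n → Fin 4) → ℝ) {i : ℕ} (hi : i ≤ L) :
    ∑ T, evolvedCoeff k L R c i T *
        (pathValue k R r (L - i) true T - pathValue k R r (L - i) false T) =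
      ∑ P, c P * (pathValue k R r L true P - pathValue k R r L false P) := by
  induction i with
  | zero => rfl
  | succ i ih =>
    rw [← ih (by omega)]
    have hLi : L - i = (L - (i + 1)) + 1 := by omega
    have h1 : L - (1 + i) = L - (i + 1) := by omega
    -- The difference of total and loss is the part that is kept. It vanishes at operators of weight
    -- above `k` and obeys the untruncated recursion at the others.
    have hrec : ∀ P, pathValue k R r (L - i) true P - pathValue k R r (L - i) false P =
        if P ∈ lowSet n k then ∑ T, R (L - (i + 1)) P T *
          (pathValue k R r (L - (i + 1)) true T - pathValue k R r (L - (i + 1)) false T)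
        else 0 := by
      intro P
      rw [hLi, pathValue, pathValue]
      by_cases hP : k < pauliWeight P
      · simp [hP, lowSet]
      · simp [hP, lowSet, not_lt.1 hP, mul_sub, Finset.sum_sub_distrib]
    simp_rw [hrec, mul_ite, mul_zero]
    rw [Finset.sum_ite_mem, Finset.univ_inter]
    simp_rw [evolvedCoeff, Finset.sum_mul, Finset.mul_sum, h1]
    rw [Finset.sum_comm]
    exact Finset.sum_congr rfl fun P _ => Finset.sum_congr rfl fun T _ => by ring

/-- Each step is a restriction to low weights followed by a matrix with orthonormal rows; neither
increases the `ℓ²` norm. -/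
theorem sum_evolvedCoeff_sq_le (k : ℕ) (U : Fin L → QUnitary (Fin n)) (c : (Fin n → Fin 4) → ℝ)
    (i : ℕ) :
    ∑ T, evolvedCoeff k L (layerPtm U) c (i + 1) T ^ 2 ≤ ∑ P ∈ lowSet n k, c P ^ 2 := by
  have step : ∀ i, ∑ T, evolvedCoeff k L (layerPtm U) c (i + 1) T ^ 2 =
      ∑ P ∈ lowSet n k, evolvedCoeff k L (layerPtm U) c i P ^ 2 := by
    intro i
    simp_rw [evolvedCoeff, sq, Finset.sum_mul_sum]
    rw [Finset.sum_comm]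
    refine Finset.sum_congr rfl fun P hP => ?_
    rw [Finset.sum_comm]
    simp_rw [mul_mul_mul_comm, ← Finset.mul_sum, layerPtm,
      sum_ptm_mul_ptm (QUnitary.mul_conjTranspose_self _)]
    simp [hP]
  induction i with
  | zero => exact (step 0).le
  | succ i ih =>
    rw [step]
    exact (Finset.sum_le_sum_of_subset_of_nonneg (Finset.subset_univ _)
      fun _ _ _ => sq_nonneg _).trans ih

theorem evolvedCoeff_sub (k : ℕ) (R : ℕ → (Fin n → Fin 4) → (Fin n → Fin 4) → ℝ)
    (c c' : (Fin n → Fin 4) → ℝ) (i : ℕ) (T : Fin n → Fin 4) :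
    evolvedCoeff k L R (c - c') i T = evolvedCoeff k L R c i T - evolvedCoeff k L R c' i T := by
  induction i generalizing T with
  | zero => rfl
  | succ i ih => simp [evolvedCoeff, ih, sub_mul, Finset.sum_sub_distrib]

end

/-! ## Stabilizer states and the estimators -/

/-- The factor is `1` for the identity letter, `±3` if the axis matches the letter and `0`
otherwise. The three axes add up to `3` times the identity, the two signs of the matching axis to
`3` times the Pauli matrix. -/
theorem sum_shotFactor (l : Fin 4) (x y : Fin 2) :
    ∑ a : Fin 3 × Fin 2, (shotFactor l a.1 a.2 : ℂ) *
      ((2⁻¹ : ℂ) • (1 + (-1 : ℂ) ^ (a.2 : ℕ) • pauliOne a.1.succ)) x y = 3 * pauliOne l x y := by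
  rw [Fintype.sum_prod_type]
  simp only [Fin.sum_univ_three, Fin.sum_univ_two]
  fin_cases l <;> fin_cases x <;> fin_cases y <;>
    simp [shotFactor, pauliOne] <;> ring_nf

theorem abs_shotFactor_le (l : Fin 4) (a : Fin 3) (g : Fin 2) :
    |shotFactor l a g| ≤ if l ≠ 0 then 3 else 1 := by
  fin_cases l <;> fin_cases a <;> fin_cases g <;> norm_num [shotFactor]

section

variable {n : ℕ}

theorem abs_shotWeight_le (P : Fin n → Fin 4) (σ : StabLabel n) :
    |shotWeight P σ| ≤ 3 ^ pauliWeight P := by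
  rw [shotWeight, Finset.abs_prod, pauliWeight, ← Finset.prod_const, Finset.prod_filter]
  exact Finset.prod_le_prod (fun _ _ => abs_nonneg _) fun i _ => abs_shotFactor_le _ _ _

theorem shotWeight_sq_le (P : Fin n → Fin 4) (σ : StabLabel n) :
    shotWeight P σ ^ 2 ≤ 9 ^ pauliWeight P := by
  have h := pow_le_pow_left₀ (abs_nonneg _) (abs_shotWeight_le P σ) 2
  rwa [sq_abs, ← pow_mul, mul_comm, pow_mul, show (3 : ℝ) ^ 2 = 9 by norm_num] at h

theorem shotWeight_zero (σ : StabLabel n) : shotWeight (fun _ => 0) σ = 1 := by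
  refine Finset.prod_eq_one fun i _ => ?_
  simp [shotFactor]

theorem sum_shotWeight_smul (P : Fin n → Fin 4) :
    ∑ σ : StabLabel n, (shotWeight P σ : ℂ) • stabState σ = (3 : ℂ) ^ n • pauliOp P := by
  ext x y
  have h := sum_pi_prod fun i (a : Fin 3 × Fin 2) => (shotFactor (P i) a.1 a.2 : ℂ) *
    ((2⁻¹ : ℂ) • (1 + (-1 : ℂ) ^ (a.2 : ℕ) • pauliOne a.1.succ)) (x i) (y i)
  simp only [sum_shotFactor] at h
  rw [Finset.prod_mul_distrib, Finset.prod_const, Finset.card_univ, Fintype.card_fin] at h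
  rw [Matrix.sum_apply]
  refine Eq.trans (Finset.sum_congr rfl fun σ _ => ?_) h
  rw [Finset.prod_mul_distrib, Matrix.smul_apply, smul_eq_mul, shotWeight, Complex.ofReal_prod]
  rfl

theorem pauliOp_zero : pauliOp (fun _ : Fin n => 0) = 1 := by
  simp [pauliOp, pauliOne, tensorOp_one]

theorem stabState_conjTranspose (σ : StabLabel n) : (stabState σ).conjTranspose = stabState σ := by
  rw [stabState, conjTranspose_tensorOp]
  congr 1
  funext i
  simp [Matrix.conjTranspose_smul, pauliOne_conjTranspose]

theorem stabState_mul_self (σ : StabLabel n) : stabState σ * stabState σ = stabState σ := by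
  rw [stabState, tensorOp_mul]
  congr 1
  funext i
  have h := pauliOne_mul_self (σ i).1.succ
  obtain hs | hs : (-1 : ℂ) ^ ((σ i).2 : ℕ) = 1 ∨ (-1 : ℂ) ^ ((σ i).2 : ℕ) = -1 :=
    neg_one_pow_eq_or ℂ _
  all_goals
    rw [hs]
    simp only [Matrix.smul_mul, Matrix.mul_smul, add_mul, mul_add, one_mul, mul_one, h, smul_smul]
    module

theorem stabState_posSemidef (σ : StabLabel n) : (stabState σ).PosSemidef := by
  have h := Matrix.posSemidef_self_mul_conjTranspose (stabState σ)
  rwa [stabState_conjTranspose, stabState_mul_self] at h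

theorem trace_stabState_mul_nonneg (σ : StabLabel n) {ρ : QOp (Fin n)} (h : ρ.PosSemidef) :
    0 ≤ (stabState σ * ρ).trace.re := by
  have h1 := (h.mul_mul_conjTranspose_same (stabState σ)).trace_nonneg
  rw [Matrix.trace_mul_comm, stabState_conjTranspose, ← Matrix.mul_assoc, stabState_mul_self] at h1
  exact (Complex.le_def.1 h1).1

end

/-! ## Discrete laws -/

section Discrete

variable {Ω κ : Type*} [MeasurableSpace Ω] [Fintype κ]

/-- The law that gives the weight `w i` to the point `p i`. -/
noncomputable def discreteLaw (w : κ → ℝ) (p : κ → Ω) : Measure Ω :=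
  ∑ i, ENNReal.ofReal (w i) • Measure.dirac (p i)

theorem isProbabilityMeasure_discreteLaw {w : κ → ℝ} (hw : ∀ i, 0 ≤ w i) (hs : ∑ i, w i = 1)
    (p : κ → Ω) : IsProbabilityMeasure (discreteLaw w p) := by
  constructor
  simp [discreteLaw, ← ENNReal.ofReal_sum_of_nonneg fun i _ => hw i, hs]

theorem integrable_discreteLaw (w : κ → ℝ) (p : κ → Ω) {f : Ω → ℝ} (hf : Measurable f) :
    Integrable f (discreteLaw w p) := by
  refine integrable_finsetSum_measure.2 fun i _ => ?_
  refine Integrable.smul_measure ?_ ENNReal.ofReal_ne_top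
  exact integrable_dirac' hf.stronglyMeasurable (by simp)

theorem integral_discreteLaw {w : κ → ℝ} (hw : ∀ i, 0 ≤ w i) (p : κ → Ω) {f : Ω → ℝ}
    (hf : Measurable f) : ∫ z, f z ∂discreteLaw w p = ∑ i, w i * f (p i) := by
  rw [discreteLaw, integral_finsetSum_measure]
  · refine Finset.sum_congr rfl fun i _ => ?_
    rw [integral_smul_measure, integral_dirac' _ _ hf.stronglyMeasurable,
      ENNReal.toReal_ofReal (hw i), smul_eq_mul]
  · exact fun i _ => (integrable_dirac' hf.stronglyMeasurable (by simp)).smul_measure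
      ENNReal.ofReal_ne_top

end Discrete

/-! ## Moments of the measurement records -/

section

variable {n : ℕ}

theorem stateShotLaw_eq (ρ : QOp (Fin n)) : stateShotLaw ρ =
    discreteLaw (fun σ => (1 / 3) ^ n * (stabState σ * ρ).trace.re) id := rfl

theorem stateShotLaw_weight_nonneg {ρ : QOp (Fin n)} (h : IsState ρ) (σ : StabLabel n) :
    0 ≤ (1 / 3 : ℝ) ^ n * (stabState σ * ρ).trace.re :=
  mul_nonneg (by positivity) (trace_stabState_mul_nonneg σ h.1)

theorem sum_shotWeight_mul_trace (P : Fin n → Fin 4) (A : QOp (Fin n)) :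
    ∑ σ : StabLabel n, shotWeight P σ * (stabState σ * A).trace.re =
      3 ^ n * (pauliOp P * A).trace.re := by
  have h := congrArg (fun S => (S * A).trace.re) (sum_shotWeight_smul P)
  simp only [Matrix.sum_mul, Matrix.trace_sum, Complex.re_sum, Matrix.smul_mul, Matrix.trace_smul,
    smul_eq_mul, Complex.re_ofReal_mul] at h
  rw [h, show ((3 : ℂ) ^ n) = ((3 ^ n : ℝ) : ℂ) by push_cast; rfl, Complex.re_ofReal_mul]

theorem sum_trace_stabState_mul (A : QOp (Fin n)) :
    ∑ σ : StabLabel n, (stabState σ * A).trace.re = 3 ^ n * A.trace.re := by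
  have h := sum_shotWeight_mul_trace (fun _ => 0) A
  simpa [shotWeight_zero, pauliOp_zero] using h

theorem isProbabilityMeasure_stateShotLaw {ρ : QOp (Fin n)} (h : IsState ρ) :
    IsProbabilityMeasure (stateShotLaw ρ) := by
  refine isProbabilityMeasure_discreteLaw (stateShotLaw_weight_nonneg h) ?_ id
  rw [← Finset.mul_sum, sum_trace_stabState_mul, h.2, Complex.one_re, mul_one, ← mul_pow]
  norm_num

theorem integral_shotWeight {ρ : QOp (Fin n)} (h : IsState ρ) (P : Fin n → Fin 4) :
    ∫ σ, shotWeight P σ ∂stateShotLaw ρ = pauliValue ρ P := by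
  rw [stateShotLaw_eq, integral_discreteLaw (stateShotLaw_weight_nonneg h) _ (.of_discrete)]
  have : ∀ σ : StabLabel n, (1 / 3 : ℝ) ^ n * (stabState σ * ρ).trace.re * shotWeight P (id σ) =
      (1 / 3 : ℝ) ^ n * (shotWeight P σ * (stabState σ * ρ).trace.re) := fun σ => by
    rw [id]; ring
  simp only [this]
  rw [← Finset.mul_sum, sum_shotWeight_mul_trace, ← mul_assoc, ← mul_pow, pauliValue]
  norm_num

/-- The columns of the eigenvector unitary are the eigenvectors, so this is the trace of `S` against
the spectral calculus of `O`. It is used for `f = 1`, `λ` and `λ²`: total mass, mean and second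
moment of the outcomes. -/
theorem trace_mul_spectral {O : QOp (Fin n)} (hO : O.IsHermitian) (S : QOp (Fin n))
    (f : Bits (Fin n) → ℝ) :
    ∑ v, f v * (star (hO.eigenvectorBasis v).ofLp ⬝ᵥ
      S.mulVec (hO.eigenvectorBasis v).ofLp).re = (S * ((hO.eigenvectorUnitary : QOp (Fin n)) *
        Matrix.diagonal (fun v => (f v : ℂ)) *
        (hO.eigenvectorUnitary : QOp (Fin n)).conjTranspose)).trace.re := by
  rw [← Matrix.mul_assoc, ← Matrix.mul_assoc, Matrix.trace_mul_comm, ← Matrix.mul_assoc,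
    ← Matrix.mul_assoc, Matrix.trace, Complex.re_sum]
  refine Finset.sum_congr rfl fun v _ => ?_
  rw [Matrix.diag_apply, Matrix.mul_diagonal, mul_comm _ ((f v : ℝ) : ℂ), Complex.re_ofReal_mul,
    Matrix.mul_assoc]
  rfl

theorem trace_mul_one_spectral {O : QOp (Fin n)} (hO : O.IsHermitian) (S : QOp (Fin n)) :
    ∑ v, (star (hO.eigenvectorBasis v).ofLp ⬝ᵥ
      S.mulVec (hO.eigenvectorBasis v).ofLp).re = S.trace.re := by
  have h := trace_mul_spectral hO S fun _ => 1
  simp only [one_mul, Complex.ofReal_one, Matrix.diagonal_one, Matrix.mul_one] at h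
  rw [h, QUnitary.mul_conjTranspose_self, Matrix.mul_one]

theorem spectral_eq {O : QOp (Fin n)} (hO : O.IsHermitian) :
    (hO.eigenvectorUnitary : QOp (Fin n)) * Matrix.diagonal (fun v => (hO.eigenvalues v : ℂ)) *
      (hO.eigenvectorUnitary : QOp (Fin n)).conjTranspose = O := by
  conv_rhs => rw [hO.spectral_theorem, Unitary.conjStarAlgAut_apply]
  rfl

theorem trace_mul_eigenvalues {O : QOp (Fin n)} (hO : O.IsHermitian) (S : QOp (Fin n)) :
    ∑ v, hO.eigenvalues v * (star (hO.eigenvectorBasis v).ofLp ⬝ᵥ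
      S.mulVec (hO.eigenvectorBasis v).ofLp).re = (S * O).trace.re := by
  rw [trace_mul_spectral, spectral_eq]

theorem trace_mul_eigenvalues_sq {O : QOp (Fin n)} (hO : O.IsHermitian) (S : QOp (Fin n)) :
    ∑ v, hO.eigenvalues v ^ 2 * (star (hO.eigenvectorBasis v).ofLp ⬝ᵥ
      S.mulVec (hO.eigenvectorBasis v).ofLp).re = (S * (O * O)).trace.re := by
  rw [trace_mul_spectral]
  congr 3
  conv_rhs => rw [← spectral_eq hO]
  have h := QUnitary.conjTranspose_mul_self hO.eigenvectorUnitary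
  set V : QOp (Fin n) := (hO.eigenvectorUnitary : QOp (Fin n))
  set E := Matrix.diagonal fun v => (hO.eigenvalues v : ℂ)
  have h2 : V * E * V.conjTranspose * (V * E * V.conjTranspose) =
      V * (E * (V.conjTranspose * V) * E) * V.conjTranspose := by
    simp only [Matrix.mul_assoc]
  rw [h2, h, Matrix.mul_one, Matrix.diagonal_mul_diagonal]
  simp [sq]

theorem re_quadratic_stabState_nonneg (σ : StabLabel n) (v : Bits (Fin n) → ℂ) :
    0 ≤ (star v ⬝ᵥ (stabState σ).mulVec v).re :=
  (Complex.le_def.1 ((stabState_posSemidef σ).dotProduct_mulVec_nonneg v)).1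

/-- The probability weight of one randomized measurement of an observable. -/
noncomputable def observableShotWeight {O : QOp (Fin n)} (hO : O.IsHermitian)
    (z : StabLabel n × Bits (Fin n)) : ℝ :=
  (1 / 6) ^ n * (star (hO.eigenvectorBasis z.2).ofLp ⬝ᵥ
    (stabState z.1).mulVec (hO.eigenvectorBasis z.2).ofLp).re

theorem observableShotWeight_nonneg {O : QOp (Fin n)} (hO : O.IsHermitian)
    (z : StabLabel n × Bits (Fin n)) : 0 ≤ observableShotWeight hO z :=
  mul_nonneg (by positivity) (re_quadratic_stabState_nonneg _ _)

theorem observableShotLaw_eq {O : QOp (Fin n)} (hO : O.IsHermitian) : observableShotLaw O hO =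
    discreteLaw (observableShotWeight hO) fun z => (z.1, hO.eigenvalues z.2) := by
  rw [discreteLaw, Fintype.sum_prod_type]
  rfl

theorem isProbabilityMeasure_observableShotLaw {O : QOp (Fin n)} (hO : O.IsHermitian) :
    IsProbabilityMeasure (observableShotLaw O hO) := by
  rw [observableShotLaw_eq]
  refine isProbabilityMeasure_discreteLaw (observableShotWeight_nonneg hO) ?_ _
  simp only [observableShotWeight]
  rw [Fintype.sum_prod_type]
  simp only [← Finset.mul_sum, trace_mul_one_spectral]
  have h := sum_trace_stabState_mul (1 : QOp (Fin n))
  simp only [Matrix.mul_one] at h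
  rw [h, Matrix.trace_one, Fintype.card_pi_const, Fintype.card_fin,
    show (((2 ^ n : ℕ) : ℂ)) = ((2 ^ n : ℝ) : ℂ) by push_cast; rfl, Complex.ofReal_re, ← mul_pow,
    ← mul_pow]
  norm_num

theorem measurable_outcome_mul_shotWeight (P : Fin n → Fin 4) :
    Measurable fun y : StabLabel n × ℝ => y.2 * shotWeight P y.1 :=
  measurable_snd.mul ((Measurable.of_discrete (f := shotWeight P)).comp measurable_fst)

theorem pauliCoeff_re (O : QOp (Fin n)) (P : Fin n → Fin 4) :
    (pauliCoeff O P).re = (pauliOp P * O).trace.re / 2 ^ n := by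
  rw [pauliCoeff, show ((2 : ℂ) ^ n) = ((2 ^ n : ℝ) : ℂ) by push_cast; rfl, Complex.div_ofReal_re]

/-- There are `6^n` product states and the weighted states add up to `3^n` times `P`; the quotient
`2^(-n)` is the normalization of the Pauli coefficient. -/
theorem integral_outcome_mul_shotWeight {O : QOp (Fin n)} (hO : O.IsHermitian)
    (P : Fin n → Fin 4) :
    ∫ y, y.2 * shotWeight P y.1 ∂observableShotLaw O hO = (pauliCoeff O P).re := by
  rw [observableShotLaw_eq, integral_discreteLaw (observableShotWeight_nonneg hO) _
    (measurable_outcome_mul_shotWeight P), Fintype.sum_prod_type]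
  have h : ∀ σ : StabLabel n, ∑ v, observableShotWeight hO (σ, v) *
      (hO.eigenvalues v * shotWeight P σ) =
        (1 / 6) ^ n * (shotWeight P σ * (stabState σ * O).trace.re) := fun σ => by
    rw [← trace_mul_eigenvalues hO, Finset.mul_sum, Finset.mul_sum]
    refine Finset.sum_congr rfl fun v _ => ?_
    rw [observableShotWeight]
    ring
  simp only [h]
  rw [← Finset.mul_sum, sum_shotWeight_mul_trace, pauliCoeff_re, ← mul_assoc, ← mul_pow,
    show (1 / 6 * 3 : ℝ) = 2⁻¹ by norm_num, inv_pow, mul_comm, div_eq_mul_inv]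

theorem integral_outcome_sq {O : QOp (Fin n)} (hO : O.IsHermitian) :
    ∫ y, y.2 ^ 2 ∂observableShotLaw O hO = (O * O).trace.re / 2 ^ n := by
  rw [observableShotLaw_eq, integral_discreteLaw (observableShotWeight_nonneg hO) _
    (measurable_snd.pow_const 2), Fintype.sum_prod_type]
  have h : ∀ σ : StabLabel n, ∑ v, observableShotWeight hO (σ, v) * (hO.eigenvalues v) ^ 2 =
        (1 / 6) ^ n * (stabState σ * (O * O)).trace.re := fun σ => by
    rw [← trace_mul_eigenvalues_sq hO, Finset.mul_sum]
    refine Finset.sum_congr rfl fun v _ => ?_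
    rw [observableShotWeight]
    ring
  simp only [h]
  rw [← Finset.mul_sum, sum_trace_stabState_mul, ← mul_assoc, ← mul_pow,
    show (1 / 6 * 3 : ℝ) = 2⁻¹ by norm_num, inv_pow, mul_comm, div_eq_mul_inv]

theorem ofReal_re_pauliCoeff {O : QOp (Fin n)} (hO : O.IsHermitian) (P : Fin n → Fin 4) :
    ((pauliCoeff O P).re : ℂ) = pauliCoeff O P := by
  rw [pauliCoeff_re, pauliCoeff, ← ofReal_trace_mul (pauliOp_conjTranspose P) hO]
  push_cast
  rfl

theorem pauliNorm_sq_eq_sum {O : QOp (Fin n)} (hO : O.IsHermitian) :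
    pauliNorm O ^ 2 = ∑ P, (pauliCoeff O P).re ^ 2 := by
  rw [pauliNorm, Real.sq_sqrt (Finset.sum_nonneg fun _ _ => by positivity)]
  refine Finset.sum_congr rfl fun P _ => ?_
  conv_lhs => rw [← ofReal_re_pauliCoeff hO P]
  rw [Complex.norm_real, Real.norm_eq_abs, sq_abs]

theorem pauliNorm_sq_eq_trace {O : QOp (Fin n)} (hO : O.IsHermitian) :
    pauliNorm O ^ 2 = (O * O).trace.re / 2 ^ n := by
  rw [pauliNorm_sq_eq_sum hO]
  have h := congrArg Complex.re (sum_trace_mul_trace O O)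
  have him : ∀ P : Fin n → Fin 4, (pauliOp P * O).trace.im = 0 := fun P => by
    simpa using (congrArg Complex.im (ofReal_trace_mul (pauliOp_conjTranspose P) hO)).symm
  simp only [Complex.re_sum, Complex.mul_re, him, mul_zero, sub_zero, Fintype.card_fin] at h
  rw [show ((2 : ℂ) ^ n) = ((2 ^ n : ℝ) : ℂ) by push_cast; rfl, Complex.ofReal_re,
    Complex.ofReal_im, zero_mul, sub_zero] at h
  have h2 : (O * O).trace.re / 2 ^ n = (2 ^ n * (O * O).trace.re) / 2 ^ n / 2 ^ n := by
    field_simp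
  rw [h2, ← h]
  simp only [pauliCoeff_re, Finset.sum_div]
  refine Finset.sum_congr rfl fun P _ => ?_
  ring

/-- The Pauli norm is the normalized Hilbert–Schmidt norm, and each diagonal entry of `O²` is the
squared norm of a column of `O`. -/
theorem pauliNorm_le_opNorm {O : QOp (Fin n)} (hO : O.IsHermitian) :
    pauliNorm O ≤ ‖Matrix.toEuclideanCLM (𝕜 := ℂ) O‖ := by
  refine le_of_sq_le_sq ?_ (norm_nonneg _)
  rw [pauliNorm_sq_eq_trace hO, div_le_iff₀ (by positivity)]
  have h : ∀ x : Bits (Fin n), ((O * O) x x).re ≤ ‖Matrix.toEuclideanCLM (𝕜 := ℂ) O‖ ^ 2 := by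
    intro x
    have h1 := (Matrix.toEuclideanCLM (𝕜 := ℂ) O).le_opNorm (EuclideanSpace.single x 1)
    rw [PiLp.norm_single, norm_one, mul_one] at h1
    have h2 := pow_le_pow_left₀ (norm_nonneg _) h1 2
    refine le_trans (le_of_eq ?_) h2
    rw [EuclideanSpace.norm_sq_eq, Matrix.mul_apply, Complex.re_sum]
    refine Finset.sum_congr rfl fun y _ => ?_
    have h3 : (Matrix.toEuclideanCLM (𝕜 := ℂ) O (EuclideanSpace.single x 1)) y = O y x := by
      simp [Matrix.ofLp_toEuclideanCLM]
    rw [h3, ← hO.apply x y, Complex.star_def, ← Complex.normSq_eq_conj_mul_self, Complex.ofReal_re,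
      Complex.normSq_eq_norm_sq]
  rw [Matrix.trace, Complex.re_sum]
  refine (Finset.sum_le_sum fun x _ => h x).trans (le_of_eq ?_)
  simp [mul_comm]

end

/-! ## Means of independent samples -/

section Mean

variable {Ω : Type*} [MeasurableSpace Ω]

/-- Markov's inequality, relative to a scale `c` that may be zero. -/
theorem measure_lt_le_of_integral_le {μ : Measure Ω} [IsProbabilityMeasure μ] {X : Ω → ℝ}
    (hX : Integrable X μ) (h0 : ∀ ω, 0 ≤ X ω) {K c t : ℝ} (hc : 0 ≤ c) (ht : 0 < t)
    (h : ∫ ω, X ω ∂μ ≤ K * c) : μ {ω | t * c < X ω} ≤ ENNReal.ofReal (K / t) := by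
  rcases hc.eq_or_lt with rfl | hc
  -- Scale zero occurs for `O = 0`. Then `X` vanishes almost surely, so the strict inequality
  -- describes a null set.
  · have h1 : ∫ ω, X ω ∂μ = 0 :=
      le_antisymm (by simpa using h) (integral_nonneg h0)
    have h2 := (integral_eq_zero_iff_of_nonneg h0 hX).1 h1
    have h3 : μ {ω | t * 0 < X ω} = 0 := by
      refine measure_mono_null (fun ω hω => ?_) h2
      have : 0 < X ω := by simpa using hω
      exact this.ne'
    rw [h3]
    exact zero_le
  · have h1 := mul_meas_ge_le_integral_of_nonneg (.of_forall h0) hX (t * c)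
    have h2 : μ.real {ω | t * c ≤ X ω} ≤ K / t := by
      rw [le_div_iff₀ ht]
      refine le_of_mul_le_mul_right ?_ hc
      calc μ.real {ω | t * c ≤ X ω} * t * c = t * c * μ.real {ω | t * c ≤ X ω} := by ring
        _ ≤ K * c := h1.trans h
    calc μ {ω | t * c < X ω} ≤ μ {ω | t * c ≤ X ω} := measure_mono (Set.ofPred_subset_ofPred.2 fun _ => le_of_lt)
      _ = ENNReal.ofReal (μ.real {ω | t * c ≤ X ω}) := (ofReal_measureReal).symm
      _ ≤ _ := ENNReal.ofReal_le_ofReal h2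

variable {μ : Measure Ω} [IsProbabilityMeasure μ] {X : Ω → ℝ} {M : ℕ}

theorem memLp_mean (hX : MemLp X 2 μ) :
    MemLp (fun ω : Fin M → Ω => (∑ m, X (ω m)) / M) 2 (Measure.pi fun _ => μ) := by
  have h : MemLp (fun ω : Fin M → Ω => ∑ m, X (ω m)) 2 (Measure.pi fun _ => μ) :=
    memLp_finsetSum _ fun m _ => hX.comp_measurePreserving (measurePreserving_eval _ m)
  simpa [div_eq_inv_mul] using h.const_mul ((M : ℝ)⁻¹)

theorem integral_mean (hX : MemLp X 2 μ) (hM : 0 < M) :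
    ∫ ω : Fin M → Ω, (∑ m, X (ω m)) / M ∂(Measure.pi fun _ => μ) = ∫ z, X z ∂μ := by
  have hi : Integrable X μ := hX.integrable one_le_two
  rw [integral_div, integral_finsetSum]
  · have h : ∀ m : Fin M, ∫ ω : Fin M → Ω, X (ω m) ∂(Measure.pi fun _ => μ) = ∫ z, X z ∂μ :=
      fun m => integral_comp_eval (μ := fun _ : Fin M => μ) (i := m) hi.aestronglyMeasurable
    simp only [h, Finset.sum_const, Finset.card_univ, Fintype.card_fin, nsmul_eq_mul]
    field_simp
  · exact fun m _ => (measurePreserving_eval (fun _ : Fin M => μ) m).integrable_comp_of_integrable hi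

theorem integrable_mean_sub_sq (hX : MemLp X 2 μ) (c : ℝ) :
    Integrable (fun ω : Fin M → Ω => ((∑ m, X (ω m)) / M - c) ^ 2) (Measure.pi fun _ => μ) :=
  ((memLp_mean hX).sub (memLp_const c)).integrable_sq

/-- The variance of a mean of `M` independent copies is the single variance divided by `M`, and a
variance is at most the second moment. -/
theorem integral_mean_sub_sq_le (hX : MemLp X 2 μ) (hM : 0 < M) :
    ∫ ω : Fin M → Ω, ((∑ m, X (ω m)) / M - ∫ z, X z ∂μ) ^ 2 ∂(Measure.pi fun _ => μ) ≤
      (∫ z, X z ^ 2 ∂μ) / M := by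
  have hv := ProbabilityTheory.variance_eq_integral (memLp_mean (M := M) hX).aemeasurable
  rw [integral_mean hX hM] at hv
  rw [← hv]
  have h1 := ProbabilityTheory.variance_sum_pi (μ := fun _ : Fin M => μ) (X := fun _ => X)
    fun _ => hX
  have h2 : (fun ω : Fin M → Ω => (∑ m, X (ω m)) / M) =
      fun ω => (M : ℝ)⁻¹ * (∑ m, fun ω : Fin M → Ω => X (ω m)) ω := by
    funext ω
    rw [Finset.sum_apply, div_eq_inv_mul]
  rw [h2, ProbabilityTheory.variance_const_mul, h1, Finset.sum_const, Finset.card_univ,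
    Fintype.card_fin, nsmul_eq_mul]
  have h3 := ProbabilityTheory.variance_le_expectation_sq hX.aestronglyMeasurable
  have hM' : (0 : ℝ) < M := by exact_mod_cast hM
  calc ((M : ℝ)⁻¹) ^ 2 * (M * ProbabilityTheory.variance X μ)
      = ProbabilityTheory.variance X μ / M := by field_simp
    _ ≤ _ := by gcongr; exact h3

end Mean

section Estimates

variable {n M : ℕ}

theorem measure_stateEstimate_le {ρ : QOp (Fin n)} (h : IsState ρ) (hM : 0 < M) (w : ℕ) {t : ℝ}
    (ht : 0 < t) : (Measure.pi fun _ : Fin M => stateShotLaw ρ)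
      {x | t < ∑ T ∈ lowSet n w, (stateEstimate x T - pauliValue ρ T) ^ 2} ≤
        ENNReal.ofReal ((lowSet n w).card * 9 ^ w / M / t) := by
  have := isProbabilityMeasure_stateShotLaw h
  have hL : ∀ T : Fin n → Fin 4, MemLp (shotWeight T) 2 (stateShotLaw ρ) := fun T =>
    (memLp_two_iff_integrable_sq (Measurable.of_discrete).aestronglyMeasurable).2
      (integrable_discreteLaw _ _ .of_discrete)
  have key : ∀ T ∈ lowSet n w, ∫ x : Fin M → StabLabel n,
      (stateEstimate x T - pauliValue ρ T) ^ 2 ∂(Measure.pi fun _ => stateShotLaw ρ) ≤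
        9 ^ w / M := by
    intro T hT
    have h1 := integral_mean_sub_sq_le (hL T) hM
    rw [integral_shotWeight h] at h1
    refine h1.trans ?_
    gcongr
    calc ∫ σ, shotWeight T σ ^ 2 ∂stateShotLaw ρ ≤ ∫ _, (9 : ℝ) ^ w ∂stateShotLaw ρ := by
          refine integral_mono (hL T).integrable_sq (integrable_const _) fun σ => ?_
          exact (shotWeight_sq_le T σ).trans
            (pow_le_pow_right₀ (by norm_num) (Finset.mem_filter.1 hT).2)
      _ = 9 ^ w := by simp
  have hint : ∀ T ∈ lowSet n w, Integrable (fun x : Fin M → StabLabel n =>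
      (stateEstimate x T - pauliValue ρ T) ^ 2) (Measure.pi fun _ => stateShotLaw ρ) :=
    fun T _ => integrable_mean_sub_sq (hL T) _
  have h2 := measure_lt_le_of_integral_le (μ := Measure.pi fun _ : Fin M => stateShotLaw ρ)
    (X := fun x => ∑ T ∈ lowSet n w, (stateEstimate x T - pauliValue ρ T) ^ 2)
    (K := (lowSet n w).card * 9 ^ w / M) (integrable_finsetSum _ hint)
    (fun x => Finset.sum_nonneg fun _ _ => sq_nonneg _) zero_le_one ht (by
      rw [integral_finsetSum _ hint]
      refine (Finset.sum_le_sum key).trans (le_of_eq ?_)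
      rw [Finset.sum_const, nsmul_eq_mul]
      ring)
  simpa only [mul_one] using h2

/-- The error is measured relative to the Pauli norm, because the second moment of a single outcome
is its square; no bound on the operator norm is needed. -/
theorem measure_observableEstimate_le {O : QOp (Fin n)} (hO : O.IsHermitian) (hM : 0 < M) (w : ℕ)
    {t : ℝ} (ht : 0 < t) : (Measure.pi fun _ : Fin M => observableShotLaw O hO)
      {y | t * pauliNorm O ^ 2 <
        ∑ P ∈ lowSet n w, (observableEstimate y P - (pauliCoeff O P).re) ^ 2} ≤
        ENNReal.ofReal ((lowSet n w).card * 9 ^ w / M / t) := by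
  have := isProbabilityMeasure_observableShotLaw hO
  have hi : ∀ {f : StabLabel n × ℝ → ℝ}, Measurable f → Integrable f (observableShotLaw O hO) := by
    intro f hf
    rw [observableShotLaw_eq]
    exact integrable_discreteLaw _ _ hf
  have hL : ∀ P : Fin n → Fin 4, MemLp (fun y : StabLabel n × ℝ => y.2 * shotWeight P y.1) 2
      (observableShotLaw O hO) := fun P =>
    (memLp_two_iff_integrable_sq (measurable_outcome_mul_shotWeight P).aestronglyMeasurable).2
      (hi ((measurable_outcome_mul_shotWeight P).pow_const 2))
  have key : ∀ P ∈ lowSet n w, ∫ y : Fin M → StabLabel n × ℝ,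
      (observableEstimate y P - (pauliCoeff O P).re) ^ 2
        ∂(Measure.pi fun _ => observableShotLaw O hO) ≤ 9 ^ w * pauliNorm O ^ 2 / M := by
    intro P hP
    have h1 := integral_mean_sub_sq_le (hL P) hM
    rw [integral_outcome_mul_shotWeight hO] at h1
    refine h1.trans ?_
    gcongr
    calc ∫ y, (y.2 * shotWeight P y.1) ^ 2 ∂observableShotLaw O hO
        ≤ ∫ y, 9 ^ w * y.2 ^ 2 ∂observableShotLaw O hO := by
          refine integral_mono (hL P).integrable_sq
            ((hi (measurable_snd.pow_const 2)).const_mul _) fun y => ?_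
          simp only [mul_pow, mul_comm (y.2 ^ 2)]
          gcongr
          exact (shotWeight_sq_le P y.1).trans
            (pow_le_pow_right₀ (by norm_num) (Finset.mem_filter.1 hP).2)
      _ = 9 ^ w * pauliNorm O ^ 2 := by
          rw [integral_const_mul, integral_outcome_sq, pauliNorm_sq_eq_trace hO]
  have hint : ∀ P ∈ lowSet n w, Integrable (fun y : Fin M → StabLabel n × ℝ =>
      (observableEstimate y P - (pauliCoeff O P).re) ^ 2)
        (Measure.pi fun _ => observableShotLaw O hO) :=
    fun P _ => integrable_mean_sub_sq (hL P) _
  exact measure_lt_le_of_integral_le (μ := Measure.pi fun _ : Fin M => observableShotLaw O hO)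
    (X := fun y => ∑ P ∈ lowSet n w, (observableEstimate y P - (pauliCoeff O P).re) ^ 2)
    (K := (lowSet n w).card * 9 ^ w / M) (integrable_finsetSum _ hint)
    (fun x => Finset.sum_nonneg fun _ _ => sq_nonneg _) (sq_nonneg _) ht (by
      rw [integral_finsetSum _ hint]
      refine (Finset.sum_le_sum key).trans (le_of_eq ?_)
      rw [Finset.sum_const, nsmul_eq_mul]
      ring)

end Estimates

/-! ## Layers of disjoint gates -/

section GateLayer

variable {n : ℕ}

/-- Splitting a bit string into its restrictions to the blocks. -/
def blockEquiv (B : Fin n → Fin n) : Bits (Fin n) ≃ ∀ q, Bits {i : Fin n // B i = q} where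
  toFun x q i := x i
  invFun y i := y (B i) ⟨i, rfl⟩
  left_inv x := rfl
  right_inv y := by
    funext q i
    obtain ⟨i, rfl⟩ := i
    rfl

theorem sum_prod_blocks (B : Fin n → Fin n) (F : ∀ q, Bits {i : Fin n // B i = q} → ℂ) :
    ∑ x : Bits (Fin n), ∏ q, F q (fun i => x i) = ∏ q, ∑ u, F q u := by
  rw [Finset.prod_univ_sum, Fintype.piFinset_univ]
  exact Fintype.sum_equiv (blockEquiv B) _ _ fun x => rfl

/-- The tensor product of operators on the blocks. -/
def blockOp (B : Fin n → Fin n) (A : ∀ q, QOp {i : Fin n // B i = q}) : QOp (Fin n) :=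
  Matrix.of fun x y => ∏ q, A q (fun i => x i) (fun i => y i)

theorem blockOp_mul (B : Fin n → Fin n) (A A' : ∀ q, QOp {i : Fin n // B i = q}) :
    blockOp B A * blockOp B A' = blockOp B fun q => A q * A' q := by
  ext x z
  simp only [blockOp, Matrix.mul_apply, Matrix.of_apply, ← Finset.prod_mul_distrib]
  exact sum_prod_blocks B fun q u => A q (fun i => x i) u * A' q u (fun i => z i)

theorem conjTranspose_blockOp (B : Fin n → Fin n) (A : ∀ q, QOp {i : Fin n // B i = q}) :
    (blockOp B A).conjTranspose = blockOp B fun q => (A q).conjTranspose := by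
  ext x y
  simp [blockOp, Matrix.conjTranspose_apply]

theorem trace_blockOp (B : Fin n → Fin n) (A : ∀ q, QOp {i : Fin n // B i = q}) :
    (blockOp B A).trace = ∏ q, (A q).trace :=
  sum_prod_blocks B fun q u => A q u u

theorem pauliOp_eq_blockOp (B : Fin n → Fin n) (P : Fin n → Fin 4) :
    pauliOp P = blockOp B fun q => pauliOp fun i : {i : Fin n // B i = q} => P i := by
  ext x y
  simp only [pauliOp, tensorOp, blockOp, Matrix.of_apply]
  exact (Fintype.prod_fiberwise B fun i => pauliOne (P i) (x i) (y i)).symm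

/-- On a block where `P` is the identity the gate cancels, and the trace of `T` on that block
vanishes unless `T` is the identity there too. So `T` lives on the blocks that meet the support of
`P`, at most one per letter of `P`. -/
theorem IsGateLayer.pauliWeight_le_of_ptm_ne_zero {a : ℕ} {U : QUnitary (Fin n)} (h : IsGateLayer a U)
    {P T : Fin n → Fin 4} (hPT : ptm (U : QOp (Fin n)) P T ≠ 0) :
    pauliWeight T ≤ a * pauliWeight P := by
  obtain ⟨B, hB, g, hg⟩ := h
  have hU : (U : QOp (Fin n)) = blockOp B fun q => (g q : QOp _) := by
    ext x y
    exact hg x y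
  have key : ∀ q, (∀ i, B i = q → P i = 0) → ∀ i, B i = q → T i = 0 := by
    intro q hP
    have h1 : ptmC (U : QOp (Fin n)) P T ≠ 0 := by
      rw [← ofReal_ptm]
      exact_mod_cast hPT
    rw [ptmC, hU, pauliOp_eq_blockOp B P, pauliOp_eq_blockOp B T, conjTranspose_blockOp,
      blockOp_mul, blockOp_mul, blockOp_mul, trace_blockOp] at h1
    have h2 := Finset.prod_ne_zero_iff.1 (div_ne_zero_iff.1 h1).1 q (Finset.mem_univ q)
    have h3 : (pauliOp fun i : {i : Fin n // B i = q} => P i) = pauliOp fun _ => 0 := by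
      congr 1
      funext i
      exact hP i i.2
    have h4 : (pauliOp fun _ : {i : Fin n // B i = q} => 0) = 1 := by
      simp [pauliOp, pauliOne, tensorOp_one]
    rw [h3, h4, Matrix.mul_one, QUnitary.conjTranspose_mul_self, ← h4, trace_pauliOp_mul] at h2
    intro i hi
    by_contra hT
    refine h2 (if_neg fun h5 => hT ?_)
    exact congrFun h5 ⟨i, hi⟩
  let S := (Finset.univ.filter fun i => P i ≠ 0).image B
  calc pauliWeight T ≤ (S.biUnion fun q => Finset.univ.filter fun i => B i = q).card := by
        refine Finset.card_le_card fun i hi => ?_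
        rw [Finset.mem_biUnion]
        refine ⟨B i, ?_, by simp⟩
        by_contra hS
        refine (Finset.mem_filter.1 hi).2 (key (B i) (fun i' hi' => ?_) i rfl)
        by_contra hP
        exact hS (Finset.mem_image.2 ⟨i', by simpa using hP, hi'⟩)
    _ ≤ S.card * a := Finset.card_biUnion_le_card_mul _ _ _ fun q _ => hB q
    _ ≤ pauliWeight P * a := by
        gcongr
        exact Finset.card_image_le
    _ = a * pauliWeight P := mul_comm _ _

/-- The last Heisenberg step goes through the first layer and starts from operators of weight at
most `k`. -/
theorem pauliWeight_le_of_evolvedCoeff_ne_zero {a L k : ℕ} (hL : 1 ≤ L)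
    {U : Fin L → QUnitary (Fin n)} (hU : IsGateLayer a (U ⟨0, hL⟩)) {c : (Fin n → Fin 4) → ℝ}
    {T : Fin n → Fin 4} (h : evolvedCoeff k L (layerPtm U) c L T ≠ 0) : pauliWeight T ≤ a * k := by
  obtain ⟨i, rfl⟩ : ∃ i, L = i + 1 := ⟨L - 1, by omega⟩
  obtain ⟨P, hP, h1⟩ := Finset.exists_ne_zero_of_sum_ne_zero h
  have h2 := right_ne_zero_of_mul h1
  rw [show i + 1 - (1 + i) = 0 by omega, layerPtm_of_lt U hL] at h2
  exact (hU.pauliWeight_le_of_ptm_ne_zero h2).trans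
    (Nat.mul_le_mul_left a (Finset.mem_filter.1 hP).2)

theorem card_lowSet_le (n k : ℕ) : (lowSet n k).card ≤ (4 * n + 1) ^ k := by
  rw [← length_lowList]
  refine le_trans (Finset.card_le_card fun P hP => ?_) (List.toFinset_card_le _)
  rw [List.mem_toFinset, mem_lowList]
  exact (Finset.mem_filter.1 hP).2

end GateLayer

/-! ## The error of the estimate -/

section ErrorBound

variable {n L : ℕ}

/-- For `c = ±1`, `(1 + c P)² = 2 (1 + c P)`, so `1 + c P` is positive and has nonnegative
expectation value. -/
theorem abs_pauliValue_le {ρ : QOp (Fin n)} (h : IsState ρ) (P : Fin n → Fin 4) :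
    |pauliValue ρ P| ≤ 1 := by
  have key : ∀ c : ℝ, c * c = 1 → 0 ≤ 1 + c * pauliValue ρ P := by
    intro c hc
    have h1 := (h.1.mul_mul_conjTranspose_same (1 + (c : ℂ) • pauliOp P)).trace_nonneg
    have h2 : (1 + (c : ℂ) • pauliOp P).conjTranspose = 1 + (c : ℂ) • pauliOp P := by
      simp [Matrix.conjTranspose_smul, pauliOp_conjTranspose]
    have hc' : (c : ℂ) * c = 1 := by exact_mod_cast hc
    have h3 : (1 + (c : ℂ) • pauliOp P) * (1 + (c : ℂ) • pauliOp P) =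
        (2 : ℂ) • (1 + (c : ℂ) • pauliOp P) := by
      simp only [mul_add, add_mul, one_mul, mul_one, Matrix.smul_mul, Matrix.mul_smul, smul_smul,
        pauliOp_mul_self, hc']
      module
    rw [Matrix.trace_mul_comm, h2, ← Matrix.mul_assoc, h3, Matrix.smul_mul, Matrix.trace_smul,
      Matrix.add_mul, Matrix.one_mul, Matrix.trace_add, h.2, Matrix.smul_mul, Matrix.trace_smul] at h1
    have h4 := (Complex.le_def.1 h1).1
    simp [Complex.mul_re] at h4
    rw [pauliValue]
    linarith
  rw [abs_le]
  constructor
  · linarith [key 1 (by norm_num)]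
  · linarith [key (-1) (by norm_num)]

theorem abs_sum_mul_le {κ : Type*} (s : Finset κ) (u v : κ → ℝ) {x y z : ℝ}
    (hu : ∑ i ∈ s, u i ^ 2 ≤ x) (hv : ∑ i ∈ s, v i ^ 2 ≤ y) (hz : 0 ≤ z) (h : x * y ≤ z ^ 2) :
    |∑ i ∈ s, u i * v i| ≤ z := by
  refine abs_le_of_sq_le_sq ?_ hz
  refine (Finset.sum_mul_sq_le_sq_mul_sq s u v).trans (le_trans ?_ h)
  have h1 : 0 ≤ ∑ i ∈ s, u i ^ 2 := Finset.sum_nonneg fun _ _ => sq_nonneg _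
  have h2 : 0 ≤ ∑ i ∈ s, v i ^ 2 := Finset.sum_nonneg fun _ _ => sq_nonneg _
  exact mul_le_mul hu hv h2 (h1.trans hu)

theorem abs_estimate_sub_le {a k N : ℕ} (hL : 1 ≤ L) {U : Fin L → QUnitary (Fin n)}
    (hU : IsGateLayer a (U ⟨0, hL⟩)) {O ρ : QOp (Fin n)} (hO : O.IsHermitian) (hρ : IsState ρ)
    {ε : ℝ} (h0 : 0 < ε) (h1 : ε < 1) (hN1 : 1 ≤ N) (hN : (lowSet n (a * k)).card ≤ N)
    {e r : (Fin n → Fin 4) → ℝ}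
    (he : ∑ P ∈ lowSet n k, (e P - (pauliCoeff O P).re) ^ 2 ≤ ε ^ 2 / (16 * N) * pauliNorm O ^ 2)
    (hr : ∑ T ∈ lowSet n (a * k), (r T - pauliValue ρ T) ^ 2 ≤ ε ^ 2 / 64)
    (ht : (∑ P, (pauliCoeff O P).re * pathValue k (layerPtm U) (pauliValue ρ) L false P) ^ 2 ≤
      ε ^ 2 / 4 * pauliNorm O ^ 2) :
    |∑ T, evolvedCoeff k L (layerPtm U) e L T * r T - expectationValue O ρ U| ≤
      ε * pauliNorm O := by
  set ν := pauliNorm O with hν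
  have hν0 : 0 ≤ ν := Real.sqrt_nonneg _
  set A : (Fin n → Fin 4) → ℝ := fun P => (pauliCoeff O P).re with hA
  have hNR : (1 : ℝ) ≤ N := by exact_mod_cast hN1
  have hsupp : ∀ (c : (Fin n → Fin 4) → ℝ) (g : (Fin n → Fin 4) → ℝ),
      ∑ T, evolvedCoeff k L (layerPtm U) c L T * g T =
        ∑ T ∈ lowSet n (a * k), evolvedCoeff k L (layerPtm U) c L T * g T := by
    intro c g
    refine (Finset.sum_subset (Finset.subset_univ _) fun T _ hT => ?_).symm
    by_contra h
    exact hT (Finset.mem_filter.2 ⟨Finset.mem_univ _,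
      pauliWeight_le_of_evolvedCoeff_ne_zero hL hU (left_ne_zero_of_mul h)⟩)
  have hsq : ∀ c : (Fin n → Fin 4) → ℝ, ∑ T ∈ lowSet n (a * k),
      evolvedCoeff k L (layerPtm U) c L T ^ 2 ≤ ∑ P ∈ lowSet n k, c P ^ 2 := by
    intro c
    refine (Finset.sum_le_sum_of_subset_of_nonneg (Finset.subset_univ _)
      fun _ _ _ => sq_nonneg _).trans ?_
    obtain ⟨i, rfl⟩ : ∃ i, L = i + 1 := ⟨L - 1, by omega⟩
    exact sum_evolvedCoeff_sq_le k U c i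
  have hsumA : ∑ P ∈ lowSet n k, A P ^ 2 ≤ ν ^ 2 := by
    rw [hν, pauliNorm_sq_eq_sum hO]
    exact Finset.sum_le_sum_of_subset_of_nonneg (Finset.subset_univ _) fun _ _ _ => sq_nonneg _
  have hε : ε ^ 2 / (16 * N) ≤ 1 / 16 := by
    rw [div_le_div_iff₀ (by positivity) (by norm_num)]
    nlinarith
  -- From `e² ≤ 2 (e - A)² + 2 A²`; the constant `2/16 + 2` is rounded up to `3`.
  have hsume : ∑ P ∈ lowSet n k, e P ^ 2 ≤ 3 * ν ^ 2 := by
    calc ∑ P ∈ lowSet n k, e P ^ 2 ≤ ∑ P ∈ lowSet n k, (2 * (e P - A P) ^ 2 + 2 * A P ^ 2) :=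
          Finset.sum_le_sum fun P _ => by nlinarith [sq_nonneg (e P - A P - A P)]
      _ = 2 * ∑ P ∈ lowSet n k, (e P - A P) ^ 2 + 2 * ∑ P ∈ lowSet n k, A P ^ 2 := by
          rw [Finset.sum_add_distrib, Finset.mul_sum, Finset.mul_sum]
      _ ≤ 2 * (1 / 16 * ν ^ 2) + 2 * ν ^ 2 := by
          have : ε ^ 2 / (16 * N) * ν ^ 2 ≤ 1 / 16 * ν ^ 2 := by gcongr
          linarith
      _ ≤ 3 * ν ^ 2 := by nlinarith [sq_nonneg ν]
  -- Errors in the estimates of the state, using `3 / 64 ≤ 1 / 16`.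
  have hfirst : |∑ T ∈ lowSet n (a * k), evolvedCoeff k L (layerPtm U) e L T *
      (r T - pauliValue ρ T)| ≤ ε * ν / 4 :=
    abs_sum_mul_le _ _ _ ((hsq e).trans hsume) hr (by positivity)
      (by nlinarith [sq_nonneg (ε * ν)])
  -- Errors in the estimates of the observable: `∑ (Tr[T ρ])² ≤ N` over the low-weight operators
  -- cancels the `N` in the accuracy demanded of `e`.
  have hsecond : |∑ T ∈ lowSet n (a * k), evolvedCoeff k L (layerPtm U) (e - A) L T *
      pauliValue ρ T| ≤ ε * ν / 4 := by
    refine abs_sum_mul_le (y := N) _ _ _ ((hsq _).trans he) ?_ (by positivity) (le_of_eq ?_)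
    · calc ∑ T ∈ lowSet n (a * k), pauliValue ρ T ^ 2 ≤ ∑ T ∈ lowSet n (a * k), (1 : ℝ) :=
            Finset.sum_le_sum fun T _ => (sq_le_one_iff_abs_le_one _).2 (abs_pauliValue_le hρ T)
        _ ≤ N := by
            rw [Finset.sum_const, nsmul_eq_mul, mul_one]
            exact_mod_cast hN
    · field_simp
      ring
  have hthird := abs_le_of_sq_le_sq (ht.trans (le_of_eq (by ring : _ = (ε * ν / 2) ^ 2)))
    (by positivity)
  -- Duality after all `L` layers: paths of length zero have the values of `ρ` as total and zero as
  -- loss.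
  have hexp : expectationValue O ρ U =
      ∑ T ∈ lowSet n (a * k), evolvedCoeff k L (layerPtm U) A L T * pauliValue ρ T +
        ∑ P, A P * pathValue k (layerPtm U) (pauliValue ρ) L false P := by
    have h2 := sum_evolvedCoeff_mul k (layerPtm U) A (pauliValue ρ) (le_refl L)
    rw [Nat.sub_self] at h2
    simp only [pathValue] at h2
    simp only [if_true, Bool.false_eq_true, if_false, sub_zero] at h2
    rw [← hsupp, h2, expectationValue_eq k hO, ← Finset.sum_add_distrib]
    exact Finset.sum_congr rfl fun P _ => by ring
  have hsplit : ∑ T, evolvedCoeff k L (layerPtm U) e L T * r T - expectationValue O ρ U =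
      ∑ T ∈ lowSet n (a * k), evolvedCoeff k L (layerPtm U) e L T * (r T - pauliValue ρ T) +
      ∑ T ∈ lowSet n (a * k), evolvedCoeff k L (layerPtm U) (e - A) L T *
        pauliValue ρ T -
      ∑ P, A P * pathValue k (layerPtm U) (pauliValue ρ) L false P := by
    rw [hexp, hsupp, ← sub_sub, ← Finset.sum_sub_distrib, ← Finset.sum_add_distrib]
    congr 1
    refine Finset.sum_congr rfl fun T _ => ?_
    rw [evolvedCoeff_sub]
    ring
  rw [hsplit]
  have h5 := abs_le.1 hfirst
  have h6 := abs_le.1 hsecond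
  have h7 := abs_le.1 hthird
  rw [abs_le]
  constructor <;> linarith [h5.1, h5.2, h6.1, h6.2, h7.1, h7.2]

end ErrorBound

/-! ## Resource bounds -/

section Resources

variable {n : ℕ} {ε δ : ℝ}

theorem one_le_log_factor (hε : 0 < ε) (hε1 : ε < 1) (hδ : 0 < δ) (hδ1 : δ < 1) :
    1 ≤ 1 + Real.log (ε⁻¹ * δ⁻¹) := by
  have h := Real.log_nonneg (one_le_mul_of_one_le_of_one_le (one_le_inv₀ hε |>.2 hε1.le)
    (one_le_inv₀ hδ |>.2 hδ1.le))
  linarith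

theorem resourceBound_mul (hn : 2 ≤ n) (c d : ℝ) :
    resourceBound c n ε δ * resourceBound d n ε δ = resourceBound (c + d) n ε δ := by
  have : (0 : ℝ) < n := by exact_mod_cast (by omega : 0 < n)
  rw [resourceBound, resourceBound, resourceBound, ← Real.rpow_add this, add_mul]

theorem resourceBound_pos (hn : 2 ≤ n) (c : ℝ) : 0 < resourceBound c n ε δ :=
  Real.rpow_pos_of_pos (by exact_mod_cast (by omega : 0 < n)) _

theorem resourceBound_pow (hn : 2 ≤ n) (c : ℝ) (m : ℕ) :
    resourceBound c n ε δ ^ m = resourceBound (m * c) n ε δ := by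
  induction m with
  | zero => simp [resourceBound]
  | succ m ih =>
    rw [pow_succ, ih, resourceBound_mul hn]
    congr 1
    push_cast
    ring

theorem resourceBound_mono (hn : 2 ≤ n) (hε : 0 < ε) (hε1 : ε < 1) (hδ : 0 < δ) (hδ1 : δ < 1)
    {c d : ℝ} (h : c ≤ d) : resourceBound c n ε δ ≤ resourceBound d n ε δ := by
  have h1 := one_le_log_factor hε hε1 hδ hδ1
  refine Real.rpow_le_rpow_of_exponent_le (by exact_mod_cast (by omega : 1 ≤ n)) ?_
  exact mul_le_mul_of_nonneg_right h (by linarith)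

theorem natPow_le_resourceBound (hn : 2 ≤ n) {m : ℕ} {c : ℝ}
    (h : (m : ℝ) ≤ c * (1 + Real.log (ε⁻¹ * δ⁻¹))) : (n : ℝ) ^ m ≤ resourceBound c n ε δ := by
  rw [← Real.rpow_natCast]
  exact Real.rpow_le_rpow_of_exponent_le (by exact_mod_cast (by omega : 1 ≤ n)) h

theorem two_pow_le_resourceBound (hn : 2 ≤ n) (hε : 0 < ε) (hε1 : ε < 1) (hδ : 0 < δ)
    (hδ1 : δ < 1) (m : ℕ) : (2 : ℝ) ^ m ≤ resourceBound m n ε δ := by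
  have h1 := one_le_log_factor hε hε1 hδ hδ1
  refine le_trans (pow_le_pow_left₀ zero_le_two (by exact_mod_cast hn) m)
    (natPow_le_resourceBound hn ?_)
  exact le_mul_of_one_le_right (Nat.cast_nonneg m) h1

theorem four_mul_add_one_pow_le (hn : 2 ≤ n) (m : ℕ) : (4 * n + 1) ^ m ≤ n ^ (4 * m) := by
  rw [pow_mul]
  refine Nat.pow_le_pow_left ?_ m
  have h2 : 2 * 2 ≤ n * n := Nat.mul_le_mul hn hn
  nlinarith

/-- `(ε² δ)⁻¹ ≤ (ε⁻¹ δ⁻¹)²`, and `log n ≥ log 2 ≥ 1/2` doubles the exponent `2` to `4`. -/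
theorem inv_sq_mul_le_resourceBound (hn : 2 ≤ n) (hε : 0 < ε) (hε1 : ε < 1) (hδ : 0 < δ)
    (hδ1 : δ < 1) : (ε ^ 2 * δ)⁻¹ ≤ resourceBound 4 n ε δ := by
  have h1 := one_le_log_factor hε hε1 hδ hδ1
  have hpos : 0 < ε⁻¹ * δ⁻¹ := by positivity
  have h2 : (ε ^ 2 * δ)⁻¹ ≤ (ε⁻¹ * δ⁻¹) ^ 2 := by
    have hd : 1 ≤ δ⁻¹ := (one_le_inv₀ hδ).2 hδ1.le
    calc (ε ^ 2 * δ)⁻¹ = ε⁻¹ ^ 2 * δ⁻¹ * 1 := by rw [mul_inv, inv_pow, mul_one]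
      _ ≤ ε⁻¹ ^ 2 * δ⁻¹ * δ⁻¹ := by gcongr
      _ = (ε⁻¹ * δ⁻¹) ^ 2 := by ring
  have hlog2 : (1 / 2 : ℝ) ≤ Real.log n := by
    have h3 : Real.log 2 ≤ Real.log n := Real.log_le_log zero_lt_two (by exact_mod_cast hn)
    have h4 := Real.one_sub_inv_le_log_of_pos (zero_lt_two' ℝ)
    linarith
  refine h2.trans ?_
  have h5 : (ε⁻¹ * δ⁻¹) ^ 2 = Real.exp (2 * Real.log (ε⁻¹ * δ⁻¹)) := by
    rw [← Real.exp_log (pow_pos hpos 2), Real.log_pow]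
    norm_num
  rw [h5, resourceBound, Real.rpow_def_of_pos (by exact_mod_cast (by omega : 0 < n)),
    Real.exp_le_exp]
  nlinarith

theorem exists_truncation (hε : 0 < ε) (hε1 : ε < 1) (hδ : 0 < δ) (hδ1 : δ < 1) :
    ∃ k : ℕ, (∀ i < k, ε * ε * δ < 8 * (2 / 3 : ℝ) ^ i) ∧ 8 * (2 / 3 : ℝ) ^ k ≤ ε * ε * δ ∧
      (k : ℝ) ≤ 22 * (1 + Real.log (ε⁻¹ * δ⁻¹)) := by
  have hΛ := one_le_log_factor hε hε1 hδ hδ1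
  have hpos : 0 < ε * ε * δ := by positivity
  have hex : ∃ k : ℕ, 8 * (2 / 3 : ℝ) ^ k ≤ ε * ε * δ := by
    obtain ⟨k, hk⟩ := exists_pow_lt_of_lt_one (show 0 < ε * ε * δ / 8 by positivity)
      (show (2 / 3 : ℝ) < 1 by norm_num)
    exact ⟨k, by linarith⟩
  classical
  refine ⟨Nat.find hex, fun i hi => not_le.1 (Nat.find_min hex hi), Nat.find_spec hex, ?_⟩
  rcases Nat.eq_zero_or_pos (Nat.find hex) with h0 | h0
  · rw [h0, Nat.cast_zero]
    linarith
  · obtain ⟨i, hi⟩ : ∃ i, Nat.find hex = i + 1 := ⟨Nat.find hex - 1, by omega⟩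
    have h1 := not_le.1 (Nat.find_min hex (show i < Nat.find hex by omega))
    have h2 := Real.log_lt_log hpos h1
    have h3 : Real.log (ε * ε * δ) = 2 * Real.log ε + Real.log δ := by
      rw [Real.log_mul (by positivity) hδ.ne', Real.log_mul hε.ne' hε.ne']
      ring
    have h4 : Real.log (8 * (2 / 3 : ℝ) ^ i) = Real.log 8 + i * Real.log (2 / 3) := by
      rw [Real.log_mul (by norm_num) (by positivity), Real.log_pow]
    have h5 : Real.log (ε⁻¹ * δ⁻¹) = -Real.log ε - Real.log δ := by
      rw [Real.log_mul (by positivity) (by positivity), Real.log_inv, Real.log_inv]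
      ring
    -- Minimality at `i = k - 1` and these bounds give `i / 3 < 7 + log(1/(ε² δ))`; hence the
    -- constant `22 = 3 * 7 + 1`.
    have h6 : Real.log 8 ≤ 8 - 1 := Real.log_le_sub_one_of_pos (by norm_num)
    have h7 : Real.log (2 / 3) ≤ 2 / 3 - 1 := Real.log_le_sub_one_of_pos (by norm_num)
    have h8 : Real.log δ < 0 := Real.log_neg hδ hδ1
    have h9 : (i : ℝ) * Real.log (2 / 3) ≤ i * (2 / 3 - 1) := by gcongr
    rw [hi, h5]
    push_cast
    rw [h3, h4] at h2
    have h10 : Real.log ε < 0 := Real.log_neg hε hε1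
    linarith

end Resources

/-! ## The simulation algorithm -/

section Simulation

variable {n L : ℕ}

theorem ComputesHeisenberg.expands {b k X : ℕ} {Q : Prog} {w : CircuitDesc}
    {U : Fin L → QUnitary (Fin n)} (h : ComputesHeisenberg b Q w U) (hn : 1 ≤ n)
    (hX : n ^ (b * (k + 1)) ≤ X) {j : ℕ} (hj : j < L) {P : Fin n → Fin 4}
    (hP : pauliWeight P ≤ k) : Expands w Q X L j P (layerPtm U j P) := by
  obtain ⟨t, s, m, T, he, ht, hm, hs, hT, hU⟩ := h ⟨j, hj⟩ P
  have hpow : n ^ (b * (pauliWeight P + 1)) ≤ X :=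
    (Nat.pow_le_pow_right hn (Nat.mul_le_mul_left b (Nat.succ_le_succ hP))).trans hX
  refine ⟨t, s, m, fun q => if h : q < m then T ⟨q, h⟩ else fun _ => 0, he, ht.trans hpow,
    hm.trans hpow, hs, fun q hq u => ?_, fun T' => ?_⟩
  · simpa only [hq, dif_pos] using hT ⟨q, hq⟩ u
  · rw [layerPtm_of_lt U hj, ptm_eq_of_sum hU, Finset.sum_range]
    refine Finset.sum_congr rfl fun q _ => ?_
    simp only [q.2, dif_pos]

/-- For `x ≥ 1`, `⌈x⌉ ≤ x + 1 ≤ 2 x`, and the factor `2` costs one unit of the exponent. -/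
theorem resourceBound_ceil_le (hn : 2 ≤ n) {ε δ : ℝ} (hε : 0 < ε) (hε1 : ε < 1) (hδ : 0 < δ)
    (hδ1 : δ < 1) {c : ℝ} (hc : 0 ≤ c) :
    (⌈resourceBound c n ε δ⌉₊ : ℝ) ≤ resourceBound (c + 1) n ε δ := by
  have h1 := (Nat.ceil_lt_add_one (resourceBound_pos (ε := ε) (δ := δ) hn c).le).le
  have h2 : 1 ≤ resourceBound c n ε δ := by
    have := resourceBound_mono hn hε hε1 hδ hδ1 hc
    simpa [resourceBound] using this
  have h3 := two_pow_le_resourceBound hn hε hε1 hδ hδ1 1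
  rw [← resourceBound_mul hn]
  push_cast at h3
  nlinarith

/-- The workspace bound of the simulation. -/
theorem exists_workspace (b : ℕ) (hn : 2 ≤ n) {ε δ : ℝ} (hε : 0 < ε) (hε1 : ε < 1) (hδ : 0 < δ)
    (hδ1 : δ < 1) {c : ℝ} (hc : 0 ≤ c) {k : ℕ}
    (hk : (k : ℝ) ≤ 22 * (1 + Real.log (ε⁻¹ * δ⁻¹))) :
    ∃ X : ℕ, 4 ≤ X ∧ n ≤ X ∧ ⌈resourceBound c n ε δ⌉₊ ≤ X ∧ k ≤ X ∧ (4 * n + 1) ^ k ≤ X ∧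
      n ^ (b * (k + 1)) ≤ X ∧
      (4000 * X ^ 5 : ℝ) ≤ resourceBound (5 * (c + 23 * b + 88) + 27) n ε δ := by
  have hΛ := one_le_log_factor hε hε1 hδ hδ1
  set M := ⌈resourceBound c n ε δ⌉₊
  set F : ℝ := c + 23 * b + 88 with hF
  have hb : (0 : ℝ) ≤ b := Nat.cast_nonneg b
  refine ⟨4 + n + M + k + (4 * n + 1) ^ k + n ^ (b * (k + 1)), by omega, by omega, by omega,
    by omega, by omega, by omega, ?_⟩
  have mono : ∀ {d : ℝ}, d ≤ F → resourceBound d n ε δ ≤ resourceBound F n ε δ :=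
    fun h => resourceBound_mono hn hε hε1 hδ hδ1 h
  have h1 : (4 : ℝ) ≤ resourceBound F n ε δ := by
    refine le_trans ?_ ((two_pow_le_resourceBound hn hε hε1 hδ hδ1 2).trans (mono ?_))
    · norm_num
    · push_cast
      linarith
  have h2 : (n : ℝ) ≤ resourceBound F n ε δ := by
    have := natPow_le_resourceBound (ε := ε) (δ := δ) (m := 1) (c := 1) hn (by push_cast; linarith)
    rw [pow_one] at this
    exact this.trans (mono (by linarith))
  have h3 : (M : ℝ) ≤ resourceBound F n ε δ :=
    (resourceBound_ceil_le hn hε hε1 hδ hδ1 hc).trans (mono (by linarith))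
  have h4 : (((4 * n + 1) ^ k : ℕ) : ℝ) ≤ resourceBound F n ε δ := by
    have h5 : (((4 * n + 1) ^ k : ℕ) : ℝ) ≤ ((n ^ (4 * k) : ℕ) : ℝ) := by
      exact_mod_cast four_mul_add_one_pow_le hn k
    refine h5.trans ?_
    rw [Nat.cast_pow]
    refine (natPow_le_resourceBound (c := 88) hn ?_).trans (mono (by linarith))
    push_cast
    linarith
  have h5 : (k : ℝ) ≤ resourceBound F n ε δ := by
    refine le_trans ?_ h4
    exact_mod_cast (Nat.lt_pow_self (by omega : 1 < 4 * n + 1)).le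
  have h6 : ((n ^ (b * (k + 1)) : ℕ) : ℝ) ≤ resourceBound F n ε δ := by
    rw [Nat.cast_pow]
    refine (natPow_le_resourceBound (c := 23 * b) hn ?_).trans (mono (by linarith))
    push_cast
    nlinarith
  have h7 : ((4 + n + M + k + (4 * n + 1) ^ k + n ^ (b * (k + 1)) : ℕ) : ℝ) ≤
      resourceBound (F + 3) n ε δ := by
    -- Six summands, and `6 ≤ 2 ^ 3`. With `4000 ≤ 2 ^ 12` below, the additional exponent is `5 * 3
    -- + 12 = 27`.
    have h8 := two_pow_le_resourceBound hn hε hε1 hδ hδ1 3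
    rw [← resourceBound_mul hn]
    push_cast at h4 h6 h8 ⊢
    nlinarith
  have h9 := two_pow_le_resourceBound hn hε hε1 hδ hδ1 12
  have h10 := pow_le_pow_left₀ (Nat.cast_nonneg _) h7 5
  rw [resourceBound_pow hn] at h10
  calc (4000 * ((4 + n + M + k + (4 * n + 1) ^ k + n ^ (b * (k + 1)) : ℕ) : ℝ) ^ 5 : ℝ)
      ≤ resourceBound (12 : ℕ) n ε δ * resourceBound ((5 : ℕ) * (F + 3)) n ε δ := by
        refine mul_le_mul (le_trans (by norm_num) h9) h10 (by positivity)
          (resourceBound_pos hn _).le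
    _ = resourceBound (5 * F + 27) n ε δ := by
        rw [resourceBound_mul hn]
        congr 1
        push_cast
        ring

/-- `4 n + 1 ≤ n^4` and the bound on `k` give the exponent `88 (a + 1)` for the number of operators;
its cube, `256 = 2^8` and `(ε² δ)⁻¹` contribute `264 (a + 1)`, `8` and `4`. -/
theorem sample_bound (a : ℕ) (hn : 2 ≤ n) {ε δ : ℝ} (hε : 0 < ε) (hε1 : ε < 1) (hδ : 0 < δ)
    (hδ1 : δ < 1) {k : ℕ} (hk : (k : ℝ) ≤ 22 * (1 + Real.log (ε⁻¹ * δ⁻¹))) :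
    256 * ((((4 * n + 1) ^ ((a + 1) * k) : ℕ) : ℝ)) ^ 3 / (ε ^ 2 * δ) ≤
      ⌈resourceBound (264 * (a + 1) + 12) n ε δ⌉₊ := by
  refine le_trans ?_ (Nat.le_ceil _)
  have hN : (((4 * n + 1) ^ ((a + 1) * k) : ℕ) : ℝ) ≤ resourceBound (88 * (a + 1)) n ε δ := by
    have h5 : (((4 * n + 1) ^ ((a + 1) * k) : ℕ) : ℝ) ≤ ((n ^ (4 * ((a + 1) * k)) : ℕ) : ℝ) := by
      exact_mod_cast four_mul_add_one_pow_le hn _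
    refine h5.trans ?_
    rw [Nat.cast_pow]
    refine natPow_le_resourceBound hn ?_
    push_cast
    have : (0 : ℝ) ≤ 4 * (a + 1) := by positivity
    nlinarith
  have h1 := pow_le_pow_left₀ (Nat.cast_nonneg _) hN 3
  rw [resourceBound_pow hn] at h1
  have h2 := two_pow_le_resourceBound hn hε hε1 hδ hδ1 8
  have h3 := inv_sq_mul_le_resourceBound hn hε hε1 hδ hδ1
  rw [div_eq_mul_inv]
  calc 256 * ((((4 * n + 1) ^ ((a + 1) * k) : ℕ) : ℝ)) ^ 3 * (ε ^ 2 * δ)⁻¹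
      ≤ resourceBound (8 : ℕ) n ε δ * resourceBound ((3 : ℕ) * (88 * (a + 1))) n ε δ *
          resourceBound 4 n ε δ := by
        have p1 := resourceBound_pos (ε := ε) (δ := δ) hn ((8 : ℕ) : ℝ)
        have p2 := resourceBound_pos (ε := ε) (δ := δ) hn ((3 : ℕ) * (88 * ((a : ℝ) + 1)))
        refine mul_le_mul (mul_le_mul (le_trans (by norm_num) h2) h1 (by positivity) p1.le) h3
          (by positivity) (by positivity)
    _ = resourceBound (264 * (a + 1) + 12) n ε δ := by
        rw [resourceBound_mul hn, resourceBound_mul hn]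
        congr 1
        push_cast
        ring

/-- Markov's inequality for the squared error; the `8` in the choice of `k` is `4` from the
threshold `(ε/2)²` times `2` from the probability `δ/2`. -/
theorem measure_truncation_le {D : Fin L → Measure (QUnitary (Fin n))}
    [∀ j, IsProbabilityMeasure (D j)] (hD : IsTwirledSequence D) (hL : 1 ≤ L) {ε δ : ℝ}
    (hε : 0 < ε) {k : ℕ} (hk : 8 * (2 / 3 : ℝ) ^ k ≤ ε * ε * δ) {O ρ : QOp (Fin n)}
    (hO : O.IsHermitian) (hρ : IsState ρ) : Measure.pi D {U | ε ^ 2 / 4 * pauliNorm O ^ 2 <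
      (∑ P, (pauliCoeff O P).re * pathValue k (layerPtm U) (pauliValue ρ) L false P) ^ 2} ≤
        ENNReal.ofReal (δ / 2) := by
  have h := integral_truncation_sq_le hD hL k hρ fun P => (pauliCoeff O P).re
  rw [← pauliNorm_sq_eq_sum hO] at h
  refine (measure_lt_le_of_integral_le (integrable_of_continuous_pi ?_) (fun _ => sq_nonneg _)
    (sq_nonneg _) (by positivity) h).trans (ENNReal.ofReal_le_ofReal ?_)
  · exact (continuous_finsetSum _ fun P _ =>
      continuous_const.mul (continuous_pathValue k _ L false P)).pow 2
  · rw [div_le_iff₀ (by positivity), pow_succ]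
    have : 0 < (2 / 3 : ℝ) ^ k := by positivity
    nlinarith

/-- A union bound with product sets. It works with outer measures, so neither the failure event nor
the bad sets have to be measurable. -/
theorem failure_le {κ₁ κ₂ κ₃ : Type*} [MeasurableSpace κ₁] [MeasurableSpace κ₂]
    [MeasurableSpace κ₃] {μ₁ : Measure κ₁} {μ₂ : Measure κ₂} {μ₃ : Measure κ₃}
    [IsProbabilityMeasure μ₁] [IsProbabilityMeasure μ₂] [IsProbabilityMeasure μ₃]
    {S : Set (κ₁ × κ₂ × κ₃)} {p : κ₁ → Prop} (hp : ∀ᵐ u ∂μ₁, p u) {B₁ : Set κ₁} {B₂ : Set κ₂}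
    {B₃ : Set κ₃} {δ : ℝ} (hδ : 0 ≤ δ) (h₁ : μ₁ B₁ ≤ ENNReal.ofReal (δ / 2))
    (h₂ : μ₂ B₂ ≤ ENNReal.ofReal (δ / 4)) (h₃ : μ₃ B₃ ≤ ENNReal.ofReal (δ / 4))
    (hS : ∀ u x y, p u → u ∉ B₁ → x ∉ B₂ → y ∉ B₃ → (u, x, y) ∉ S) :
    (μ₁.prod (μ₂.prod μ₃)) S ≤ ENNReal.ofReal δ := by
  have hsub : S ⊆ ({u | ¬ p u} ×ˢ Set.univ ∪ B₁ ×ˢ Set.univ) ∪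
      (Set.univ ×ˢ (B₂ ×ˢ Set.univ) ∪ Set.univ ×ˢ (Set.univ ×ˢ B₃)) := by
    rintro ⟨u, x, y⟩ hz
    by_contra hc
    simp only [Set.mem_union, Set.mem_prod, Set.mem_univ, and_true, true_and, not_or] at hc
    exact hS u x y (not_not.1 hc.1.1) hc.1.2 hc.2.1 hc.2.2 hz
  calc (μ₁.prod (μ₂.prod μ₃)) S
      ≤ (0 + ENNReal.ofReal (δ / 2)) + (ENNReal.ofReal (δ / 4) + ENNReal.ofReal (δ / 4)) := by
        refine (measure_mono hsub).trans ((measure_union_le _ _).trans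
          (add_le_add ((measure_union_le _ _).trans (add_le_add ?_ ?_))
            ((measure_union_le _ _).trans (add_le_add ?_ ?_))))
        · rw [Measure.prod_prod, ae_iff.1 hp, zero_mul]
        · rwa [Measure.prod_prod, measure_univ, mul_one]
        · rwa [Measure.prod_prod, Measure.prod_prod, measure_univ, measure_univ, one_mul, mul_one]
        · rwa [Measure.prod_prod, Measure.prod_prod, measure_univ, measure_univ, one_mul, one_mul]
    _ = ENNReal.ofReal δ := by
        rw [zero_add, ← ENNReal.ofReal_add (by positivity) (by positivity),
          ← ENNReal.ofReal_add (by positivity) (by positivity)]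
        congr 1
        ring

end Simulation

theorem mainTheorem4 (a b : ℕ) :
    ∃ C₁ C₂ : ℝ, 0 < C₁ ∧ 0 < C₂ ∧ ∀ Q : Prog, ∃ 𝒜 : Prog,
      ∀ (n L : ℕ), 2 ≤ n → 1 ≤ L →
      ∀ (D : Fin L → Measure (QUnitary (Fin n)))
        (desc : (Fin L → QUnitary (Fin n)) → CircuitDesc),
      IsLocallyScramblingCircuit b Q D desc →
      (∀ j : Fin L, (j : ℕ) = 0 → ∀ᵐ U ∂(D j), IsGateLayer a U) →
      ∀ (ε δ : ℝ), 0 < ε → ε < 1 → 0 < δ → δ < 1 →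
      ∀ M : ℕ, M = ⌈resourceBound C₁ n ε δ⌉₊ →
      (∀ᵐ U ∂(Measure.pi D), ∀ (x : Fin M → StabLabel n) (y : Fin M → StabLabel n × ℝ),
        ∃ (t : ℕ) (s : Store), Exec (desc U) 𝒜 (simInput L ε δ x y) t s ∧
          (t : ℝ) ≤ L * resourceBound C₂ n ε δ) ∧
      ∀ (O ρ : QOp (Fin n)) (hO : O.IsHermitian), IsState ρ →
        ((Measure.pi D).prod
            ((Measure.pi fun _ : Fin M => stateShotLaw ρ).prod
              (Measure.pi fun _ : Fin M => observableShotLaw O hO)))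
          {z | ¬ ∃ (t : ℕ) (s : Store),
            Exec (desc z.1) 𝒜 (simInput L ε δ z.2.1 z.2.2) t s ∧
            |s.real 0 0 0 - expectationValue O ρ z.1| ≤ ε * pauliNorm O} ≤ ENNReal.ofReal δ ∧
        ε * pauliNorm O ≤ ε * ‖Matrix.toEuclideanCLM (𝕜 := ℂ) O‖ := by
  refine ⟨264 * (a + 1) + 12, 5 * ((264 * (a + 1) + 12) + 23 * b + 88) + 27, by positivity,
    by positivity, fun Q => ⟨simProg Q, ?_⟩⟩
  intro n L hn hL D desc hD hgate ε δ hε hε1 hδ hδ1 M hM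
  have := hD.prob
  obtain ⟨k, hk1, hk2, hk3⟩ := exists_truncation hε hε1 hδ hδ1
  obtain ⟨X, hX4, hnX, hMX, hkX, hTX, hbX, hX⟩ := exists_workspace b hn hε hε1 hδ hδ1
    (show (0 : ℝ) ≤ 264 * (a + 1) + 12 by positivity) hk3
  rw [← hM] at hMX
  have hruns : ∀ U, ComputesHeisenberg b Q (desc U) U →
      ∀ (x : Fin M → StabLabel n) (y : Fin M → StabLabel n × ℝ),
        Runs (desc U) (simProg Q) (simInput L ε δ x y) (L * (4000 * X ^ 5)) fun s' =>
          s'.real 0 0 0 = ∑ T, evolvedCoeff k L (layerPtm U) (observableEstimate y) L T *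
            stateEstimate x T :=
    fun U hU x y => simProg_runs hL hX4 hnX hMX hkX hTX hk1 hk2 fun j hj P hP =>
      hU.expands (by omega) hbX hj hP
  refine ⟨?_, fun O ρ hO hρ => ⟨?_, mul_le_mul_of_nonneg_left (pauliNorm_le_opNorm hO) hε.le⟩⟩
  · filter_upwards [hD.shallow] with U hU x y
    obtain ⟨t, s, he, ht, -⟩ := hruns U hU x y
    refine ⟨t, s, he, ?_⟩
    calc (t : ℝ) ≤ ((L * (4000 * X ^ 5) : ℕ) : ℝ) := by exact_mod_cast ht
      _ = L * (4000 * X ^ 5) := by push_cast; rfl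
      _ ≤ _ := by gcongr
  · have := isProbabilityMeasure_stateShotLaw hρ
    have := isProbabilityMeasure_observableShotLaw hO
    -- One number that bounds the count of operators and the factor `9^w` for both weights in use,
    -- `w = k` and `w = a * k`, also if `a = 0`.
    set N := (4 * n + 1) ^ ((a + 1) * k) with hN
    have hN1 : 1 ≤ N := Nat.one_le_pow _ _ (by omega)
    have hNR : (1 : ℝ) ≤ N := by exact_mod_cast hN1
    have hlow : ∀ w, w ≤ (a + 1) * k → (lowSet n w).card ≤ N ∧ 9 ^ w ≤ N := fun w hw =>
      ⟨(card_lowSet_le n w).trans (Nat.pow_le_pow_right (by omega) hw),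
        (Nat.pow_le_pow_left (by omega) w).trans (Nat.pow_le_pow_right (by omega) hw)⟩
    have hMN := sample_bound a hn hε hε1 hδ hδ1 hk3
    rw [← hM, ← hN, div_le_iff₀ (by positivity)] at hMN
    have hM0 : (0 : ℝ) < M := by
      by_contra h
      have h1 : (0 : ℝ) < 256 * (N : ℝ) ^ 3 := by positivity
      have h2 : (0 : ℝ) < ε ^ 2 * δ := by positivity
      nlinarith
    have hM0' : 0 < M := by exact_mod_cast hM0
    -- The threshold `ε² / (64 N)` lies below both accuracies, `ε² / 64` for the state and `ε² / (16
    -- N)` for the observable; then `M ≥ 256 N³ / (ε² δ)` gives `δ / 4`.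
    have hprob : ∀ w t, w ≤ (a + 1) * k → ε ^ 2 / (64 * N) ≤ t →
        ENNReal.ofReal ((lowSet n w).card * 9 ^ w / M / t) ≤ ENNReal.ofReal (δ / 4) := by
      intro w t hw ht
      have ht0 : 0 < t := lt_of_lt_of_le (by positivity) ht
      have h1 : ((lowSet n w).card : ℝ) ≤ N := by exact_mod_cast (hlow w hw).1
      have h2 : (9 : ℝ) ^ w ≤ N := by exact_mod_cast (hlow w hw).2
      refine ENNReal.ofReal_le_ofReal ?_
      rw [div_le_iff₀ ht0, div_le_iff₀ hM0]
      calc ((lowSet n w).card : ℝ) * 9 ^ w ≤ N * N := by gcongr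
        _ = 256 * (N : ℝ) ^ 3 / (256 * N) := by field_simp
        _ ≤ M * (ε ^ 2 * δ) / (256 * N) := by gcongr
        _ = δ / 4 * (ε ^ 2 / (64 * N)) * M := by field_simp; norm_num
        _ ≤ δ / 4 * t * M := by gcongr
    have hgate0 : ∀ᵐ U ∂(Measure.pi D), IsGateLayer a (U ⟨0, hL⟩) :=
      (measurePreserving_eval D ⟨0, hL⟩).quasiMeasurePreserving.ae (hgate ⟨0, hL⟩ rfl)
    refine failure_le (hD.shallow.and hgate0) hδ.le
      (measure_truncation_le (hD.isTwirledSequence) hL hε hk2 hO hρ)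
      ((measure_stateEstimate_le hρ hM0' (a * k) (t := ε ^ 2 / 64) (by positivity)).trans
        (hprob _ _ (Nat.mul_le_mul_right k (Nat.le_succ a)) ?_))
      ((measure_observableEstimate_le hO hM0' k (t := ε ^ 2 / (16 * N)) (by positivity)).trans
        (hprob _ _ (Nat.le_mul_of_pos_left k (Nat.succ_pos a)) ?_)) ?_
    · gcongr
      linarith
    · gcongr
      norm_num
    · intro U x y hU hB1 hB2 hB3 hbad
      obtain ⟨t, s, he, -, hs⟩ := hruns U hU.1 x y
      refine hbad ⟨t, s, he, ?_⟩
      rw [hs]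
      exact abs_estimate_sub_le hL hU.2 hO hρ hε hε1 hN1
        (hlow _ (Nat.mul_le_mul_right k (Nat.le_succ a))).1 (not_lt.1 hB3) (not_lt.1 hB2)
        (not_lt.1 hB1)
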